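/- Let $\mathbb{D}=\mathbb{R}^2\times\mathbb{T}^1$ with $\mathbb{T}^1=\mathbb{R}/\mathbb{Z}$. For $f\in L^2(\mathbb{D})^3$ write $$f_n(k)=\frac1{2\pi}\int_{\mathbb{R}^2}\int_{\mathbb{T}^1}f(x,z)\,e^{-i(k\cdot x+2\pi nz)}\,dz\,dx,\qquad k\in\mathbb{R}^2,\ n\in\mathbb{Z},$$ for its Fourier transform (the horizontal integral being understood in the $L^2$ sense), and $(Qf)(x)=\int_{\mathbb{T}^1}f(x,z)\,dz$ for its vertical average. Let $\mathbb{P}$ be the Leray projector, i.e. the orthogonal projector of $L^2(\mathbb{D})^3$ onto the divergence-free fields, let $e_3=(0,0,1)$, and let $\langle\Omega\rangle=(1+|\Omega|^2)^{1/2}$. For every $R>0$ there is a constant $C_R>0$, depending only on $R$, such that the following holds for every $\Omega\in\mathbb{R}$ and every real vector field $\tilde u_0\in L^2(\mathbb{D})^3$ with $Q\tilde u_0=0$, $\operatorname{div}\tilde u_0=0$ and $$\operatorname{supp}\,(\tilde u_0)_n(k)\subset\mathcal{B}_R=\Bigl\{(k,n)\in\mathbb{R}^2\times\mathbb{Z}\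 \Big|\ \sqrt{|k|^2+4\pi^2n^2}\le R\Bigr\}.$$ The linear Rossby equation $$\partial_t\tilde u+\Omega\,\mathbb{P}(e_3\wedge\tilde u)=\Delta\tilde u,\qquad \operatorname{div}\tilde u=0,$$ has a unique solution $\tilde u\in C^0([0,\infty),L^2(\mathbb{D})^3)$ (in the sense of distributions in space) with $\tilde u(0)=\tilde u_0$, and for all $p\in[1,\infty]$ and $q\in[2,\infty]$ with $\frac1p+\frac2q\le1$, $$\|\tilde u\|_{L^p(\mathbb{R}_+,L^q(\mathbb{D}))}\le C_R\,\langle\Omega\rangle^{-\frac1{4p}}\,\|\tilde u_0\|_{L^2(\mathbb{D})}.$$ -/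

import Mathlib

open MeasureTheory Set
open scoped ENNReal InnerProductSpace FourierTransform ContDiff

noncomputable section

/-- The layer `ℝ² × 𝕋¹` with `𝕋¹ = ℝ/ℤ`; its measure is the product of the Lebesgue measures
(so the circle has total mass `1`). -/
abbrev Layer : Type := EuclideanSpace ℝ (Fin 2) × UnitAddCircle

/-- Values of velocity fields: `ℝ³` with the Euclidean norm. -/
abbrev Vec3 : Type := EuclideanSpace ℝ (Fin 3)

/-- The space `L²(𝔻)³` of real square-integrable vector fields on the layer. -/
abbrev L2Field : Type := Lp Vec3 2 (volume : Measure Layer)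

/-- The universal covering `ℝ³ → ℝ² × 𝕋¹`, `(y₁, y₂, y₃) ↦ ((y₁, y₂), y₃ mod 1)`. -/
def cover (y : Vec3) : Layer := (!₂[y 0, y 1], (y 2 : UnitAddCircle))

section Calculus

variable {F : Type*} [NormedAddCommGroup F] [NormedSpace ℝ F]

/-- Smooth compactly supported functions on the layer: `φ` is smooth when its lift to the
universal covering `ℝ³` is smooth. -/
def IsTestFunction (φ : Layer → F) : Prop :=
  ContDiff ℝ ∞ (fun y : Vec3 => φ (cover y)) ∧ HasCompactSupport φ

/-- The partial derivative in direction `j`, where `0, 1` are the two horizontal directions and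
`2` is the vertical one. -/
def partialD (j : Fin 3) (φ : Layer → F) (p : Layer) : F :=
  deriv (fun s : ℝ => φ (p + cover (EuclideanSpace.single j s))) 0

/-- The Laplacian in all three space variables. -/
def laplace (φ : Layer → F) (p : Layer) : F :=
  ∑ j : Fin 3, partialD j (partialD j φ) p

end Calculus

/-- The gradient in all three space variables. -/
def grad (φ : Layer → ℝ) (p : Layer) : Vec3 := WithLp.toLp 2 fun j => partialD j φ p

section TestFunctionFacts

variable {F : Type*} [NormedAddCommGroup F] [NormedSpace ℝ F]

theorem cover_add (y w : Vec3) : cover (y + w) = cover y + cover w := by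
  refine Prod.ext ?_ ?_
  · ext i
    fin_cases i <;> simp [cover]
  · simp [cover]

theorem isOpenQuotientMap_cover : IsOpenQuotientMap cover := by
  let e : Vec3 → EuclideanSpace ℝ (Fin 2) × ℝ := fun y => (!₂[y 0, y 1], y 2)
  let e' : EuclideanSpace ℝ (Fin 2) × ℝ → Vec3 := fun q => !₂[q.1 0, q.1 1, q.2]
  have he : Continuous e := by
    refine Continuous.prodMk ?_ (by fun_prop)
    refine (PiLp.continuous_toLp 2 _).comp (continuous_pi fun i => ?_)
    fin_cases i <;> simp <;> fun_prop
  have he' : Continuous e' := by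
    refine (PiLp.continuous_toLp 2 _).comp (continuous_pi fun i => ?_)
    fin_cases i <;> simp <;> fun_prop
  let h : Vec3 ≃ₜ EuclideanSpace ℝ (Fin 2) × ℝ :=
    { toFun := e
      invFun := e'
      left_inv := fun y => by ext i; fin_cases i <;> simp [e, e']
      right_inv := fun q => by
        refine Prod.ext ?_ ?_
        · ext i; fin_cases i <;> simp [e, e']
        · simp [e, e']
      continuous_toFun := he
      continuous_invFun := he' }
  have hq : IsOpenQuotientMap (fun t : ℝ => (t : UnitAddCircle)) :=
    QuotientAddGroup.isOpenQuotientMap_mk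
  exact (IsOpenQuotientMap.id.prodMap hq).comp h.isOpenQuotientMap

theorem IsTestFunction.continuous {φ : Layer → F} (hφ : IsTestFunction φ) : Continuous φ :=
  isOpenQuotientMap_cover.isQuotientMap.continuous_iff.2 hφ.1.continuous

theorem partialD_cover {φ : Layer → F} (hφ : IsTestFunction φ) (j : Fin 3) (y : Vec3) :
    partialD j φ (cover y) =
      fderiv ℝ (fun y : Vec3 => φ (cover y)) y (EuclideanSpace.single j 1) := by
  have hd : DifferentiableAt ℝ (fun y : Vec3 => φ (cover y)) y :=
    (hφ.1.differentiable (by simp)).differentiableAt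
  rw [← hd.lineDeriv_eq_fderiv, lineDeriv]
  unfold partialD
  congr 1
  funext s
  rw [← cover_add]
  congr 3
  ext i
  simp

theorem IsTestFunction.partialD {φ : Layer → F} (hφ : IsTestFunction φ) (j : Fin 3) :
    IsTestFunction (partialD j φ) := by
  constructor
  · have : (fun y : Vec3 => _root_.partialD j φ (cover y)) = fun y =>
        fderiv ℝ (fun y : Vec3 => φ (cover y)) y (EuclideanSpace.single j 1) := by
      funext y; exact partialD_cover hφ j y
    rw [this]
    exact (hφ.1.fderiv_right (m := ∞) (by simp)).clm_apply contDiff_const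
  · refine HasCompactSupport.intro hφ.2.isCompact fun p hp => ?_
    have h0 : φ =ᶠ[nhds p] 0 := notMem_tsupport_iff_eventuallyEq.1 hp
    have hc : Continuous fun s : ℝ => p + cover (EuclideanSpace.single j s) := by
      refine continuous_const.add (isOpenQuotientMap_cover.continuous.comp ?_)
      refine (PiLp.continuous_toLp 2 _).comp (continuous_pi fun i => ?_)
      by_cases hij : i = j
      · subst hij; simpa using continuous_id'
      · simpa [hij] using continuous_const
    have hp0 : p + cover (EuclideanSpace.single j 0) = p := by
      have hs : EuclideanSpace.single j (0 : ℝ) = 0 := by ext i; simp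
      have : cover 0 + cover 0 = cover 0 := by rw [← cover_add, add_zero]
      have h00 : cover 0 = 0 := by simpa using this
      rw [hs, h00, add_zero]
    have h1 : (fun s : ℝ => φ (p + cover (EuclideanSpace.single j s))) =ᶠ[nhds 0] fun _ => 0 := by
      have := hc.tendsto 0
      rw [hp0] at this
      exact this.eventually h0
    unfold _root_.partialD
    rw [h1.deriv_eq]
    simp

theorem IsTestFunction.memLp_grad {φ : Layer → ℝ} (hφ : IsTestFunction φ) :
    MemLp (grad φ) 2 volume := by
  have hc : Continuous (grad φ) :=
    (PiLp.continuous_toLp 2 _).comp (continuous_pi fun j => (hφ.partialD j).continuous)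
  refine hc.memLp_of_hasCompactSupport ?_
  have hs : ∀ j, HasCompactSupport (_root_.partialD j φ) := fun j => (hφ.partialD j).2
  refine HasCompactSupport.intro (((hs 0).isCompact.union (hs 1).isCompact).union
    (hs 2).isCompact) fun p hp => ?_
  simp only [Set.mem_union, not_or] at hp
  ext j
  fin_cases j
  · exact image_eq_zero_of_notMem_tsupport (f := _root_.partialD 0 φ) hp.1.1
  · exact image_eq_zero_of_notMem_tsupport (f := _root_.partialD 1 φ) hp.1.2
  · exact image_eq_zero_of_notMem_tsupport (f := _root_.partialD 2 φ) hp.2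

end TestFunctionFacts

/-- `div v = 0` in the sense of distributions. -/
def IsDivFree (v : L2Field) : Prop :=
  ∀ φ : Layer → ℝ, IsTestFunction φ → ∫ p, ⟪v p, grad φ p⟫_ℝ = 0

theorem integral_inner_grad (v : L2Field) {φ : Layer → ℝ} (hφ : IsTestFunction φ) :
    ∫ p, ⟪v p, grad φ p⟫_ℝ = ⟪v, hφ.memLp_grad.toLp (grad φ)⟫_ℝ := by
  rw [L2.inner_def]
  refine integral_congr_ae ?_
  filter_upwards [hφ.memLp_grad.coeFn_toLp] with p hp
  rw [hp]

/-- The closed subspace of divergence-free fields in `L²(𝔻)³`. -/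
def divFree : Submodule ℝ L2Field where
  carrier := {v | IsDivFree v}
  add_mem' := fun {a b} ha hb φ hφ => by
    have h1 := ha φ hφ
    have h2 := hb φ hφ
    rw [integral_inner_grad _ hφ] at h1 h2 ⊢
    rw [inner_add_left, h1, h2, add_zero]
  zero_mem' := fun φ hφ => by
    rw [integral_inner_grad _ hφ, inner_zero_left]
  smul_mem' := fun c a ha φ hφ => by
    have h1 := ha φ hφ
    rw [integral_inner_grad _ hφ] at h1 ⊢
    rw [real_inner_smul_left, h1, mul_zero]

theorem isClosed_divFree : IsClosed (divFree : Set L2Field) := by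
  have : (divFree : Set L2Field) = ⋂ (φ : Layer → ℝ) (hφ : IsTestFunction φ),
      {v : L2Field | ⟪v, hφ.memLp_grad.toLp (grad φ)⟫_ℝ = 0} := by
    ext v
    simp only [Set.mem_iInter, Set.mem_ofPred_eq]
    exact forall₂_congr fun φ hφ => by rw [integral_inner_grad _ hφ]
  rw [this]
  exact isClosed_iInter fun φ => isClosed_iInter fun hφ =>
    isClosed_eq (continuous_id.inner continuous_const) continuous_const

instance : CompleteSpace divFree := isClosed_divFree.completeSpace_coe

/-- The Leray projector: the orthogonal projector of `L²(𝔻)³` onto the divergence-free fields. -/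
def leray : L2Field →L[ℝ] L2Field := divFree.starProjection

/-- The linear map `v ↦ e₃ ∧ v` of `ℝ³`. -/
def e3Wedge : Vec3 →L[ℝ] Vec3 :=
  LinearMap.toContinuousLinearMap
    ((WithLp.linearEquiv 2 ℝ (Fin 3 → ℝ)).symm.toLinearMap ∘ₗ
      crossProduct ![0, 0, 1] ∘ₗ (WithLp.linearEquiv 2 ℝ (Fin 3 → ℝ)).toLinearMap)

/-- The Coriolis operator `v ↦ ℙ (e₃ ∧ v)` on `L²(𝔻)³`. -/
def coriolis (v : L2Field) : L2Field := leray (e3Wedge.compLp v)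

/-- `u` is a solution, for times `t ≥ 0`, of the linear Rossby equation
`∂ₜ u + Ω ℙ (e₃ ∧ u) = Δ u`, `div u = 0`, with initial data `u₀`: it is a continuous curve in
`L²(𝔻)³`, and the equation holds in the sense of distributions on the layer, at every time
(one-sided derivative at `t = 0`). Values of `u` at negative times are irrelevant. -/
structure IsRossbySolution (Ω : ℝ) (u₀ : L2Field) (u : ℝ → L2Field) : Prop where
  continuousOn : ContinuousOn u (Ici 0)
  initial : u 0 = u₀
  div_free : ∀ t, 0 ≤ t → IsDivFree (u t)
  equation : ∀ φ : Layer → Vec3, IsTestFunction φ → ∀ t, 0 ≤ t →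
    HasDerivWithinAt (fun s => ∫ p, ⟪u s p, φ p⟫_ℝ)
      ((∫ p, ⟪u t p, laplace φ p⟫_ℝ) - Ω * ∫ p, ⟪coriolis (u t) p, φ p⟫_ℝ) (Ici 0) t

/-- `Q v = 0`, that is `v ∈ (1 - Q) L²(𝔻)³`: the vertical average of `v` vanishes. -/
def HasZeroVerticalMean (v : L2Field) : Prop :=
  ∀ᵐ x : EuclideanSpace ℝ (Fin 2), ∫ z : UnitAddCircle, v (x, z) = 0

/-- The vertical Fourier coefficient `x ↦ ∫_{𝕋¹} vᵢ(x, z) e^{-2πinz} dz` of the `i`-th component. -/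
def verticalCoeff (v : L2Field) (i : Fin 3) (n : ℤ) (x : EuclideanSpace ℝ (Fin 2)) : ℂ :=
  ∫ z : UnitAddCircle, fourier (-n) z * ((v (x, z) i : ℝ) : ℂ)

theorem memLp_verticalCoeff (v : L2Field) (i : Fin 3) (n : ℤ) :
    MemLp (verticalCoeff v i n) 2 volume := by
  let f : Layer → ℂ := fun p => fourier (-n) p.2 * ((v p i : ℝ) : ℂ)
  have hi : Continuous fun w : Vec3 => ((w i : ℝ) : ℂ) := by fun_prop
  have hf : AEStronglyMeasurable f volume :=
    (((fourier (-n)).continuous.comp continuous_snd).aestronglyMeasurable).mul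
      (hi.comp_aestronglyMeasurable (Lp.aestronglyMeasurable v))
  have hb : ∀ p, ‖f p‖ₑ ≤ ‖v p‖ₑ := fun p => by
    refine enorm_le_iff_norm_le.2 ?_
    simp only [f, norm_mul, fourier_apply, Circle.norm_coe, one_mul, Complex.norm_real]
    exact PiLp.norm_apply_le (v p) i
  have hv : ∫⁻ p, ‖f p‖ₑ ^ (2 : ℝ) < ⊤ := by
    have h := Lp.eLpNorm_lt_top v
    rw [eLpNorm_lt_top_iff_lintegral_rpow_enorm_lt_top (by simp) (by simp)] at h
    refine lt_of_le_of_lt (lintegral_mono fun p => ?_) h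
    simpa using ENNReal.rpow_le_rpow (hb p) (by norm_num : (0 : ℝ) ≤ 2)
  have hm : AEStronglyMeasurable f
      ((volume : Measure (EuclideanSpace ℝ (Fin 2))).prod (volume : Measure UnitAddCircle)) := hf
  refine ⟨hm.integral_prod_right', ?_⟩
  rw [eLpNorm_lt_top_iff_lintegral_rpow_enorm_lt_top (by simp) (by simp)]
  have hv' : ∫⁻ p, ‖f p‖ₑ ^ (2 : ℝ) =
      ∫⁻ x : EuclideanSpace ℝ (Fin 2), ∫⁻ z : UnitAddCircle, ‖f (x, z)‖ₑ ^ (2 : ℝ) :=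
    lintegral_prod _ (hm.enorm.pow_const 2)
  rw [hv'] at hv
  refine lt_of_le_of_lt (lintegral_mono_ae ?_) hv
  have : IsProbabilityMeasure (volume : Measure UnitAddCircle) := ⟨UnitAddCircle.measure_univ⟩
  filter_upwards [hm.prodMk_left] with x hx
  have h1 : ‖verticalCoeff v i n x‖ₑ ≤ eLpNorm (fun z => f (x, z)) 1 volume := by
    rw [eLpNorm_one_eq_lintegral_enorm]
    exact enorm_integral_le_lintegral_enorm _
  have h2 := h1.trans (eLpNorm_le_eLpNorm_of_exponent_le (one_le_two : (1 : ℝ≥0∞) ≤ 2) hx)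
  rw [eLpNorm_eq_lintegral_rpow_enorm_toReal (by simp) (by simp)] at h2
  have h3 := ENNReal.rpow_le_rpow h2 (by norm_num : (0 : ℝ) ≤ 2)
  rw [← ENNReal.rpow_mul] at h3
  simpa using h3

/-- The Fourier transform of the `i`-th component of `v`,
`vₙ(k) = (2π)⁻¹ ∫_{ℝ²} ∫_{𝕋¹} vᵢ(x, z) e^{-i(k·x + 2πnz)} dz dx`, the horizontal integral being the
`L²` (Plancherel) Fourier transform. The latter is normalised in Mathlib with the phase
`e^{-2πi ξ·x}`, hence the evaluation at `ξ = k / (2π)`. -/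
def layerFourier (v : L2Field) (i : Fin 3) (n : ℤ) (k : EuclideanSpace ℝ (Fin 2)) : ℂ :=
  ((2 * Real.pi)⁻¹ : ℝ) *
    (𝓕 ((memLp_verticalCoeff v i n).toLp (verticalCoeff v i n)) :
      Lp ℂ 2 (volume : Measure (EuclideanSpace ℝ (Fin 2)))) ((2 * Real.pi)⁻¹ • k)

/-- The Fourier transform of `v` is supported in the ball
`{(k, n) ∈ ℝ² × ℤ | √(|k|² + 4π²n²) ≤ R}`. -/
def FourierSupportedIn (R : ℝ) (v : L2Field) : Prop :=
  ∀ (i : Fin 3) (n : ℤ), ∀ᵐ k : EuclideanSpace ℝ (Fin 2),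
    R < √(‖k‖ ^ 2 + 4 * Real.pi ^ 2 * (n : ℝ) ^ 2) → layerFourier v i n k = 0

/-- The norm of `u` in `L^p(ℝ₊, L^q(𝔻))`. -/
def mixedNorm (p q : ℝ≥0∞) (u : ℝ → L2Field) : ℝ≥0∞ :=
  eLpNorm (fun t => eLpNorm (u t) q (volume : Measure Layer)) p
    ((volume : Measure ℝ).restrict (Ioi 0))

/-- `⟨Ω⟩ = (1 + |Ω|²)^{1/2}`. -/
def japaneseBracket (Ω : ℝ) : ℝ := √(1 + |Ω| ^ 2)

end

noncomputable section

open Filter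
open scoped Topology

/-! On divergence-free fields the Coriolis operator is diagonal in Fourier space: applying `e₃ ×` to
the circular polarisation relation `k × f = -σ i |k| f`, with `k = (ξ, n)` and `σ = ±1`, gives `e₃ ×
f = (σ i / |k|) (k f₃ - n f)`. The first term is a gradient, which the Leray projector kills, and
the second is a scalar multiple of `f` (`RossbyMode.coriolis_eq`). A polarised profile therefore
evolves by the factor `exp (t (-4π²|k|² + i σ Ω n / |k|))`, and for a profile of bounded support
this is a differentiable curve in `L²` (`RossbyMode.hasDerivAt_flow`). Vanishing vertical mean and
bounded Fourier support leave finitely many vertical frequencies, all nonzero, and at each of them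
the data split into two polarisations (`exists_mode_decomposition`). This gives existence and
reduces the estimate to one scalar profile with `|n| ≥ 1`, whose heat factor is at most `e^{-t}`.

Decay comes from the phase `τ / √(n² + |ξ|²)`. After a rotation the plane wave depends on one
coordinate of `ξ` only. Along the other coordinate the phase is stationary only at the origin, and a
van der Corput argument gives `|τ|^{-1/2}` uniformly in space (`norm_integral_cexp_inv_sqrt_le`,
`norm_integral_ball_kernel_le`). The kernel linking times `s` and `t` is thus at most a constant
times `⟨Ω⟩^{-1/2} e^{-s-t} (1 + |s-t|^{-1/2})` (`norm_kernel_le`), which is integrable in `(s, t)`.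
The `TT*` argument takes a square root, whence `⟨Ω⟩^{-1/4}` in `L¹` of time with values in `L^∞`
(`lintegral_iSup_fourierInv_le`); the spatial supremum inside the time integral is replaced by
evaluation at measurable selections of points (`lintegral_iSup_enorm_le`). Hölder interpolation with
the bounds for `L²` and `L^∞` that are uniform in time covers the whole range of `(p, q)`
(`mixedNorm_le_of_lintegral_le`).

Uniqueness is by duality. A solution with zero data is paired with the mode flow for `-Ω` run
backwards in time. The pairing is constant because the Coriolis operator is skew on divergence-free
fields, so the solution is orthogonal to every mode (`RossbyMode.inner_eq_zero`), and the modes are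
total among divergence-free fields (`eq_zero_of_inner_modes`). The equation is given only against
compactly supported test functions, so horizontal cutoffs are needed to use modes as test functions
(`RossbyMode.hasDerivAt_inner`). -/

/-! ### One-dimensional oscillatory integrals -/

theorem hasDerivAt_sqrt_add_sq {A : ℝ} (hA : 0 < A) (y : ℝ) :
    HasDerivAt (fun y : ℝ => √(A + y ^ 2)) (y / √(A + y ^ 2)) y := by
  have h : HasDerivAt (fun y : ℝ => A + y ^ 2) (2 * y) y := by
    simpa using (hasDerivAt_pow 2 y).const_add A
  convert h.sqrt (by positivity) using 1
  field_simp

/-- Van der Corput type bound on a half line piece for the phase `τ / √(A + y²)`, whose only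
stationary point is `y = 0`. -/
theorem norm_integral_cexp_inv_sqrt_le_of_pos {A B b δ τ s : ℝ} (hA : 0 < A) (hB : A + b ^ 2 ≤ B ^ 2)
    (hB0 : 0 ≤ B) (hδ : 0 < δ) (hb : δ ≤ b) (hs : 0 ≤ s) (hτ : τ ≠ 0) :
    ‖∫ y in δ..b, Complex.exp (Complex.I * (τ * (√(A + y ^ 2))⁻¹ : ℝ)) *
      ((Real.exp (-(s * y ^ 2)) : ℝ) : ℂ)‖ ≤ 8 * B ^ 3 / (|τ| * δ) := by
  set w : ℝ → ℝ := fun y => √(A + y ^ 2) with hw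
  have hw0 : ∀ y, 0 < w y := fun y => Real.sqrt_pos.2 (by positivity)
  have hwd : ∀ y, HasDerivAt w (y / w y) y := fun y => hasDerivAt_sqrt_add_sq hA y
  set F : ℝ → ℂ := fun y => Complex.exp (Complex.I * (τ * (w y)⁻¹ : ℝ)) with hF
  set F' : ℝ → ℂ := fun y => F y * (Complex.I * (τ * (-(y / w y) / w y ^ 2) : ℝ)) with hF'
  have hFd : ∀ y, HasDerivAt F (F' y) y := fun y => by
    have h1 : HasDerivAt (fun y => τ * (w y)⁻¹) (τ * (-(y / w y) / w y ^ 2)) y :=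
      ((hwd y).inv (hw0 y).ne').const_mul τ
    exact ((h1.ofReal_comp).const_mul Complex.I).cexp
  -- The phase has derivative `-τ y / w³`; `G` is the amplitude divided by `y / w³`. Integrating by
  -- parts with `V = (i/τ) G` against `F'` returns the integrand.
  set G : ℝ → ℝ := fun y => Real.exp (-(s * y ^ 2)) * (w y ^ 3 / y) with hG
  set G' : ℝ → ℝ := fun y => Real.exp (-(s * y ^ 2)) * (-(2 * s * w y ^ 3) + 3 * w y - w y ^ 3 / y ^ 2)
    with hG'
  have hGd : ∀ y, 0 < y → HasDerivAt G (G' y) y := fun y hy => by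
    have h1 : HasDerivAt (fun y => Real.exp (-(s * y ^ 2))) (Real.exp (-(s * y ^ 2)) * (-(s * (2 * y)))) y := by
      have : HasDerivAt (fun y : ℝ => -(s * y ^ 2)) (-(s * (2 * y))) y := by
        simpa using ((hasDerivAt_pow 2 y).const_mul s).fun_neg
      exact this.exp
    have h2 : HasDerivAt (fun y => w y ^ 3 / y)
        ((3 * w y ^ 2 * (y / w y) * y - w y ^ 3 * 1) / y ^ 2) y := by
      have := (((hwd y).fun_pow 3).fun_div (hasDerivAt_id' y) hy.ne')
      simpa using this
    refine (h1.fun_mul h2).congr_deriv ?_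
    have := (hw0 y).ne'
    simp only [hG']
    field_simp
    ring
  have hwc : Continuous w := continuous_iff_continuousAt.2 fun y => (hwd y).continuousAt
  have hFc : Continuous F := continuous_iff_continuousAt.2 fun y => (hFd y).continuousAt
  have hF'c : Continuous F' := by
    simp only [hF']
    refine hFc.mul (continuous_const.mul (Complex.continuous_ofReal.comp ?_))
    refine continuous_const.mul (Continuous.div ?_ (hwc.pow 2) fun y => by have := hw0 y; positivity)
    exact (continuous_id.div hwc fun y => (hw0 y).ne').neg
  have hpos : ∀ y ∈ uIcc δ b, 0 < y := fun y hy => by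
    rw [uIcc_of_le hb] at hy; exact hδ.trans_le hy.1
  have hwB : ∀ y ∈ uIcc δ b, w y ≤ B := fun y hy => by
    rw [uIcc_of_le hb] at hy
    refine Real.sqrt_le_iff.2 ⟨hB0, le_trans ?_ hB⟩
    have : 0 ≤ y := hδ.le.trans hy.1
    gcongr; exact hy.2
  have hG'c : ContinuousOn G' (uIcc δ b) := by
    simp only [hG']
    refine ContinuousOn.mul (by fun_prop) (ContinuousOn.sub (by fun_prop) ?_)
    exact (hwc.pow 3).continuousOn.div (by fun_prop) fun y hy => by have := hpos y hy; positivity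
  set V : ℝ → ℂ := fun y => Complex.I / τ * (G y : ℂ) with hV
  set V' : ℝ → ℂ := fun y => Complex.I / τ * (G' y : ℂ) with hV'
  have hVd : ∀ y ∈ uIcc δ b, HasDerivAt V (V' y) y := fun y hy =>
    ((hGd y (hpos y hy)).ofReal_comp).const_mul _
  have hV'c : ContinuousOn V' (uIcc δ b) :=
    continuousOn_const.mul (Complex.continuous_ofReal.comp_continuousOn hG'c)
  have key := intervalIntegral.integral_mul_deriv_eq_deriv_mul hVd (fun y _ => hFd y)
    hV'c.intervalIntegrable hF'c.continuousOn.intervalIntegrable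
  have hcongr : (∫ y in δ..b, F y * ((Real.exp (-(s * y ^ 2)) : ℝ) : ℂ)) = ∫ y in δ..b, V y * F' y := by
    refine intervalIntegral.integral_congr fun y hy => ?_
    have h1 := (hw0 y).ne'
    have h2 := (hpos y hy).ne'
    have hτ' : (τ : ℂ) ≠ 0 := by exact_mod_cast hτ
    have e : (Real.exp (-(s * y ^ 2)) : ℝ) = -(G y * (-(y / w y) / w y ^ 2)) := by
      simp only [hG]; field_simp
    simp only [hV, hF']
    rw [e]
    push_cast
    field_simp
    rw [Complex.I_sq]
    ring
  rw [hcongr, key]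
  have hFn : ∀ y, ‖F y‖ = 1 := fun y => by
    simp only [hF]; rw [mul_comm, Complex.norm_exp_ofReal_mul_I]
  have hVn : ∀ y ∈ uIcc δ b, ‖V y‖ ≤ B ^ 3 / (|τ| * δ) := fun y hy => by
    have hy0 := hpos y hy
    have h3 : ‖V y‖ = |G y| / |τ| := by
      simp [hV]; ring
    have h4 : |G y| ≤ B ^ 3 / δ := by
      have : 0 ≤ G y := by have := hw0 y; positivity
      rw [abs_of_nonneg this]
      have e1 : Real.exp (-(s * y ^ 2)) ≤ 1 := Real.exp_le_one_iff.2 (by nlinarith [sq_nonneg y])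
      have e2 : w y ^ 3 / y ≤ B ^ 3 / δ := by
        have := hw0 y
        have := hwB y hy
        rw [uIcc_of_le hb] at hy
        gcongr; exact hy.1
      calc G y ≤ 1 * (B ^ 3 / δ) := by
            have := hw0 y
            exact mul_le_mul e1 e2 (by positivity) zero_le_one
        _ = _ := one_mul _
    rw [h3, mul_comm |τ|, ← div_div]
    gcongr
  have hV'n : ∀ y ∈ uIcc δ b, ‖V' y * F y‖ ≤ 6 * B ^ 3 / |τ| * (y ^ 2)⁻¹ := fun y hy => by
    have hy0 := hpos y hy
    have hwy := hw0 y
    have hwb := hwB y hy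
    have h3 : ‖V' y * F y‖ = |G' y| / |τ| := by
      rw [norm_mul, hFn]; simp [hV']; ring
    have h4 : |G' y| ≤ 6 * B ^ 3 * (y ^ 2)⁻¹ := by
      have e1 : Real.exp (-(s * y ^ 2)) ≤ 1 := Real.exp_le_one_iff.2 (by nlinarith [sq_nonneg y])
      have e0 := Real.exp_pos (-(s * y ^ 2))
      -- Here `x e^{-x} ≤ 1` absorbs the factor `s` produced by differentiating the Gaussian, so the
      -- bound is uniform in `s`. The constant 6 is `2 + 3 + 1`, one summand per term of `G'`; the
      -- two boundary terms then raise it to 8.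
      have e2 : s * y ^ 2 * Real.exp (-(s * y ^ 2)) ≤ 1 := by
        rw [Real.exp_neg, ← div_eq_mul_inv, div_le_one (Real.exp_pos _)]
        linarith [Real.add_one_le_exp (s * y ^ 2)]
      have e3 : w y ^ 3 ≤ B ^ 3 := by gcongr
      have e4 : w y * y ^ 2 ≤ B ^ 3 := by
        refine le_trans ?_ e3
        have : w y ^ 2 = A + y ^ 2 := Real.sq_sqrt (by positivity)
        nlinarith
      have e5 : G' y * y ^ 2 = -(2 * (s * y ^ 2 * Real.exp (-(s * y ^ 2))) * w y ^ 3)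
          + 3 * (Real.exp (-(s * y ^ 2)) * (w y * y ^ 2)) - Real.exp (-(s * y ^ 2)) * w y ^ 3 := by
        simp only [hG']; field_simp
      have e6 : |G' y * y ^ 2| ≤ 6 * B ^ 3 := by
        rw [e5]
        have a0 : 0 ≤ s * y ^ 2 * Real.exp (-(s * y ^ 2)) := by positivity
        have b0 : 0 ≤ w y ^ 3 := by positivity
        have c0 : 0 ≤ w y * y ^ 2 := by positivity
        have a1 : s * y ^ 2 * Real.exp (-(s * y ^ 2)) * w y ^ 3 ≤ 1 * B ^ 3 :=
          mul_le_mul e2 e3 b0 zero_le_one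
        have a2 : Real.exp (-(s * y ^ 2)) * (w y * y ^ 2) ≤ 1 * B ^ 3 :=
          mul_le_mul e1 e4 c0 zero_le_one
        have a3 : Real.exp (-(s * y ^ 2)) * w y ^ 3 ≤ 1 * B ^ 3 :=
          mul_le_mul e1 e3 b0 zero_le_one
        have a4 := mul_nonneg a0 b0
        have a5 := mul_nonneg e0.le c0
        have a6 := mul_nonneg e0.le b0
        rw [abs_le]; constructor <;> nlinarith
      rw [abs_mul, abs_of_pos (by positivity : 0 < y ^ 2)] at e6
      rw [← div_eq_mul_inv, le_div_iff₀ (by positivity)]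
      exact e6
    rw [h3, div_le_iff₀ (abs_pos.2 hτ)]
    refine h4.trans (le_of_eq ?_)
    have := abs_pos.2 hτ
    field_simp
  have hint : ‖∫ y in δ..b, V' y * F y‖ ≤ 6 * B ^ 3 / (|τ| * δ) := by
    have hd : ∀ y ∈ uIcc δ b, HasDerivAt (fun y : ℝ => -(6 * B ^ 3 / |τ| * y⁻¹)) (6 * B ^ 3 / |τ| * (y ^ 2)⁻¹) y :=
      fun y hy => by
        refine (((hasDerivAt_inv (hpos y hy).ne').const_mul (6 * B ^ 3 / |τ|))).fun_neg.congr_deriv ?_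
        ring
    have hi : IntervalIntegrable (fun y : ℝ => 6 * B ^ 3 / |τ| * (y ^ 2)⁻¹) volume δ b := by
      refine ContinuousOn.intervalIntegrable (continuousOn_const.mul (ContinuousOn.inv₀ (by fun_prop) ?_))
      intro y hy; have := hpos y hy; positivity
    refine (intervalIntegral.norm_integral_le_of_norm_le hb (.of_forall fun y hy => hV'n y ?_) hi).trans ?_
    · rw [uIcc_of_le hb]; exact Ioc_subset_Icc_self hy
    · rw [intervalIntegral.integral_eq_sub_of_hasDerivAt hd hi]
      have : 0 ≤ 6 * B ^ 3 / |τ| * b⁻¹ := by have := hδ.trans_le hb; positivity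
      have e : 6 * B ^ 3 / (|τ| * δ) = 6 * B ^ 3 / |τ| * δ⁻¹ := by rw [← div_div, div_eq_mul_inv _ δ]
      rw [e]; linarith
  have n1 := hVn b right_mem_uIcc
  have n2 := hVn δ left_mem_uIcc
  have : 8 * B ^ 3 / (|τ| * δ) = B ^ 3 / (|τ| * δ) + B ^ 3 / (|τ| * δ) + 6 * B ^ 3 / (|τ| * δ) := by ring
  rw [this]
  refine (norm_sub_le _ _).trans (add_le_add ((norm_sub_le _ _).trans ?_) hint)
  rw [norm_mul (V b), norm_mul (V δ), hFn, hFn, mul_one, mul_one]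
  exact add_le_add n1 n2

/-- Within distance `|τ|^{-1/2}` of the stationary point the integrand is bounded by 1; beyond it
the nonstationary bound with `δ = |τ|^{-1/2}` has the same size. The integrand is even, hence the
factor 2. -/
theorem norm_integral_cexp_inv_sqrt_le {A B b τ s : ℝ} (hA : 0 < A) (hB : A + b ^ 2 ≤ B ^ 2)
    (hB0 : 0 ≤ B) (hb : 0 ≤ b) (hs : 0 ≤ s) (hτ : τ ≠ 0) :
    ‖∫ y in (-b)..b, Complex.exp (Complex.I * (τ * (√(A + y ^ 2))⁻¹ : ℝ)) *
      ((Real.exp (-(s * y ^ 2)) : ℝ) : ℂ)‖ ≤ 2 * (8 * B ^ 3 + 1) / √|τ| := by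
  set f : ℝ → ℂ := fun y => Complex.exp (Complex.I * (τ * (√(A + y ^ 2))⁻¹ : ℝ)) *
      ((Real.exp (-(s * y ^ 2)) : ℝ) : ℂ) with hf
  have hc : Continuous f := by
    have : Continuous fun y : ℝ => (√(A + y ^ 2))⁻¹ :=
      (by fun_prop : Continuous fun y : ℝ => √(A + y ^ 2)).inv₀
        fun y => (Real.sqrt_pos.2 (by positivity)).ne'
    fun_prop
  have hi : ∀ a b, IntervalIntegrable f volume a b := fun a b => hc.intervalIntegrable a b
  have hn : ∀ y, ‖f y‖ ≤ 1 := fun y => by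
    simp only [hf]
    rw [norm_mul, mul_comm Complex.I, Complex.norm_exp_ofReal_mul_I, one_mul, Complex.norm_real,
      Real.norm_eq_abs, abs_of_pos (Real.exp_pos _)]
    exact Real.exp_le_one_iff.2 (by nlinarith [sq_nonneg y])
  have hhalf : ‖∫ y in (0 : ℝ)..b, f y‖ ≤ (8 * B ^ 3 + 1) / √|τ| := by
    have hτ0 : 0 < √|τ| := Real.sqrt_pos.2 (abs_pos.2 hτ)
    have htriv : ∀ c, 0 ≤ c → ‖∫ y in (0 : ℝ)..c, f y‖ ≤ c := fun c hc => by
      have := intervalIntegral.norm_integral_le_of_norm_le_const (a := 0) (b := c) (f := f) (C := 1)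
        fun y _ => hn y
      simpa [abs_of_nonneg hc] using this
    rcases le_total b (√|τ|)⁻¹ with h | h
    · refine (htriv b hb).trans (h.trans ?_)
      rw [inv_eq_one_div]
      gcongr
      have : 0 ≤ 8 * B ^ 3 := by positivity
      linarith
    · rw [← intervalIntegral.integral_add_adjacent_intervals (hi 0 (√|τ|)⁻¹) (hi _ b)]
      have h1 := htriv (√|τ|)⁻¹ (by positivity)
      have h2 := norm_integral_cexp_inv_sqrt_le_of_pos hA hB hB0 (inv_pos.2 hτ0) h hs hτ
      have e : 8 * B ^ 3 / (|τ| * (√|τ|)⁻¹) = 8 * B ^ 3 / √|τ| := by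
        congr 1
        rw [← div_eq_mul_inv, Real.div_sqrt]
      rw [e] at h2
      refine (norm_add_le _ _).trans ((add_le_add h1 h2).trans (le_of_eq ?_))
      field_simp
      ring
  have hneg : ∫ y in (-b)..0, f y = ∫ y in (0 : ℝ)..b, f y := by
    have := intervalIntegral.integral_comp_neg (a := 0) (b := b) f
    rw [neg_zero] at this
    rw [← this]
    refine intervalIntegral.integral_congr fun y _ => ?_
    simp [hf]
  rw [← intervalIntegral.integral_add_adjacent_intervals (hi (-b) 0) (hi 0 b), hneg, ← two_mul,
    norm_mul, mul_div_assoc]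
  simpa using hhalf

/-! ### The kernel on a ball of horizontal frequencies -/

/-- The horizontal plane. -/
abbrev Plane : Type := EuclideanSpace ℝ (Fin 2)

/-- The reflection in the hyperplane bisecting two vectors of equal norm exchanges them. -/
theorem exists_linearIsometryEquiv_map_eq (y : Plane) :
    ∃ O : Plane ≃ₗᵢ[ℝ] Plane, O (EuclideanSpace.single 0 ‖y‖) = y :=
  ⟨_, Submodule.reflection_sub (v := EuclideanSpace.single 0 ‖y‖) (w := y) (by simp)⟩

theorem integral_plane_eq (g : ℝ × ℝ → ℂ) :
    ∫ ξ : Plane, g (ξ 0, ξ 1) = ∫ q : ℝ × ℝ, g q := by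
  have h := (volume_preserving_finTwoArrow ℝ).comp
    (EuclideanSpace.volume_preserving_symm_measurableEquiv_toLp (Fin 2))
  exact h.integral_comp ((MeasurableEquiv.toLp 2 (Fin 2 → ℝ)).symm.trans
    MeasurableEquiv.finTwoArrow).measurableEmbedding g

theorem plane_norm_sq (ξ : Plane) : ‖ξ‖ ^ 2 = ξ 0 ^ 2 + ξ 1 ^ 2 := by
  rw [EuclideanSpace.norm_sq_eq, Fin.sum_univ_two]; simp

/-- The integrand of the space-time kernel. -/
def kernelIntegrand (n τ s : ℝ) (r : ℝ) : ℂ :=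
  Complex.exp (Complex.I * (τ * (√(n ^ 2 + r))⁻¹ : ℝ)) * ((Real.exp (-(s * (n ^ 2 + r))) : ℝ) : ℂ)

theorem continuous_kernelIntegrand_comp {X : Type*} [TopologicalSpace X] {n : ℝ} (hn : n ≠ 0)
    (τ s : ℝ) {r : X → ℝ} (hr : Continuous r) (hr0 : ∀ x, 0 ≤ r x) :
    Continuous fun x => kernelIntegrand n τ s (r x) := by
  have : Continuous fun x => (√(n ^ 2 + r x))⁻¹ :=
    (by fun_prop : Continuous fun x => √(n ^ 2 + r x)).inv₀
      fun x => (Real.sqrt_pos.2 (by have := hr0 x; positivity)).ne'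
  unfold kernelIntegrand
  fun_prop

theorem norm_kernelIntegrand (n τ s r : ℝ) :
    ‖kernelIntegrand n τ s r‖ = Real.exp (-(s * (n ^ 2 + r))) := by
  rw [kernelIntegrand, norm_mul, mul_comm Complex.I, Complex.norm_exp_ofReal_mul_I, one_mul,
    Complex.norm_real, Real.norm_eq_abs, abs_of_pos (Real.exp_pos _)]

/-- For frozen `x` the Gaussian factor in `n² + x²` comes out of the integral, and what remains is
the one-dimensional integral with `A = n² + x²`. Since `n² ≥ 1`, that factor is at most `e^{-s}` and
the phase has no singularity. On the chord `A + y²` stays below `n² + ρ²`, so the constant does not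
depend on `x`. -/
theorem norm_integral_kernelIntegrand_le {n ρ τ s x : ℝ} (hn : 1 ≤ |n|) (hs : 0 ≤ s)
    (hτ : τ ≠ 0) (hx : |x| ≤ ρ) :
    ‖∫ y in (-√(ρ ^ 2 - x ^ 2))..√(ρ ^ 2 - x ^ 2), kernelIntegrand n τ s (x ^ 2 + y ^ 2)‖ ≤
      Real.exp (-s) * (2 * (8 * √(n ^ 2 + ρ ^ 2) ^ 3 + 1) / √|τ|) := by
  have hn2 : 1 ≤ n ^ 2 := by nlinarith [sq_abs n]
  have hx2 : 0 ≤ ρ ^ 2 - x ^ 2 := by nlinarith [sq_abs x, abs_nonneg x]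
  have h := norm_integral_cexp_inv_sqrt_le (A := n ^ 2 + x ^ 2) (B := √(n ^ 2 + ρ ^ 2))
    (b := √(ρ ^ 2 - x ^ 2)) (τ := τ) (s := s) (by positivity)
    (by rw [Real.sq_sqrt hx2, Real.sq_sqrt (by positivity)]; linarith) (by positivity)
    (by positivity) hs hτ
  have e : ∀ y : ℝ, kernelIntegrand n τ s (x ^ 2 + y ^ 2) = ((Real.exp (-(s * (n ^ 2 + x ^ 2))) : ℝ) : ℂ) *
      (Complex.exp (Complex.I * (τ * (√(n ^ 2 + x ^ 2 + y ^ 2))⁻¹ : ℝ)) *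
      ((Real.exp (-(s * y ^ 2)) : ℝ) : ℂ)) := fun y => by
    have : Real.exp (-(s * (n ^ 2 + (x ^ 2 + y ^ 2)))) =
        Real.exp (-(s * (n ^ 2 + x ^ 2))) * Real.exp (-(s * y ^ 2)) := by
      rw [← Real.exp_add]; congr 1; ring
    rw [kernelIntegrand, this, ← add_assoc]
    push_cast
    ring
  simp_rw [e]
  rw [intervalIntegral.integral_const_mul, norm_mul, Complex.norm_real, Real.norm_eq_abs,
    abs_of_pos (Real.exp_pos _)]
  refine mul_le_mul (Real.exp_le_exp.2 ?_) h (norm_nonneg _) (Real.exp_pos _).le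
  nlinarith [sq_nonneg x]

/-- The kernel is radial, so an isometry may move `y` to the first axis. The plane wave is then
constant along each chord of the ball in the second direction, where it drops out of the modulus;
the one-dimensional bound on each chord is integrated over `|x| ≤ ρ`. No decay in the first
direction is used, which is why the bound is uniform in `y`. -/
theorem norm_integral_ball_kernel_le {n ρ τ s : ℝ} (hn : 1 ≤ |n|) (hρ : 0 ≤ ρ) (hs : 0 ≤ s)
    (hτ : τ ≠ 0) (y : Plane) :
    ‖∫ ξ in Metric.closedBall (0 : Plane) ρ,
      Complex.exp ((2 * Real.pi * ⟪ξ, y⟫_ℝ : ℝ) * Complex.I) * kernelIntegrand n τ s (‖ξ‖ ^ 2)‖ ≤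
      2 * ρ * (Real.exp (-s) * (2 * (8 * √(n ^ 2 + ρ ^ 2) ^ 3 + 1) / √|τ|)) := by
  have hn0 : n ≠ 0 := fun h => by simp [h] at hn; linarith
  obtain ⟨O, hO⟩ := exists_linearIsometryEquiv_map_eq y
  set M := Real.exp (-s) * (2 * (8 * √(n ^ 2 + ρ ^ 2) ^ 3 + 1) / √|τ|) with hM
  set S : Set (ℝ × ℝ) := {q | q.1 ^ 2 + q.2 ^ 2 ≤ ρ ^ 2} with hS
  have hSc : IsClosed S := isClosed_le (by fun_prop) (by fun_prop)
  set g : ℝ × ℝ → ℂ := fun q => Complex.exp ((2 * Real.pi * (q.1 * ‖y‖) : ℝ) * Complex.I) *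
    kernelIntegrand n τ s (q.1 ^ 2 + q.2 ^ 2) with hg
  have hgc : Continuous g := by
    refine Continuous.mul (by fun_prop) ?_
    exact continuous_kernelIntegrand_comp hn0 τ s (by fun_prop) fun q => by positivity
  have e1 : ∫ ξ in Metric.closedBall (0 : Plane) ρ,
      Complex.exp ((2 * Real.pi * ⟪ξ, y⟫_ℝ : ℝ) * Complex.I) * kernelIntegrand n τ s (‖ξ‖ ^ 2) =
      ∫ q, S.indicator g q := by
    have h1 := O.measurePreserving.setIntegral_preimage_emb O.toMeasurableEquiv.measurableEmbedding
      (fun ξ => Complex.exp ((2 * Real.pi * ⟪ξ, y⟫_ℝ : ℝ) * Complex.I) * kernelIntegrand n τ s (‖ξ‖ ^ 2))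
      (Metric.closedBall (0 : Plane) ρ)
    rw [← h1, ← integral_plane_eq, ← integral_indicator (by
      exact O.continuous.measurable Metric.isClosed_closedBall.measurableSet)]
    congr 1
    funext ξ
    by_cases hξ : ‖ξ‖ ≤ ρ
    · rw [indicator_of_mem (by simpa using hξ), indicator_of_mem]
      · have e : ⟪O ξ, y⟫_ℝ = ξ 0 * ‖y‖ := by
          conv_lhs => rw [← hO]
          rw [O.inner_map_map, EuclideanSpace.inner_single_right]; simp [mul_comm]
        rw [e, O.norm_map, plane_norm_sq]
      · change ξ 0 ^ 2 + ξ 1 ^ 2 ≤ ρ ^ 2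
        rw [← plane_norm_sq]; gcongr
    · rw [indicator_of_notMem (by simpa using hξ), indicator_of_notMem]
      change ¬ (ξ 0 ^ 2 + ξ 1 ^ 2 ≤ ρ ^ 2)
      rw [← plane_norm_sq, sq_le_sq₀ (norm_nonneg _) hρ]; exact hξ
  have hSb : S ⊆ Icc (-ρ) ρ ×ˢ Icc (-ρ) ρ := by
    intro q hq
    replace hq : q.1 ^ 2 + q.2 ^ 2 ≤ ρ ^ 2 := hq
    have h1 := abs_le_of_sq_le_sq (by nlinarith [sq_nonneg q.2] : q.1 ^ 2 ≤ ρ ^ 2) hρ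
    have h2 := abs_le_of_sq_le_sq (by nlinarith [sq_nonneg q.1] : q.2 ^ 2 ≤ ρ ^ 2) hρ
    exact ⟨abs_le.1 h1, abs_le.1 h2⟩
  have hSk : IsCompact S := (isCompact_Icc.prod isCompact_Icc).of_isClosed_subset hSc hSb
  have hint : Integrable (S.indicator g) :=
    (hgc.continuousOn.integrableOn_compact hSk).integrable_indicator hSc.measurableSet
  rw [e1]
  change ‖∫ q, S.indicator g q ∂((volume : Measure ℝ).prod volume)‖ ≤ _
  rw [integral_prod _ hint]
  have hM0 : 0 ≤ M := by positivity
  have hbound : ∀ x : ℝ, ‖∫ z, S.indicator g (x, z)‖ ≤ (Icc (-ρ) ρ).indicator (fun _ => M) x := fun x => by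
    by_cases hx : x ∈ Icc (-ρ) ρ
    · rw [indicator_of_mem hx]
      have hx' : |x| ≤ ρ := abs_le.2 hx
      have hx2 : 0 ≤ ρ ^ 2 - x ^ 2 := by nlinarith [sq_abs x, abs_nonneg x]
      set b := √(ρ ^ 2 - x ^ 2) with hb
      have hb0 : 0 ≤ b := Real.sqrt_nonneg _
      have e2 : ∀ z, S.indicator g (x, z) = (Icc (-b) b).indicator (fun z => g (x, z)) z := fun z => by
        have : (x, z) ∈ S ↔ z ∈ Icc (-b) b := by
          change x ^ 2 + z ^ 2 ≤ ρ ^ 2 ↔ _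
          rw [mem_Icc, ← abs_le, ← Real.sqrt_sq_eq_abs, hb, Real.sqrt_le_sqrt_iff hx2]
          constructor <;> intro h <;> linarith
        by_cases hz : z ∈ Icc (-b) b
        · rw [indicator_of_mem hz, indicator_of_mem (this.2 hz)]
        · rw [indicator_of_notMem hz, indicator_of_notMem (fun h => hz (this.1 h))]
      simp_rw [e2]
      rw [integral_indicator measurableSet_Icc, integral_Icc_eq_integral_Ioc,
        ← intervalIntegral.integral_of_le (by linarith)]
      simp only [hg]
      rw [intervalIntegral.integral_const_mul, norm_mul, Complex.norm_exp_ofReal_mul_I, one_mul]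
      exact norm_integral_kernelIntegrand_le hn hs hτ hx'
    · rw [indicator_of_notMem hx]
      have : ∀ z, S.indicator g (x, z) = 0 := fun z =>
        indicator_of_notMem (fun h => hx (hSb h).1) _
      simp [this]
  refine (norm_integral_le_of_norm_le ?_ (.of_forall hbound)).trans (le_of_eq ?_)
  · exact (integrableOn_const (by simp)).integrable_indicator measurableSet_Icc
  · rw [integral_indicator measurableSet_Icc, setIntegral_const]
    simp [Measure.real, hρ, two_mul]

/-! ### Duality in time and linearisation of the supremum -/

section Duality

variable {T H : Type*} [MeasurableSpace T] {ν : Measure T} [NormedAddCommGroup H]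
  [InnerProductSpace ℂ H] [CompleteSpace H]

local notation "⟪" x ", " y "⟫" => inner ℂ x y

/-- The `TT*` argument in `L¹` of time. -/
theorem lintegral_enorm_inner_le {g : T → H} (hg : Integrable g ν) (f : H) {D : ℝ≥0∞}
    (hD : ∫⁻ s, ∫⁻ t, ‖⟪g s, g t⟫‖ₑ ∂ν ∂ν ≤ D ^ 2) :
    ∫⁻ t, ‖⟪g t, f⟫‖ₑ ∂ν ≤ D * ‖f‖ₑ := by
  set F : T → ℂ := fun t => ⟪g t, f⟫ with hF
  have hFm : AEStronglyMeasurable F ν := hg.1.inner aestronglyMeasurable_const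
  -- The phase of `F`, equal to zero where `F` vanishes. With `v = ∫ θ g`, the integral of `|F|` is
  -- `⟪f, v⟫`, and `‖v‖²` is at most the double integral of `|⟪g s, g t⟫|`.
  set θ : T → ℂ := fun t => F t / (‖F t‖ : ℂ) with hθ
  have hθm : AEStronglyMeasurable θ ν := hFm.div₀ (Complex.continuous_ofReal.comp_aestronglyMeasurable hFm.norm)
  have hθ1 : ∀ t, ‖θ t‖ ≤ 1 := fun t => by
    simp only [hθ, norm_div, Complex.norm_real, norm_norm]; exact div_self_le_one _
  set G : T → H := fun t => θ t • g t with hG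
  have hGi : Integrable G ν := hg.bdd_smul 1 hθm (.of_forall hθ1)
  set v := ∫ t, G t ∂ν with hv
  have hGF : ∀ t, ⟪f, G t⟫ = (‖F t‖ : ℂ) := fun t => by
    have h1 : ⟪f, g t⟫ = (starRingEnd ℂ) (F t) := (inner_conj_symm _ _).symm
    rw [hG, inner_smul_right, h1]
    rcases eq_or_ne (F t) 0 with h0 | h0
    · simp [hθ, h0]
    · have : (‖F t‖ : ℂ) ≠ 0 := by exact_mod_cast norm_ne_zero_iff.2 h0
      simp only [hθ]
      field_simp
      rw [Complex.mul_conj, Complex.normSq_eq_norm_sq]; push_cast; ring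
  have hle : ∀ s t, ‖⟪G s, G t⟫‖ₑ ≤ ‖⟪g s, g t⟫‖ₑ := fun s t => by
    refine enorm_le_iff_norm_le.2 ?_
    rw [hG, inner_smul_left, inner_smul_right, norm_mul, norm_mul, RCLike.norm_conj]
    have := hθ1 s
    have := hθ1 t
    calc ‖θ s‖ * (‖θ t‖ * ‖⟪g s, g t⟫‖) ≤ 1 * (1 * ‖⟪g s, g t⟫‖) := by gcongr
      _ = _ := by ring
  have hvv : ‖v‖ₑ ^ 2 ≤ D ^ 2 := by
    have h1 : ‖⟪v, v⟫‖ₑ ≤ ∫⁻ s, ∫⁻ t, ‖⟪g s, g t⟫‖ₑ ∂ν ∂ν := by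
      calc ‖⟪v, v⟫‖ₑ = ‖∫ s, ⟪v, G s⟫ ∂ν‖ₑ := by rw [integral_inner hGi]
        _ ≤ ∫⁻ s, ‖⟪v, G s⟫‖ₑ ∂ν := enorm_integral_le_lintegral_enorm _
        _ ≤ _ := by
          refine lintegral_mono fun s => ?_
          rw [← enorm_norm, norm_inner_symm, enorm_norm, hv, ← integral_inner hGi]
          exact (enorm_integral_le_lintegral_enorm _).trans (lintegral_mono fun t => hle s t)
    refine le_trans (le_of_eq ?_) (h1.trans hD)
    rw [← enorm_norm ⟪v, v⟫, inner_self_eq_norm_sq_to_K]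
    simp [enorm_pow]
  have hvD : ‖v‖ₑ ≤ D := by
    by_contra! h
    exact absurd hvv (not_le.2 (ENNReal.pow_lt_pow_left (by norm_num) h))
  have h2 : ∫⁻ t, ‖F t‖ₑ ∂ν = ‖⟪f, v⟫‖ₑ := by
    rw [hv, ← integral_inner hGi]
    simp_rw [hGF]
    rw [integral_complex_ofReal, ← ofReal_integral_norm_eq_lintegral_enorm (hg.inner_const f),
      ← ofReal_norm, Complex.norm_real, Real.norm_of_nonneg]
    exact integral_nonneg fun t => norm_nonneg _
  rw [h2]
  calc ‖⟪f, v⟫‖ₑ ≤ ‖f‖ₑ * ‖v‖ₑ := by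
        rw [← ofReal_norm, ← ofReal_norm, ← ofReal_norm,
          ← ENNReal.ofReal_mul (norm_nonneg _)]
        exact ENNReal.ofReal_le_ofReal (norm_inner_le_norm _ _)
    _ ≤ _ := by rw [mul_comm]; gcongr

end Duality

/-- The supremum is a monotone limit of values at measurable selections: run through a dense
sequence and replace the current point by the next one whenever this does not decrease the norm.
Continuity lets the dense sequence see the whole supremum, and monotone convergence passes the
uniform bound to the limit. -/
theorem lintegral_iSup_enorm_le {T Y E : Type*} [MeasurableSpace T] [TopologicalSpace T]
    [OpensMeasurableSpace T] [SecondCountableTopology T]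
    [TopologicalSpace Y] [MeasurableSpace Y] [BorelSpace Y] [SecondCountableTopology Y] [Nonempty Y]
    [NormedAddCommGroup E] {ν : Measure T} {Φ : T × Y → E} (hΦ : Continuous Φ) {D : ℝ≥0∞}
    (h : ∀ X : T → Y, Measurable X → ∫⁻ t, ‖Φ (t, X t)‖ₑ ∂ν ≤ D) :
    ∫⁻ t, ⨆ x, ‖Φ (t, x)‖ₑ ∂ν ≤ D := by
  classical
  set N : T × Y → ℝ≥0∞ := fun q => ‖Φ q‖ₑ with hN
  have hNc : Continuous N := hΦ.enorm
  let u := TopologicalSpace.denseSeq Y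
  let X : ℕ → T → Y := fun m => Nat.rec (fun _ => u 0)
    (fun k Xk t => if N (t, Xk t) ≤ N (t, u k) then u k else Xk t) m
  have hX0 : X 0 = fun _ => u 0 := rfl
  have hXs : ∀ k t, X (k + 1) t = if N (t, X k t) ≤ N (t, u k) then u k else X k t := fun _ _ => rfl
  have hNm : ∀ {Z : T → Y}, Measurable Z → Measurable fun t => N (t, Z t) := fun hZ =>
    hNc.measurable.comp (measurable_id.prodMk hZ)
  have hXm : ∀ m, Measurable (X m) := fun m => by
    induction m with
    | zero => rw [hX0]; exact measurable_const
    | succ k ih =>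
      have : X (k + 1) = fun t => if N (t, X k t) ≤ N (t, u k) then u k else X k t := funext (hXs k)
      rw [this]
      exact Measurable.ite (measurableSet_le (hNm ih) (hNm measurable_const)) measurable_const ih
  have hstep : ∀ k t, N (t, X k t) ≤ N (t, X (k + 1) t) := fun k t => by
    rw [hXs]; split_ifs with hk
    · exact hk
    · exact le_rfl
  have hu : ∀ k t, N (t, u k) ≤ N (t, X (k + 1) t) := fun k t => by
    rw [hXs]; split_ifs with hk
    · exact le_rfl
    · exact (not_le.1 hk).le
  have hmono : Monotone fun m t => N (t, X m t) := monotone_nat_of_le_succ fun k t => hstep k t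
  have hsup : ∀ t, ⨆ x, N (t, x) ≤ ⨆ m, N (t, X m t) := fun t => by
    refine iSup_le fun x => ?_
    have hcl : IsClosed {x | N (t, x) ≤ ⨆ m, N (t, X m t)} :=
      isClosed_le (hNc.comp (by fun_prop)) continuous_const
    have : Dense {x | N (t, x) ≤ ⨆ m, N (t, X m t)} :=
      (TopologicalSpace.denseRange_denseSeq Y).mono (by
        rintro _ ⟨k, rfl⟩
        exact (hu k t).trans (le_iSup (fun m => N (t, X m t)) (k + 1)))
    have hx := this.closure_eq ▸ mem_univ x
    rw [hcl.closure_eq] at hx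
    exact hx
  calc ∫⁻ t, ⨆ x, N (t, x) ∂ν ≤ ∫⁻ t, ⨆ m, N (t, X m t) ∂ν := lintegral_mono hsup
    _ = ⨆ m, ∫⁻ t, N (t, X m t) ∂ν := lintegral_iSup (fun m => hNm (hXm m)) hmono
    _ ≤ D := iSup_le fun m => h _ (hXm m)

/-! ### The Rossby symbol and the dispersive estimate for one vertical frequency -/

/-- The symbol `-|K|² + i Ω K₃ / |K|` with `K = (2πξ, 2πn)`. -/
def rossbySymbol (n Ω : ℝ) (ξ : Plane) : ℂ :=
  ((-(4 * Real.pi ^ 2 * (n ^ 2 + ‖ξ‖ ^ 2)) : ℝ) : ℂ) +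
    ((Ω * n * (√(n ^ 2 + ‖ξ‖ ^ 2))⁻¹ : ℝ) : ℂ) * Complex.I

theorem rossbySymbol_re (n Ω : ℝ) (ξ : Plane) :
    (rossbySymbol n Ω ξ).re = -(4 * Real.pi ^ 2 * (n ^ 2 + ‖ξ‖ ^ 2)) := by
  simp only [rossbySymbol, Complex.add_re, Complex.ofReal_re, Complex.re_ofReal_mul, Complex.I_re,
    mul_zero, add_zero]

theorem norm_cexp_rossbySymbol (n Ω t : ℝ) (ξ : Plane) :
    ‖Complex.exp (t * rossbySymbol n Ω ξ)‖ =
      Real.exp (-(t * (4 * Real.pi ^ 2 * (n ^ 2 + ‖ξ‖ ^ 2)))) := by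
  rw [Complex.norm_exp, Complex.re_ofReal_mul, rossbySymbol_re]
  congr 1; ring

theorem measurable_rossbySymbol (n Ω : ℝ) : Measurable (rossbySymbol n Ω) := by
  unfold rossbySymbol; fun_prop

theorem continuous_rossbySymbol {n : ℝ} (hn : n ≠ 0) (Ω : ℝ) : Continuous (rossbySymbol n Ω) := by
  have : Continuous fun ξ : Plane => (√(n ^ 2 + ‖ξ‖ ^ 2))⁻¹ :=
    (by fun_prop : Continuous fun ξ : Plane => √(n ^ 2 + ‖ξ‖ ^ 2)).inv₀
      fun x => (Real.sqrt_pos.2 (by positivity)).ne'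
  unfold rossbySymbol; fun_prop

theorem one_le_four_pi_sq_mul {n : ℝ} (hn : 1 ≤ |n|) (ξ : Plane) :
    1 ≤ 4 * Real.pi ^ 2 * (n ^ 2 + ‖ξ‖ ^ 2) := by
  have hn2 : 1 ≤ n ^ 2 := by nlinarith [sq_abs n]
  have : 9 ≤ Real.pi ^ 2 := by nlinarith [Real.pi_gt_three]
  nlinarith [sq_nonneg ‖ξ‖]

/-- Under conjugation the decay rates add and the phases subtract: the `TT*` kernel oscillates in `s
- t` and decays in `s + t`. -/
theorem cexp_mul_conj_cexp_rossbySymbol (n Ω s t : ℝ) (ξ : Plane) :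
    Complex.exp (s * rossbySymbol n Ω ξ) * (starRingEnd ℂ) (Complex.exp (t * rossbySymbol n Ω ξ)) =
      kernelIntegrand n (Ω * n * (s - t)) (4 * Real.pi ^ 2 * (s + t)) (‖ξ‖ ^ 2) := by
  rw [kernelIntegrand, ← Complex.exp_conj, ← Complex.exp_add, Complex.ofReal_exp, ← Complex.exp_add]
  congr 1
  simp only [rossbySymbol, map_mul, map_add, Complex.conj_ofReal, Complex.conj_I]
  push_cast
  ring

theorem one_le_japaneseBracket (Ω : ℝ) : 1 ≤ japaneseBracket Ω := by
  rw [japaneseBracket, Real.one_le_sqrt]; nlinarith [sq_nonneg |Ω|]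

/-- For `|Ω| ≤ 1` there is nothing to gain, and the volume of the ball bounds the kernel; for `|Ω| ≥
1` the oscillatory bound applies with `τ = Ω n (s - t)`. In both cases the heat factor is at most
`e^{-(s+t)}`. -/
theorem norm_kernel_le {n ρ : ℝ} (hn : 1 ≤ |n|) (hρ : 0 ≤ ρ) :
    ∃ C, 0 ≤ C ∧ ∀ Ω s t : ℝ, 0 ≤ s → 0 ≤ t → s ≠ t → ∀ y : Plane,
      ‖∫ ξ in Metric.closedBall (0 : Plane) ρ,
        Complex.exp ((2 * Real.pi * ⟪ξ, y⟫_ℝ : ℝ) * Complex.I) *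
          kernelIntegrand n (Ω * n * (s - t)) (4 * Real.pi ^ 2 * (s + t)) (‖ξ‖ ^ 2)‖ ≤
      C * (√(japaneseBracket Ω))⁻¹ * (Real.exp (-s) * (Real.exp (-t) * (1 + (√|s - t|)⁻¹))) := by
  set V := (volume : Measure Plane).real (Metric.closedBall (0 : Plane) ρ) with hV
  set M := 2 * ρ * (2 * (8 * √(n ^ 2 + ρ ^ 2) ^ 3 + 1)) with hM
  have hV0 : 0 ≤ V := measureReal_nonneg
  have hM0 : 0 ≤ M := by positivity
  -- The factor `√2` converts to the bracket: `⟨Ω⟩ ≤ 2` in the first regime and `⟨Ω⟩ ≤ 2 |Ω|` in the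
  -- second. `V` serves the trivial bound and `M` the oscillatory one.
  refine ⟨√2 * (V + M), by positivity, fun Ω s t hs ht hst y => ?_⟩
  set I := ∫ ξ in Metric.closedBall (0 : Plane) ρ,
        Complex.exp ((2 * Real.pi * ⟪ξ, y⟫_ℝ : ℝ) * Complex.I) *
          kernelIntegrand n (Ω * n * (s - t)) (4 * Real.pi ^ 2 * (s + t)) (‖ξ‖ ^ 2) with hI
  set J := japaneseBracket Ω with hJ
  have hJ1 : 1 ≤ J := one_le_japaneseBracket Ω
  have hJ0 : 0 < √J := Real.sqrt_pos.2 (by linarith)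
  have hJ2 : J ^ 2 = 1 + |Ω| ^ 2 := Real.sq_sqrt (by positivity)
  have hpi : 1 ≤ 4 * Real.pi ^ 2 := by nlinarith [Real.pi_gt_three]
  have hd : 0 < |s - t| := abs_pos.2 (sub_ne_zero.2 hst)
  have htriv : ‖I‖ ≤ V * Real.exp (-(s + t)) := by
    rw [mul_comm]
    refine norm_setIntegral_le_of_norm_le_const measure_closedBall_lt_top fun ξ _ => ?_
    rw [norm_mul, Complex.norm_exp_ofReal_mul_I, one_mul, norm_kernelIntegrand]
    refine Real.exp_le_exp.2 ?_
    have := one_le_four_pi_sq_mul hn ξ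
    nlinarith [add_nonneg hs ht]
  have hexp : Real.exp (-s) * Real.exp (-t) = Real.exp (-(s + t)) := by
    rw [← Real.exp_add]; congr 1; ring
  have hrhs : √2 * (V + M) * (√J)⁻¹ * (Real.exp (-s) * (Real.exp (-t) * (1 + (√|s - t|)⁻¹))) =
      Real.exp (-(s + t)) * (V + M) * ((√2 * (√J)⁻¹) * (1 + (√|s - t|)⁻¹)) := by
    rw [← hexp]; ring
  rw [hrhs]
  have hE := Real.exp_pos (-(s + t))
  have hd' : 0 ≤ (√|s - t|)⁻¹ := by positivity
  rcases le_total |Ω| 1 with hΩ | hΩ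
  · have h1 : 1 ≤ √2 * (√J)⁻¹ := by
      rw [← div_eq_mul_inv, le_div_iff₀ hJ0, one_mul]
      exact Real.sqrt_le_sqrt (by nlinarith [abs_nonneg Ω])
    calc ‖I‖ ≤ Real.exp (-(s + t)) * V * (1 * 1) := by linarith
      _ ≤ _ := by gcongr <;> linarith
  · have hΩ0 : 0 < |Ω| := by linarith
    have h1 : (√|Ω|)⁻¹ ≤ √2 * (√J)⁻¹ := by
      rw [← div_eq_mul_inv, le_div_iff₀ hJ0, inv_mul_le_iff₀ (Real.sqrt_pos.2 hΩ0), ← Real.sqrt_mul hΩ0.le]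
      exact Real.sqrt_le_sqrt (by nlinarith [abs_nonneg Ω])
    have hn0 : n ≠ 0 := fun h => by simp [h] at hn; linarith
    have hτ : Ω * n * (s - t) ≠ 0 := mul_ne_zero (mul_ne_zero (abs_pos.1 hΩ0) hn0) (sub_ne_zero.2 hst)
    have h2 := norm_integral_ball_kernel_le hn hρ (by positivity : 0 ≤ 4 * Real.pi ^ 2 * (s + t)) hτ y
    have h3 : (√|Ω * n * (s - t)|)⁻¹ ≤ (√|Ω|)⁻¹ * (√|s - t|)⁻¹ := by
      rw [← mul_inv, ← Real.sqrt_mul hΩ0.le]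
      refine inv_anti₀ (Real.sqrt_pos.2 (by positivity)) (Real.sqrt_le_sqrt ?_)
      rw [abs_mul, abs_mul]
      nlinarith [mul_pos hΩ0 hd]
    have h4 : Real.exp (-(4 * Real.pi ^ 2 * (s + t))) ≤ Real.exp (-(s + t)) :=
      Real.exp_le_exp.2 (by nlinarith [add_nonneg hs ht])
    calc ‖I‖ ≤ Real.exp (-(4 * Real.pi ^ 2 * (s + t))) * M * (√|Ω * n * (s - t)|)⁻¹ := by
          refine h2.trans (le_of_eq ?_)
          rw [hM, div_eq_mul_inv]; ring
      _ ≤ Real.exp (-(s + t)) * (V + M) * ((√2 * (√J)⁻¹) * (1 + (√|s - t|)⁻¹)) := by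
          gcongr
          · linarith
          · exact h3.trans (by gcongr; linarith)

theorem lintegral_inv_sqrt_lt_top :
    ∫⁻ u in Icc (-1 : ℝ) 1, ENNReal.ofReal (√|u|)⁻¹ < ⊤ := by
  have h1 : IntegrableOn (fun u : ℝ => (√|u|)⁻¹) (Icc (0 : ℝ) 1) := by
    have h := (intervalIntegral.intervalIntegrable_rpow' (a := 0) (b := 1) (r := -(1 / 2)) (by norm_num))
    rw [intervalIntegrable_iff_integrableOn_Icc_of_le zero_le_one] at h
    refine h.congr_fun (fun u hu => ?_) measurableSet_Icc
    change u ^ (-(1 / 2) : ℝ) = _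
    rw [Real.rpow_neg hu.1, ← Real.sqrt_eq_rpow, abs_of_nonneg hu.1]
  have h2 : IntegrableOn (fun u : ℝ => (√|u|)⁻¹) (Icc (-1 : ℝ) 0) := by
    have := (integrable_indicator_iff measurableSet_Icc).2 h1
    have := this.comp_neg
    refine (integrable_indicator_iff measurableSet_Icc).1 (this.congr (.of_forall fun u => ?_))
    beta_reduce
    by_cases hu : u ∈ Icc (-1 : ℝ) 0
    · rw [indicator_of_mem hu, indicator_of_mem (by constructor <;> linarith [hu.1, hu.2]), abs_neg]
    · rw [indicator_of_notMem hu, indicator_of_notMem]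
      exact fun h => hu (by constructor <;> linarith [h.1, h.2])
  have h3 : IntegrableOn (fun u : ℝ => (√|u|)⁻¹) (Icc (-1 : ℝ) 1) := by
    rw [← Icc_union_Icc_eq_Icc (by norm_num : (-1 : ℝ) ≤ 0) zero_le_one]
    exact h2.union h1
  exact h3.lintegral_lt_top

theorem lintegral_exp_neg_Ioi : ∫⁻ t in Ioi (0 : ℝ), ENNReal.ofReal (Real.exp (-t)) = 1 := by
  rw [← ofReal_integral_eq_lintegral_ofReal (integrableOn_exp_neg_Ioi 0) (.of_forall fun t => (Real.exp_pos _).le),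
    integral_exp_neg_Ioi_zero, ENNReal.ofReal_one]

/-- Away from the diagonal, `|s - t| ≥ 1`, the bracket is at most 2 and the exponential is
integrable. Near the diagonal the singularity is a translate of one fixed integrable function on
`[-1, 1]`, so the inner integral is bounded uniformly in `s`. -/
theorem lintegral_lintegral_exp_singular_lt_top :
    ∫⁻ s in Ioi (0 : ℝ), ∫⁻ t in Ioi (0 : ℝ),
      ENNReal.ofReal (Real.exp (-s) * (Real.exp (-t) * (1 + (√|s - t|)⁻¹))) < ⊤ := by
  set L := ∫⁻ u in Icc (-1 : ℝ) 1, ENNReal.ofReal (√|u|)⁻¹ with hL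
  have hLt : L < ⊤ := lintegral_inv_sqrt_lt_top
  set k : ℝ → ℝ≥0∞ := (Icc (-1 : ℝ) 1).indicator fun u => ENNReal.ofReal (√|u|)⁻¹ with hk
  have hinner : ∀ s : ℝ, ∫⁻ t in Ioi (0 : ℝ),
      ENNReal.ofReal (Real.exp (-s) * (Real.exp (-t) * (1 + (√|s - t|)⁻¹))) ≤
      ENNReal.ofReal (Real.exp (-s)) * (2 + L) := fun s => by
    simp_rw [ENNReal.ofReal_mul (Real.exp_pos (-s)).le]
    rw [lintegral_const_mul' _ _ ENNReal.ofReal_ne_top]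
    gcongr
    have hp : ∀ t ∈ Ioi (0 : ℝ), ENNReal.ofReal (Real.exp (-t) * (1 + (√|s - t|)⁻¹)) ≤
        2 * ENNReal.ofReal (Real.exp (-t)) + k (s - t) := fun t ht => by
      have he : Real.exp (-t) ≤ 1 := Real.exp_le_one_iff.2 (by simpa using (mem_Ioi.1 ht).le)
      have he0 := Real.exp_pos (-t)
      by_cases hst : s - t ∈ Icc (-1 : ℝ) 1
      · simp only [hk]
        rw [indicator_of_mem hst, ← ENNReal.ofReal_ofNat 2, ← ENNReal.ofReal_mul zero_le_two,
          ← ENNReal.ofReal_add (by positivity) (by positivity)]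
        refine ENNReal.ofReal_le_ofReal ?_
        have : 0 ≤ (√|s - t|)⁻¹ := by positivity
        nlinarith
      · simp only [hk]
        rw [indicator_of_notMem hst, add_zero, ← ENNReal.ofReal_ofNat 2, ← ENNReal.ofReal_mul zero_le_two]
        refine ENNReal.ofReal_le_ofReal ?_
        have h1 : 1 ≤ |s - t| := by
          by_contra! h
          exact hst (abs_le.1 h.le)
        have : (√|s - t|)⁻¹ ≤ 1 := inv_le_one_of_one_le₀ (Real.one_le_sqrt.2 h1)
        nlinarith
    refine (setLIntegral_mono' measurableSet_Ioi hp).trans ?_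
    have hm : Measurable fun t : ℝ => 2 * ENNReal.ofReal (Real.exp (-t)) := by fun_prop
    rw [lintegral_add_left hm, lintegral_const_mul _ (by fun_prop), lintegral_exp_neg_Ioi, mul_one]
    gcongr
    refine (setLIntegral_le_lintegral _ _).trans ?_
    rw [lintegral_sub_left_eq_self k s, hk, lintegral_indicator measurableSet_Icc]
  refine (lintegral_mono hinner).trans_lt ?_
  rw [lintegral_mul_const _ (by fun_prop), lintegral_exp_neg_Ioi, one_mul]
  exact ENNReal.add_lt_top.2 ⟨by simp, hLt⟩

theorem integrableOn_exp_neg_of_norm_le {H : Type*} [NormedAddCommGroup H] {g : ℝ → H} {c : ℝ}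
    (hg : StronglyMeasurable g) (h : ∀ t, 0 < t → ‖g t‖ ≤ c * Real.exp (-t)) :
    Integrable g ((volume : Measure ℝ).restrict (Ioi 0)) := by
  refine Integrable.mono' ((integrableOn_exp_neg_Ioi 0).const_mul c) hg.aestronglyMeasurable ?_
  filter_upwards [ae_restrict_mem measurableSet_Ioi] with t ht using h t ht

/-- Dispersive decay, integrated in time: the `L¹(ℝ₊, L^∞)` bound for one vertical mode. -/
theorem lintegral_iSup_fourierInv_le {n ρ : ℝ} (hn : 1 ≤ |n|) (hρ : 0 ≤ ρ) :
    ∃ C, 0 ≤ C ∧ ∀ (Ω : ℝ) (f : Plane → ℂ), MemLp f 2 volume → (∀ ξ, ρ < ‖ξ‖ → f ξ = 0) →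
      ∫⁻ t in Ioi (0 : ℝ), ⨆ x, ‖𝓕⁻ (fun ξ => Complex.exp (t * rossbySymbol n Ω ξ) * f ξ) x‖ₑ ≤
        ENNReal.ofReal (C * japaneseBracket Ω ^ (-(1 / 4) : ℝ)) * eLpNorm f 2 volume := by
  obtain ⟨C, hC0, hC⟩ := norm_kernel_le hn hρ
  have hn0 : n ≠ 0 := fun h => by simp [h] at hn; linarith
  set Λ := ∫⁻ s in Ioi (0 : ℝ), ∫⁻ t in Ioi (0 : ℝ),
      ENNReal.ofReal (Real.exp (-s) * (Real.exp (-t) * (1 + (√|s - t|)⁻¹))) with hΛ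
  have hΛt : Λ ≠ ⊤ := lintegral_lintegral_exp_singular_lt_top.ne
  refine ⟨√(C * Λ.toReal), by positivity, fun Ω f hf hfs => ?_⟩
  set B := Metric.closedBall (0 : Plane) ρ with hB
  have hBm : MeasurableSet B := Metric.isClosed_closedBall.measurableSet
  have : CompactSpace B := isCompact_iff_compactSpace.1 (isCompact_closedBall _ _)
  -- Working on the compact ball turns jointly continuous functions of `((t, x), ξ)` into continuous
  -- maps of `(t, x)` with values in `L²`, by currying.
  set μ : Measure B := Measure.comap Subtype.val volume with hμ
  have hmap : μ.map Subtype.val = (volume : Measure Plane).restrict B := map_comap_subtype_coe hBm _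
  have : IsFiniteMeasure μ := ⟨by
    rw [hμ, comap_subtype_coe_apply hBm]; simpa using measure_closedBall_lt_top⟩
  -- The conjugate cancels the one in the first slot of the inner product, so that pairing with `f`
  -- is exactly the inverse Fourier integral.
  let A : C((ℝ × Plane) × B, ℂ) :=
    ⟨fun q => (starRingEnd ℂ) (Complex.exp ((2 * Real.pi * ⟪(q.2 : Plane), q.1.2⟫_ℝ : ℝ) * Complex.I) *
      Complex.exp (q.1.1 * rossbySymbol n Ω q.2)), by
      have := (continuous_rossbySymbol hn0 Ω).comp (continuous_subtype_val.comp
        (continuous_snd : Continuous fun q : (ℝ × Plane) × B => q.2))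
      refine Complex.continuous_conj.comp (Continuous.mul (by fun_prop) ?_)
      exact Complex.continuous_exp.comp (Continuous.mul (by fun_prop) this)⟩
  let G : ℝ × Plane → Lp ℂ 2 μ := fun q => ContinuousMap.toLp 2 μ ℂ (A.curry q)
  have hGc : Continuous G := (ContinuousMap.toLp 2 μ ℂ).continuous.comp A.curry.continuous
  have hfB : MemLp (fun ξ : B => f ξ) 2 μ := by
    have := hf.restrict B
    rw [← hmap] at this
    exact (memLp_map_measure_iff this.1 measurable_subtype_coe.aemeasurable).1 this
  set F := hfB.toLp _ with hF
  have hFn : ‖F‖ₑ ≤ eLpNorm f 2 volume := by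
    rw [hF, Lp.enorm_toLp]
    have h := (MeasurableEmbedding.subtype_coe hBm).eLpNorm_map_measure (f := Subtype.val) (g := f)
      (μ := μ) (p := 2)
    rw [hmap] at h
    exact (le_of_eq h.symm).trans (eLpNorm_mono_measure _ Measure.restrict_le_self)
  have hinner : ∀ t x, ⟪G (t, x), F⟫_ℂ = 𝓕⁻ (fun ξ => Complex.exp (t * rossbySymbol n Ω ξ) * f ξ) x := by
    intro t x
    have e1 : ⟪G (t, x), F⟫_ℂ = ∫ ξ : B, (starRingEnd ℂ) (A ((t, x), ξ)) * f ξ ∂μ := by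
      refine integral_congr_ae ?_
      filter_upwards [ContinuousMap.coeFn_toLp (p := 2) (𝕜 := ℂ) μ (A.curry (t, x)), hfB.coeFn_toLp]
        with ξ h1 h2
      simp only [G, hF, h1, h2]
      simp [mul_comm]
    rw [e1, Real.fourierInv_eq']
    have e2 := integral_subtype_comap (μ := volume) hBm (fun ξ : Plane =>
      Complex.exp ((2 * Real.pi * ⟪ξ, x⟫_ℝ : ℝ) * Complex.I) *
      (Complex.exp (t * rossbySymbol n Ω ξ) * f ξ))
    simp only [smul_eq_mul]
    rw [← setIntegral_eq_integral_of_forall_compl_eq_zero (s := B), ← e2]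
    · refine integral_congr_ae (.of_forall fun ξ => ?_)
      simp [A, mul_assoc]
    · intro ξ hξ
      rw [hfs ξ (by simpa [hB] using hξ)]; simp
  have hGG : ∀ s x t y, ⟪G (s, x), G (t, y)⟫_ℂ = (starRingEnd ℂ) (∫ ξ in B,
      Complex.exp ((2 * Real.pi * ⟪ξ, y - x⟫_ℝ : ℝ) * Complex.I) *
          kernelIntegrand n (Ω * n * (t - s)) (4 * Real.pi ^ 2 * (t + s)) (‖ξ‖ ^ 2)) := by
    intro s x t y
    simp only [G]
    rw [ContinuousMap.inner_toLp, ← integral_conj, ← integral_subtype_comap hBm]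
    refine integral_congr_ae (.of_forall fun ξ => ?_)
    have e3 := cexp_mul_conj_cexp_rossbySymbol n Ω t s (ξ : Plane)
    simp only [ContinuousMap.curry_apply, A, ContinuousMap.coe_mk, ← e3, ← map_mul]
    congr 1
    rw [map_mul, ← Complex.exp_conj, inner_sub_right, mul_sub, Complex.ofReal_sub, sub_mul,
      Complex.exp_sub]
    simp only [map_mul, Complex.conj_ofReal, Complex.conj_I]
    rw [mul_neg, Complex.exp_neg]
    field_simp
  have hGn : ∀ t, 0 < t → ∀ x, ‖G (t, x)‖ ≤ ‖(ContinuousMap.toLp 2 μ ℂ : C(B, ℂ) →L[ℂ] Lp ℂ 2 μ)‖ * Real.exp (-t) := by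
    intro t ht x
    refine (ContinuousLinearMap.le_opNorm (ContinuousMap.toLp 2 μ ℂ : C(B, ℂ) →L[ℂ] Lp ℂ 2 μ) _).trans ?_
    gcongr
    refine (ContinuousMap.norm_le _ (Real.exp_pos _).le).2 fun ξ => ?_
    simp only [ContinuousMap.curry_apply, A, ContinuousMap.coe_mk, RCLike.norm_conj]
    rw [norm_mul, Complex.norm_exp_ofReal_mul_I, one_mul, norm_cexp_rossbySymbol]
    refine Real.exp_le_exp.2 ?_
    have := one_le_four_pi_sq_mul hn (ξ : Plane)
    nlinarith
  set J := japaneseBracket Ω with hJ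
  have hJ1 : 1 ≤ J := one_le_japaneseBracket Ω
  have hJ0 : 0 < J := by linarith
  -- `D²` is the integrated kernel bound `C ⟨Ω⟩^{-1/2} Λ`; this square root is the source of the
  -- exponent `1/4`.
  set D : ℝ≥0∞ := ENNReal.ofReal (√(C * Λ.toReal) * J ^ (-(1 / 4) : ℝ)) with hD
  have hD2 : ENNReal.ofReal (C * (√J)⁻¹) * Λ = D ^ 2 := by
    rw [hD, ← ENNReal.ofReal_pow (by positivity), ← ENNReal.ofReal_toReal hΛt,
      ← ENNReal.ofReal_mul (by positivity), ENNReal.toReal_ofReal ENNReal.toReal_nonneg, mul_pow,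
      Real.sq_sqrt (by positivity), ← Real.rpow_natCast, ← Real.rpow_mul hJ0.le,
      Real.sqrt_eq_rpow, ← Real.rpow_neg hJ0.le]
    congr 1
    norm_num
    ring
  have hΦ : Continuous fun q : ℝ × Plane => ⟪G q, F⟫_ℂ := hGc.inner continuous_const
  have main := lintegral_iSup_enorm_le (ν := (volume : Measure ℝ).restrict (Ioi 0)) hΦ
    (D := D * eLpNorm f 2 volume) fun X hX => by
      have hgm : StronglyMeasurable fun t => G (t, X t) :=
        hGc.comp_stronglyMeasurable (measurable_id.prodMk hX).stronglyMeasurable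
      have hgi := integrableOn_exp_neg_of_norm_le hgm fun t ht => hGn t ht (X t)
      refine (lintegral_enorm_inner_le hgi F (D := D) ?_).trans (by gcongr)
      rw [← hD2, hΛ, ← lintegral_const_mul' _ _ ENNReal.ofReal_ne_top]
      refine setLIntegral_mono' measurableSet_Ioi fun s hs => ?_
      rw [← lintegral_const_mul' _ _ ENNReal.ofReal_ne_top]
      refine lintegral_mono_ae ?_
      -- The kernel bound excludes `s = t`, which is a null set of times `t` for fixed `s`.
      filter_upwards [ae_restrict_mem measurableSet_Ioi,
        ae_restrict_of_ae (Measure.ae_ne volume s)] with t ht hts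
      rw [hGG, ← ofReal_norm, RCLike.norm_conj, ← ENNReal.ofReal_mul (by positivity)]
      refine ENNReal.ofReal_le_ofReal ((hC Ω t s (mem_Ioi.1 ht).le (mem_Ioi.1 hs).le hts _).trans ?_)
      rw [abs_sub_comm]
      exact le_of_eq (by ring)
  simpa only [hinner] using main

/-! ### The layer measure and Fourier inversion on the plane -/

instance isProbabilityMeasure_unitAddCircle : IsProbabilityMeasure (volume : Measure UnitAddCircle) :=
  ⟨UnitAddCircle.measure_univ⟩

instance isAddRightInvariant_layer : (volume : Measure Layer).IsAddRightInvariant :=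
  inferInstanceAs ((volume : Measure Plane).prod (volume : Measure UnitAddCircle)).IsAddRightInvariant

theorem measurePreserving_layer_fst :
    MeasurePreserving (Prod.fst : Layer → Plane) volume volume :=
  measurePreserving_fst (μ := (volume : Measure Plane)) (ν := (volume : Measure UnitAddCircle))

section PlaneFourier

theorem continuous_fourierInv {f : Plane → ℂ} (hf : Integrable f) : Continuous (𝓕⁻ f) := by
  exact VectorFourier.fourierIntegral_continuous Real.continuous_fourierChar
    (by exact continuous_inner.neg) hf

theorem norm_fourierInv_le (f : Plane → ℂ) (x : Plane) : ‖𝓕⁻ f x‖ ≤ ∫ ξ, ‖f ξ‖ :=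
  VectorFourier.norm_fourierIntegral_le_integral_norm _ _ _ _ _

open SchwartzMap in
/-- On `L¹ ∩ L²` the Plancherel inverse Fourier transform is given by the Fourier integral. -/
theorem coeFn_fourierInv_toLp {f : Plane → ℂ} (hf2 : MemLp f 2 volume) (hf1 : Integrable f) :
    (𝓕⁻ (hf2.toLp f) : Lp ℂ 2 (volume : Measure Plane)) =ᵐ[volume] 𝓕⁻ f := by
  -- Both sides are tested against smooth compactly supported functions. The Plancherel transform
  -- agrees with that of tempered distributions, and for integrable `f` Fubini moves the transform
  -- onto the test function.
  refine ae_eq_of_integral_contDiff_smul_eq ((Lp.memLp _).locallyIntegrable (by norm_num))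
    (continuous_fourierInv hf1).locallyIntegrable fun g g_smooth g_cpt => ?_
  have hg₁ : HasCompactSupport (Complex.ofRealCLM ∘ g) := g_cpt.comp_left rfl
  have hg₂ : ContDiff ℝ ∞ (Complex.ofRealCLM ∘ g) := by fun_prop
  set ψ : 𝓢(Plane, ℂ) := hg₁.toSchwartzMap hg₂ with hψ
  have h1 := congrArg (fun T => T ψ) (Lp.fourierInv_toTemperedDistribution_eq (hf2.toLp f))
  simp only [TemperedDistribution.fourierInv_apply, Lp.toTemperedDistribution_apply] at h1
  have e1 : ∫ x, g x • (𝓕⁻ (hf2.toLp f) : Lp ℂ 2 (volume : Measure Plane)) x =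
      ∫ x, ψ x • (𝓕⁻ (hf2.toLp f) : Lp ℂ 2 (volume : Measure Plane)) x := by
    simp [hψ]
  have e2 : ∫ x, g x • 𝓕⁻ f x = ∫ x, ψ x • 𝓕⁻ f x := by simp [hψ]
  have e3 : ∫ x, (𝓕⁻ ψ) x • (hf2.toLp f) x = ∫ x, 𝓕⁻ (ψ : Plane → ℂ) x • f x := by
    refine integral_congr_ae ?_
    filter_upwards [hf2.coeFn_toLp] with x hx
    rw [hx, fourierInv_coe]
  rw [e1, e2, ← h1, e3]
  have := VectorFourier.integral_fourierIntegral_smul_eq_flip (L := -innerₗ Plane) (μ := volume)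
    (ν := volume) (f := (ψ : Plane → ℂ)) (g := f) Real.continuous_fourierChar
    (by exact continuous_inner.neg) ψ.integrable hf1
  refine this.trans ?_
  congr 1; funext x; congr 2
  ext a b; simp [real_inner_comm]

end PlaneFourier

/-! ### Band-limited profiles -/

/-- Square integrable functions of the horizontal frequency supported in the ball of radius `ρ`. -/
structure BandLimited (ρ : ℝ) (g : Plane → ℂ) : Prop where
  memLp : MemLp g 2 volume
  eq_zero : ∀ ξ, ρ < ‖ξ‖ → g ξ = 0

namespace BandLimited

variable {ρ : ℝ} {g h : Plane → ℂ}

theorem indicator_eq (hg : BandLimited ρ g) :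
    (Metric.closedBall (0 : Plane) ρ).indicator g = g := by
  refine indicator_eq_self.2 fun ξ hξ => ?_
  by_contra h
  exact hξ (hg.eq_zero ξ (by simpa using h))

/-- Cauchy–Schwarz on the ball carrying `g`. -/
theorem lintegral_enorm_le (hg : BandLimited ρ g) :
    ∫⁻ ξ, ‖g ξ‖ₑ ≤ eLpNorm g 2 volume * volume (Metric.closedBall (0 : Plane) ρ) ^ (1 / 2 : ℝ) := by
  have h1 := eLpNorm_le_eLpNorm_mul_rpow_measure_univ (p := 1) (q := 2)
    (μ := (volume : Measure Plane).restrict (Metric.closedBall 0 ρ)) (by norm_num)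
    hg.memLp.1.restrict
  rw [eLpNorm_one_eq_lintegral_enorm, Measure.restrict_apply_univ] at h1
  have h2 : ∫⁻ ξ, ‖g ξ‖ₑ = ∫⁻ ξ in Metric.closedBall (0 : Plane) ρ, ‖g ξ‖ₑ := by
    rw [← lintegral_indicator Metric.isClosed_closedBall.measurableSet]
    conv_lhs => rw [← hg.indicator_eq]
    simp_rw [enorm_indicator_eq_indicator_enorm]
  rw [h2]
  refine h1.trans (mul_le_mul' (eLpNorm_mono_measure _ Measure.restrict_le_self) (le_of_eq ?_))
  norm_num

theorem integrable (hg : BandLimited ρ g) : Integrable g := by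
  refine ⟨hg.memLp.1, hg.lintegral_enorm_le.trans_lt ?_⟩
  exact ENNReal.mul_lt_top hg.memLp.2 (ENNReal.rpow_lt_top_of_nonneg (by norm_num)
    measure_closedBall_lt_top.ne)

theorem mul_left {m : Plane → ℂ} (hg : BandLimited ρ g) (hm : Measurable m) {c : ℝ}
    (hc : ∀ ξ, ‖ξ‖ ≤ ρ → ‖m ξ‖ ≤ c) : BandLimited ρ fun ξ => m ξ * g ξ := by
  refine ⟨hg.memLp.of_le_mul (c := c) (hm.aestronglyMeasurable.mul hg.memLp.1) (.of_forall fun ξ => ?_),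
    fun ξ hξ => by simp [hg.eq_zero ξ hξ]⟩
  rcases le_or_gt ‖ξ‖ ρ with h | h
  · rw [norm_mul]; gcongr; exact hc ξ h
  · simp [hg.eq_zero ξ h]

theorem add (hg : BandLimited ρ g) (hh : BandLimited ρ h) : BandLimited ρ fun ξ => g ξ + h ξ :=
  ⟨hg.memLp.add hh.memLp, fun ξ hξ => by simp [hg.eq_zero ξ hξ, hh.eq_zero ξ hξ]⟩

theorem const_mul (hg : BandLimited ρ g) (c : ℂ) : BandLimited ρ fun ξ => c * g ξ :=
  hg.mul_left (m := fun _ => c) measurable_const fun _ _ => le_rfl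

/-- Bounded support makes every moment of `g` integrable, and moments of the profile are derivatives
of its transform. -/
theorem contDiff_fourierInv (hg : BandLimited ρ g) : ContDiff ℝ ∞ (𝓕⁻ g) := by
  have hn : BandLimited ρ fun ξ => g (-ξ) :=
    ⟨hg.memLp.comp_measurePreserving (Measure.measurePreserving_neg _), fun ξ hξ => hg.eq_zero _ (by simpa using hξ)⟩
  rw [Real.fourierInv_eq_fourier_comp_neg]
  refine Real.contDiff_fourier fun n _ => ?_
  have : BandLimited ρ fun ξ => ((‖ξ‖ ^ n : ℝ) : ℂ) * g (-ξ) := by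
    refine hn.mul_left (by fun_prop) (c := |ρ| ^ n) fun ξ hξ => ?_
    rw [Complex.norm_real, norm_pow, norm_norm]
    gcongr
    exact hξ.trans (le_abs_self ρ)
  refine this.integrable.norm.congr (.of_forall fun ξ => ?_)
  simp

end BandLimited

/-! ### Fields with a single vertical frequency and their derivatives -/

/-- The wave number `(ξ₁, ξ₂, n)`. -/
def waveNumber (n : ℤ) (ξ : Plane) : Fin 3 → ℝ := ![ξ 0, ξ 1, n]

theorem measurable_waveNumber (n : ℤ) (j : Fin 3) : Measurable fun ξ => waveNumber n ξ j := by
  fin_cases j <;> simp [waveNumber] <;> fun_prop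

theorem abs_waveNumber_le (n : ℤ) (j : Fin 3) (ξ : Plane) : |waveNumber n ξ j| ≤ ‖ξ‖ + |(n : ℝ)| := by
  have h0 := PiLp.norm_apply_le ξ 0
  have h1 := PiLp.norm_apply_le ξ 1
  have h2 := norm_nonneg ξ
  have h3 := abs_nonneg (n : ℝ)
  rw [Real.norm_eq_abs] at h0 h1
  fin_cases j <;> simp [waveNumber] <;> linarith

theorem BandLimited.waveNumber_mul {ρ : ℝ} {g : Plane → ℂ} (hg : BandLimited ρ g) (n : ℤ) (j : Fin 3) :
    BandLimited ρ fun ξ => 2 * Real.pi * Complex.I * waveNumber n ξ j * g ξ := by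
  have := measurable_waveNumber n j
  refine hg.mul_left (m := fun ξ => 2 * Real.pi * Complex.I * waveNumber n ξ j) (by fun_prop)
    (c := 2 * Real.pi * (ρ + |(n : ℝ)|)) fun ξ hξ => ?_
  simp only [norm_mul, Complex.norm_real, Complex.norm_I, Complex.norm_two, Real.norm_eq_abs,
    abs_of_pos Real.pi_pos, mul_one]
  gcongr
  exact (abs_waveNumber_le n j ξ).trans (by gcongr)

/-- The function with the single vertical mode `n` and horizontal Fourier transform `g`. -/
def bandFn (n : ℤ) (g : Plane → ℂ) (p : Layer) : ℂ := fourier n p.2 * 𝓕⁻ g p.1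

/-- The real vector field with the single vertical mode `n` and horizontal Fourier transform `g`. -/
def bandField (n : ℤ) (g : Fin 3 → Plane → ℂ) (p : Layer) : Vec3 :=
  WithLp.toLp 2 fun i => (bandFn n (g i) p).re

/-- Functions on the layer with a smooth lift to `ℝ³`. -/
def SmoothLift {F : Type*} [NormedAddCommGroup F] [NormedSpace ℝ F] (φ : Layer → F) : Prop :=
  ContDiff ℝ ∞ fun y : Vec3 => φ (cover y)

theorem smoothLift_bandFn {ρ : ℝ} {g : Plane → ℂ} (hg : BandLimited ρ g) (n : ℤ) :
    SmoothLift (bandFn n g) := by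
  have h1 : ContDiff ℝ ∞ fun y : Vec3 => (!₂[y 0, y 1] : Plane) := by
    refine contDiff_euclidean.2 fun i => ?_
    fin_cases i <;> simp <;> fun_prop
  have h2 := hg.contDiff_fourierInv.comp h1
  have h3 : ContDiff ℝ ∞ fun y : Vec3 => fourier n ((y 2 : ℝ) : UnitAddCircle) := by
    simp_rw [fourier_coe_apply]
    have : ContDiff ℝ ∞ fun y : Vec3 => ((y 2 : ℝ) : ℂ) := Complex.ofRealCLM.contDiff.comp (by fun_prop)
    fun_prop
  exact h3.mul h2

theorem smoothLift_re {φ : Layer → ℂ} (h : SmoothLift φ) : SmoothLift fun p => (φ p).re :=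
  Complex.reCLM.contDiff.comp h

theorem smoothLift_bandField {ρ : ℝ} {g : Fin 3 → Plane → ℂ} (hg : ∀ i, BandLimited ρ (g i)) (n : ℤ) :
    SmoothLift (bandField n g) :=
  contDiff_euclidean.2 fun i => smoothLift_re (smoothLift_bandFn (hg i) n)

theorem cover_single_add (j : Fin 3) (s t : ℝ) :
    cover (EuclideanSpace.single j (s + t)) =
      cover (EuclideanSpace.single j s) + cover (EuclideanSpace.single j t) := by
  rw [← cover_add]; congr 1
  ext i; by_cases h : i = j <;> simp [h]

theorem cover_single_zero (j : Fin 3) : cover (EuclideanSpace.single j 0) = 0 := by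
  have := cover_single_add j 0 0
  simpa using this

/-- A translation in any of the three directions, the periodic one included, multiplies the profile
by a unimodular exponential. This lets one differentiation under the integral treat all directions
together. -/
theorem bandFn_add_cover_single {g : Plane → ℂ} (n : ℤ) (p : Layer) (j : Fin 3) (s : ℝ) :
    bandFn n g (p + cover (EuclideanSpace.single j s)) =
      fourier n p.2 * ∫ ξ, Complex.exp ((2 * Real.pi * ⟪ξ, p.1⟫_ℝ : ℝ) * Complex.I) *
        (Complex.exp (s * (2 * Real.pi * Complex.I * waveNumber n ξ j)) * g ξ) := by
  rw [bandFn, Real.fourierInv_eq', ← integral_const_mul, ← integral_const_mul]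
  congr 1; funext ξ
  have e1 : fourier n (p + cover (EuclideanSpace.single j s)).2 =
      fourier n p.2 * fourier n (((EuclideanSpace.single j s : Vec3) 2 : ℝ) : UnitAddCircle) := by
    simp [fourier_apply, cover, AddCircle.toCircle_add]
  rw [e1, fourier_coe_apply, smul_eq_mul, Prod.fst_add, inner_add_right]
  have e2 : ⟪ξ, (cover (EuclideanSpace.single j s)).1⟫_ℝ +
      n * (EuclideanSpace.single j s : Vec3) 2 = s * waveNumber n ξ j := by
    fin_cases j <;> simp [cover, waveNumber, PiLp.inner_apply, mul_comm]
  have e3 : Complex.exp (2 * Real.pi * Complex.I * n * ((EuclideanSpace.single j s : Vec3) 2 : ℝ) / (1 : ℝ)) *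
      Complex.exp ((2 * Real.pi * (⟪ξ, p.1⟫_ℝ + ⟪ξ, (cover (EuclideanSpace.single j s)).1⟫_ℝ) : ℝ) * Complex.I) =
      Complex.exp ((2 * Real.pi * ⟪ξ, p.1⟫_ℝ : ℝ) * Complex.I) *
        Complex.exp (s * (2 * Real.pi * Complex.I * waveNumber n ξ j)) := by
    rw [← Complex.exp_add, ← Complex.exp_add]
    congr 1
    have e2' := congrArg (fun r : ℝ => (r : ℂ)) e2
    push_cast at e2' ⊢
    linear_combination (2 * Real.pi * Complex.I) * e2'
  linear_combination (fourier n p.2 * g ξ) * e3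

/-- Differentiation under the integral; the translation factor has modulus 1, so the modulus of the
differentiated profile itself is a dominating function. -/
theorem hasDerivAt_bandFn {ρ : ℝ} {g : Plane → ℂ} (hg : BandLimited ρ g) (n : ℤ) (p : Layer) (j : Fin 3) :
    HasDerivAt (fun s : ℝ => bandFn n g (p + cover (EuclideanSpace.single j s)))
      (bandFn n (fun ξ => 2 * Real.pi * Complex.I * waveNumber n ξ j * g ξ) p) 0 := by
  simp_rw [bandFn_add_cover_single]
  rw [bandFn]
  refine HasDerivAt.const_mul _ ?_
  have hk := (hg.waveNumber_mul n j).integrable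
  have hm := measurable_waveNumber n j
  have hn : ∀ (s : ℝ) (ξ : Plane), ‖Complex.exp (s * (2 * Real.pi * Complex.I * waveNumber n ξ j))‖ = 1 := by
    intro s ξ
    have : (s : ℂ) * (2 * Real.pi * Complex.I * waveNumber n ξ j) =
        (s * (2 * Real.pi * waveNumber n ξ j) : ℝ) * Complex.I := by push_cast; ring
    rw [this, Complex.norm_exp_ofReal_mul_I]
  have key := hasDerivAt_integral_of_dominated_loc_of_deriv_le (μ := (volume : Measure Plane))
    (F := fun (s : ℝ) ξ => Complex.exp ((2 * Real.pi * ⟪ξ, p.1⟫_ℝ : ℝ) * Complex.I) *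
        (Complex.exp (s * (2 * Real.pi * Complex.I * waveNumber n ξ j)) * g ξ))
    (F' := fun (s : ℝ) ξ => Complex.exp ((2 * Real.pi * ⟪ξ, p.1⟫_ℝ : ℝ) * Complex.I) *
        ((Complex.exp (s * (2 * Real.pi * Complex.I * waveNumber n ξ j)) *
          (1 * (2 * Real.pi * Complex.I * waveNumber n ξ j))) * g ξ))
    (x₀ := 0) (s := univ) (bound := fun ξ => ‖2 * Real.pi * Complex.I * waveNumber n ξ j * g ξ‖)
    Filter.univ_mem (.of_forall fun s => ?_) ?_ ?_ ?_ hk.norm ?_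
  · convert! key.2 using 1
    rw [Real.fourierInv_eq']
    simp
  · exact (Measurable.aestronglyMeasurable (by fun_prop)).mul
      ((Measurable.aestronglyMeasurable (by fun_prop)).mul hg.memLp.1)
  · refine hg.integrable.mono ((Measurable.aestronglyMeasurable (by fun_prop)).mul
      ((Measurable.aestronglyMeasurable (by fun_prop)).mul hg.memLp.1)) (.of_forall fun ξ => ?_)
    rw [norm_mul, norm_mul, hn, Complex.norm_exp_ofReal_mul_I, one_mul, one_mul]
  · exact (Measurable.aestronglyMeasurable (by fun_prop)).mul
      ((Measurable.aestronglyMeasurable (by fun_prop)).mul hg.memLp.1)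
  · refine .of_forall fun ξ s _ => le_of_eq ?_
    rw [norm_mul, norm_mul, norm_mul (Complex.exp _), hn, Complex.norm_exp_ofReal_mul_I, one_mul,
      one_mul, one_mul, ← norm_mul]
  · refine .of_forall fun ξ s _ => ?_
    refine HasDerivAt.const_mul _ (HasDerivAt.mul_const ?_ _)
    exact ((Complex.ofRealCLM.hasDerivAt (x := s)).mul_const _).cexp

theorem partialD_re_bandFn {ρ : ℝ} {g : Plane → ℂ} (hg : BandLimited ρ g) (n : ℤ) (p : Layer) (j : Fin 3) :
    partialD j (fun p => (bandFn n g p).re) p =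
      (bandFn n (fun ξ => 2 * Real.pi * Complex.I * waveNumber n ξ j * g ξ) p).re :=
  (Complex.reCLM.hasFDerivAt.comp_hasDerivAt _ (hasDerivAt_bandFn hg n p j)).deriv

theorem grad_re_bandFn {ρ : ℝ} {g : Plane → ℂ} (hg : BandLimited ρ g) (n : ℤ) :
    grad (fun p => (bandFn n g p).re) =
      bandField n fun j ξ => 2 * Real.pi * Complex.I * waveNumber n ξ j * g ξ := by
  funext p
  simp only [grad, bandField, partialD_re_bandFn hg]

theorem partialD_bandField {ρ : ℝ} {g : Fin 3 → Plane → ℂ} (hg : ∀ i, BandLimited ρ (g i)) (n : ℤ)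
    (j : Fin 3) :
    partialD j (bandField n g) =
      bandField n fun i ξ => 2 * Real.pi * Complex.I * waveNumber n ξ j * g i ξ := by
  funext p
  refine HasDerivAt.deriv ?_
  have : HasDerivAt (fun s : ℝ => fun i => (bandFn n (g i) (p + cover (EuclideanSpace.single j s))).re)
      (fun i => (bandFn n (fun ξ => 2 * Real.pi * Complex.I * waveNumber n ξ j * g i ξ) p).re) 0 :=
    hasDerivAt_pi.2 fun i => Complex.reCLM.hasFDerivAt.comp_hasDerivAt _ (hasDerivAt_bandFn (hg i) n p j)
  exact (PiLp.hasFDerivAt_toLp (𝕜 := ℝ) 2 _).comp_hasDerivAt _ this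

theorem sum_waveNumber_sq (n : ℤ) (ξ : Plane) :
    ∑ j, waveNumber n ξ j ^ 2 = (n : ℝ) ^ 2 + ‖ξ‖ ^ 2 := by
  rw [plane_norm_sq, Fin.sum_univ_three]
  simp [waveNumber]; ring

theorem bandFn_sum {ρ : ℝ} {ι : Type*} (s : Finset ι) {g : ι → Plane → ℂ}
    (hg : ∀ i, BandLimited ρ (g i)) (n : ℤ) (p : Layer) :
    bandFn n (fun ξ => ∑ i ∈ s, g i ξ) p = ∑ i ∈ s, bandFn n (g i) p := by
  simp only [bandFn, Real.fourierInv_eq, Finset.smul_sum]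
  rw [integral_finsetSum, Finset.mul_sum]
  intro i _
  have := (Real.fourierIntegral_convergent_iff (μ := volume) (f := g i) (-p.1)).2 (hg i).integrable
  simpa using this

theorem laplace_bandField {ρ : ℝ} {g : Fin 3 → Plane → ℂ} (hg : ∀ i, BandLimited ρ (g i)) (n : ℤ) :
    laplace (bandField n g) =
      bandField n fun i ξ => ((-(4 * Real.pi ^ 2 * ((n : ℝ) ^ 2 + ‖ξ‖ ^ 2)) : ℝ) : ℂ) * g i ξ := by
  funext p
  have h1 : ∀ j, partialD j (partialD j (bandField n g)) = _ := fun j => by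
    rw [partialD_bandField hg, partialD_bandField fun i => (hg i).waveNumber_mul n j]
  simp only [laplace, h1]
  ext i
  simp only [bandField, PiLp.toLp_apply, WithLp.ofLp_sum, Finset.sum_apply]
  rw [← Complex.re_sum, ← bandFn_sum _ fun j => ((hg i).waveNumber_mul n j).waveNumber_mul n j]
  congr 3
  funext ξ
  rw [← sum_waveNumber_sq]
  push_cast
  rw [Finset.mul_sum, ← Finset.sum_neg_distrib, Finset.sum_mul]
  refine Finset.sum_congr rfl fun j _ => ?_
  linear_combination (4 * Real.pi ^ 2 * (waveNumber n ξ j : ℂ) ^ 2 * g i ξ) * Complex.I_sq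

/-! ### Product rules and integration by parts on the layer -/

section SmoothLiftCalculus

variable {F : Type*} [NormedAddCommGroup F] [NormedSpace ℝ F]

theorem IsTestFunction.smoothLift {φ : Layer → F} (h : IsTestFunction φ) : SmoothLift φ := h.1

theorem SmoothLift.continuous {φ : Layer → F} (hφ : SmoothLift φ) : Continuous φ :=
  isOpenQuotientMap_cover.isQuotientMap.continuous_iff.2 (ContDiff.continuous hφ)

theorem SmoothLift.hasDerivAt_cover {φ : Layer → F} (hφ : SmoothLift φ) (j : Fin 3) (y : Vec3) :
    HasDerivAt (fun s : ℝ => φ (cover y + cover (EuclideanSpace.single j s)))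
      (fderiv ℝ (fun y : Vec3 => φ (cover y)) y (EuclideanSpace.single j 1)) 0 := by
  have hd : DifferentiableAt ℝ (fun y : Vec3 => φ (cover y)) y :=
    (ContDiff.differentiable hφ (by simp)).differentiableAt
  have := hd.hasFDerivAt.hasLineDerivAt (EuclideanSpace.single j 1)
  refine HasDerivAt.congr_of_eventuallyEq (show HasDerivAt _ _ _ from this) (.of_forall fun s => ?_)
  dsimp only
  rw [← cover_add]
  congr 3
  ext i
  simp

theorem SmoothLift.hasDerivAt {φ : Layer → F} (hφ : SmoothLift φ) (j : Fin 3) (p : Layer) :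
    HasDerivAt (fun s : ℝ => φ (p + cover (EuclideanSpace.single j s))) (_root_.partialD j φ p) 0 := by
  obtain ⟨y, rfl⟩ := isOpenQuotientMap_cover.surjective p
  exact (hφ.hasDerivAt_cover j y).differentiableAt.hasDerivAt

theorem SmoothLift.hasDerivAt' {φ : Layer → F} (hφ : SmoothLift φ) (j : Fin 3) (p : Layer) (s : ℝ) :
    HasDerivAt (fun s : ℝ => φ (p + cover (EuclideanSpace.single j s)))
      (_root_.partialD j φ (p + cover (EuclideanSpace.single j s))) s := by
  have h := hφ.hasDerivAt j (p + cover (EuclideanSpace.single j s))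
  have h2 : HasDerivAt (fun s' : ℝ => s' - s) 1 s := (hasDerivAt_id s).sub_const s
  have h3 := HasDerivAt.scomp_of_eq s h h2 (sub_self s).symm
  rw [one_smul] at h3
  refine h3.congr_of_eventuallyEq (.of_forall fun r => ?_)
  simp only [Function.comp_apply]
  rw [add_assoc, ← cover_single_add, add_sub_cancel]

theorem SmoothLift.partialD {φ : Layer → F} (hφ : SmoothLift φ) (j : Fin 3) :
    SmoothLift (partialD j φ) := by
  have : (fun y : Vec3 => _root_.partialD j φ (cover y)) = fun y =>
      fderiv ℝ (fun y : Vec3 => φ (cover y)) y (EuclideanSpace.single j 1) := by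
    funext y; exact (hφ.hasDerivAt_cover j y).deriv
  rw [SmoothLift, this]
  exact (ContDiff.fderiv_right (m := ∞) hφ (by simp)).clm_apply contDiff_const

theorem SmoothLift.smul {a : Layer → ℝ} {φ : Layer → F} (ha : SmoothLift a) (hφ : SmoothLift φ) :
    SmoothLift fun p => a p • φ p := ContDiff.smul ha hφ

theorem SmoothLift.partialD_smul {a : Layer → ℝ} {φ : Layer → F} (ha : SmoothLift a)
    (hφ : SmoothLift φ) (j : Fin 3) :
    _root_.partialD j (fun p => a p • φ p) =
      fun p => a p • _root_.partialD j φ p + _root_.partialD j a p • φ p := by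
  funext p
  have := ((ha.hasDerivAt j p).fun_smul (hφ.hasDerivAt j p)).deriv
  simpa [_root_.partialD, cover_single_zero] using this

theorem SmoothLift.partialD_add {φ ψ : Layer → F} (hφ : SmoothLift φ) (hψ : SmoothLift ψ) (j : Fin 3) :
    _root_.partialD j (fun p => φ p + ψ p) =
      fun p => _root_.partialD j φ p + _root_.partialD j ψ p := by
  funext p
  exact ((hφ.hasDerivAt j p).add (hψ.hasDerivAt j p)).deriv

theorem SmoothLift.laplace_smul {a : Layer → ℝ} {φ : Layer → F} (ha : SmoothLift a)
    (hφ : SmoothLift φ) (p : Layer) :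
    laplace (fun p => a p • φ p) p = a p • laplace φ p +
      ∑ j, ((2 : ℝ) • (_root_.partialD j a p • _root_.partialD j φ p) +
        _root_.partialD j (_root_.partialD j a) p • φ p) := by
  simp only [laplace, Finset.smul_sum]
  rw [← Finset.sum_add_distrib]
  refine Finset.sum_congr rfl fun j _ => ?_
  rw [ha.partialD_smul hφ, SmoothLift.partialD_add (ha.smul (hφ.partialD j)) ((ha.partialD j).smul hφ),
    ha.partialD_smul (hφ.partialD j), (ha.partialD j).partialD_smul hφ]
  dsimp only
  module

/-- The integral of a derivative of a test function vanishes, by translation invariance. -/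
theorem IsTestFunction.integral_partialD {f : Layer → ℝ} (hf : IsTestFunction f) (j : Fin 3) :
    ∫ p, _root_.partialD j f p = 0 := by
  have hs := hf.smoothLift
  have hDt := hf.partialD j
  have hDc : Continuous (_root_.partialD j f) := hDt.continuous
  obtain ⟨M, hM⟩ := hDc.bounded_above_of_compact_support hDt.2
  have hcov : Continuous fun s : ℝ => cover (EuclideanSpace.single j s) := by
    refine isOpenQuotientMap_cover.continuous.comp ((PiLp.continuous_toLp 2 _).comp (continuous_pi fun i => ?_))
    by_cases hij : i = j
    · subst hij; simpa using continuous_id'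
    · simpa [hij] using continuous_const
  -- A compact set containing the supports of all translates with `|s| ≤ 1`; a constant on `K`
  -- dominates the derivatives. Translation invariance makes the differentiated integral constant in
  -- `s`.
  set K : Set Layer := (fun q : Layer × ℝ => q.1 - cover (EuclideanSpace.single j q.2)) ''
    (tsupport (_root_.partialD j f) ×ˢ Icc (-1 : ℝ) 1) with hK
  have hKc : IsCompact K := (hDt.2.isCompact.prod isCompact_Icc).image
    (continuous_fst.sub (hcov.comp continuous_snd))
  have hconst : (fun s : ℝ => ∫ p, f (p + cover (EuclideanSpace.single j s))) = fun _ => ∫ p, f p := by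
    funext s; exact integral_add_right_eq_self f _
  have key := hasDerivAt_integral_of_dominated_loc_of_deriv_le (μ := (volume : Measure Layer))
    (F := fun (s : ℝ) p => f (p + cover (EuclideanSpace.single j s)))
    (F' := fun (s : ℝ) p => _root_.partialD j f (p + cover (EuclideanSpace.single j s)))
    (x₀ := 0) (s := Icc (-1) 1) (bound := K.indicator fun _ => M)
    (Icc_mem_nhds (by norm_num) (by norm_num))
    (.of_forall fun s => ((hs.continuous.comp (by fun_prop)).aestronglyMeasurable))
    ?_ ?_ ?_ ?_ (.of_forall fun p s _ => hs.hasDerivAt' j p s)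
  · have h2 := key.2
    rw [hconst] at h2
    have := h2.unique (hasDerivAt_const _ _)
    simpa [cover_single_zero] using this
  · simpa [cover_single_zero] using hs.continuous.integrable_of_hasCompactSupport hf.2
  · exact (hDc.comp (by fun_prop)).aestronglyMeasurable
  · refine .of_forall fun p s hsm => ?_
    by_cases hp : p ∈ K
    · rw [indicator_of_mem hp]; exact hM _
    · rw [indicator_of_notMem hp, norm_le_zero_iff]
      refine image_eq_zero_of_notMem_tsupport fun hmem => ?_
      exact hp ⟨(p + cover (EuclideanSpace.single j s), s), ⟨hmem, hsm⟩, by simp⟩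
  · exact (integrable_indicator_iff hKc.measurableSet).2 (integrableOn_const hKc.measure_lt_top.ne)

/-- Integration by parts against test functions. -/
theorem IsTestFunction.integral_inner_partialD {φ ψ : Layer → Vec3} (hφ : IsTestFunction φ)
    (hψ : SmoothLift ψ) (j : Fin 3) :
    ∫ p, ⟪ψ p, _root_.partialD j φ p⟫_ℝ = -∫ p, ⟪_root_.partialD j ψ p, φ p⟫_ℝ := by
  have hcs : ∀ {a b : Layer → Vec3}, HasCompactSupport b → HasCompactSupport fun p => ⟪a p, b p⟫_ℝ :=
    fun {a b} hb => hb.mono (by intro p hp hb0; exact hp (by simp [hb0]))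
  have ht : IsTestFunction fun p => ⟪ψ p, φ p⟫_ℝ := ⟨ContDiff.inner ℝ hψ hφ.1, hcs hφ.2⟩
  have h0 := ht.integral_partialD j
  have e : ∀ p, _root_.partialD j (fun p => ⟪ψ p, φ p⟫_ℝ) p =
      ⟪ψ p, _root_.partialD j φ p⟫_ℝ + ⟪_root_.partialD j ψ p, φ p⟫_ℝ := fun p => by
    have := ((hψ.hasDerivAt j p).inner ℝ (hφ.smoothLift.hasDerivAt j p)).deriv
    simpa [_root_.partialD, cover_single_zero] using this
  simp_rw [e] at h0
  rw [integral_add] at h0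
  · linarith
  · exact (hψ.continuous.inner (hφ.partialD j).continuous).integrable_of_hasCompactSupport
      (hcs (hφ.partialD j).2)
  · exact ((hψ.partialD j).continuous.inner hφ.continuous).integrable_of_hasCompactSupport (hcs hφ.2)

theorem IsTestFunction.integrable_inner {φ ψ : Layer → Vec3} (hφ : IsTestFunction φ)
    (hψ : Continuous ψ) : Integrable fun p => ⟪ψ p, φ p⟫_ℝ :=
  (hψ.inner hφ.continuous).integrable_of_hasCompactSupport
    (hφ.2.mono (by intro p hp hb0; exact hp (by simp [hb0])))

theorem IsTestFunction.integral_inner_laplace {φ ψ : Layer → Vec3} (hφ : IsTestFunction φ)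
    (hψ : SmoothLift ψ) :
    ∫ p, ⟪ψ p, laplace φ p⟫_ℝ = ∫ p, ⟪laplace ψ p, φ p⟫_ℝ := by
  simp only [laplace, inner_sum, sum_inner]
  rw [integral_finsetSum, integral_finsetSum]
  · refine Finset.sum_congr rfl fun j _ => ?_
    rw [(hφ.partialD j).integral_inner_partialD hψ, hφ.integral_inner_partialD (hψ.partialD j), neg_neg]
  · exact fun j _ => hφ.integrable_inner ((hψ.partialD j).partialD j).continuous
  · exact fun j _ => ((hφ.partialD j).partialD j).integrable_inner hψ.continuous

/-- The gradient is the sum of the derivatives `∂ⱼ (f eⱼ)`, to each of which the vector-valued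
integration by parts applies. -/
theorem IsTestFunction.integral_inner_grad_eq {f : Layer → ℝ} {ψ : Layer → Vec3}
    (hf : IsTestFunction f) (hψ : SmoothLift ψ) :
    ∫ p, ⟪ψ p, grad f p⟫_ℝ = -∫ p, (∑ j, _root_.partialD j ψ p j) * f p := by
  have ht : ∀ j, IsTestFunction fun p => (EuclideanSpace.single j (f p) : Vec3) := fun j => by
    refine ⟨contDiff_euclidean.2 fun i => ?_, hf.2.comp_left (g := fun t => (EuclideanSpace.single j t : Vec3)) (by simp)⟩
    by_cases hij : i = j
    · subst hij; simpa using hf.1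
    · simpa [hij] using contDiff_const
  have hp : ∀ j, _root_.partialD j (fun p => (EuclideanSpace.single j (f p) : Vec3)) =
      fun p => EuclideanSpace.single j (_root_.partialD j f p) := fun j => by
    funext p
    have h1 : HasDerivAt (fun s : ℝ => Pi.single (M := fun _ : Fin 3 => ℝ) j (f (p + cover (EuclideanSpace.single j s))))
        (Pi.single j (_root_.partialD j f p)) 0 := by
      refine hasDerivAt_pi.2 fun i => ?_
      by_cases hij : i = j
      · subst hij; simpa using hf.smoothLift.hasDerivAt i p
      · simpa [hij] using hasDerivAt_const _ _
    exact ((PiLp.hasFDerivAt_toLp (𝕜 := ℝ) 2 _).comp_hasDerivAt _ h1).deriv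
  have e1 : ∀ p, ⟪ψ p, grad f p⟫_ℝ = ∑ j, ⟪ψ p,
      _root_.partialD j (fun p => (EuclideanSpace.single j (f p) : Vec3)) p⟫_ℝ := fun p => by
    simp [hp, grad, PiLp.inner_apply]
  simp_rw [e1]
  rw [integral_finsetSum _ fun j _ => ((ht j).partialD j).integrable_inner hψ.continuous]
  simp_rw [(ht _).integral_inner_partialD hψ]
  rw [Finset.sum_neg_distrib, ← integral_finsetSum _ fun j _ => (ht j).integrable_inner (hψ.partialD j).continuous]
  congr 2
  funext p
  simp [EuclideanSpace.inner_single_right, Finset.mul_sum, mul_comm]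

end SmoothLiftCalculus

/-! ### Horizontal cutoffs and approximation by test functions -/

theorem tendsto_toLp_of_dominated {α E : Type*} [MeasurableSpace α] {μ : Measure α}
    [NormedAddCommGroup E] {φ : ℕ → α → E} {φ' : α → E} {Ψ : α → ℝ}
    (hm : ∀ m, MemLp (φ m) 2 μ) (h' : MemLp φ' 2 μ) (hΨ : MemLp Ψ 2 μ)
    (hb : ∀ m p, ‖φ m p‖ ≤ Ψ p) (hl : ∀ p, Tendsto (fun m => φ m p) atTop (𝓝 (φ' p))) :
    Tendsto (fun m => (hm m).toLp (φ m)) atTop (𝓝 (h'.toLp φ')) := by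
  rw [Lp.tendsto_Lp_iff_tendsto_eLpNorm'']
  have hb' : ∀ p, ‖φ' p‖ ≤ Ψ p := fun p => le_of_tendsto (hl p).norm (.of_forall fun m => hb m p)
  have hΨt : ∫⁻ p, ‖(2 * Ψ p)‖ₑ ^ (2 : ℝ) ∂μ ≠ ⊤ := by
    have h := (hΨ.const_mul 2).2
    rw [eLpNorm_lt_top_iff_lintegral_rpow_enorm_lt_top (by simp) (by simp)] at h
    exact ne_of_lt (by simpa using h)
  have key : Tendsto (fun m => ∫⁻ p, ‖φ m p - φ' p‖ₑ ^ (2 : ℝ) ∂μ) atTop (𝓝 (∫⁻ _, 0 ∂μ)) := by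
    refine tendsto_lintegral_of_dominated_convergence' (fun p => ‖(2 * Ψ p)‖ₑ ^ (2 : ℝ))
      (fun m => (((hm m).sub h').1.enorm.pow_const _)) (fun m => .of_forall fun p => ?_) hΨt
      (.of_forall fun p => ?_)
    · refine ENNReal.rpow_le_rpow (enorm_le_iff_norm_le.2 ?_) (by norm_num)
      refine (norm_sub_le _ _).trans ((add_le_add (hb m p) (hb' p)).trans ?_)
      rw [← two_mul]; exact le_abs_self _
    · have h1 : Tendsto (fun m => ‖φ m p - φ' p‖ₑ) atTop (𝓝 0) := by
        have := ((hl p).sub_const (φ' p)).enorm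
        simpa using this
      have h2 := (ENNReal.continuous_rpow_const (y := 2)).tendsto 0 |>.comp h1
      simpa [Function.comp_def] using h2
  rw [lintegral_zero] at key
  have h3 := (ENNReal.continuous_rpow_const (y := 1 / 2)).tendsto 0 |>.comp key
  rw [ENNReal.zero_rpow_of_pos (by norm_num)] at h3
  refine h3.congr fun m => ?_
  rw [eLpNorm_eq_lintegral_rpow_enorm_toReal (by simp) (by simp)]
  simp

/-- A fixed bump function of the horizontal variable. -/
def planeBump : ContDiffBump (0 : Plane) := ⟨1, 2, one_pos, one_lt_two⟩

def layerBump (p : Layer) : ℝ := planeBump p.1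

def dilate (ε : ℝ) (p : Layer) : Layer := (ε • p.1, p.2)

/-- Horizontal cutoffs that increase to `1`. -/
def cutoff (m : ℕ) (p : Layer) : ℝ := layerBump (dilate ((m : ℝ) + 1)⁻¹ p)

theorem hasCompactSupport_comp_fst {E : Type*} [Zero E] {f : Plane → E} (hf : HasCompactSupport f) :
    HasCompactSupport fun p : Layer => f p.1 := by
  refine HasCompactSupport.intro (hf.isCompact.prod isCompact_univ) fun p hp => ?_
  exact image_eq_zero_of_notMem_tsupport fun h => hp ⟨h, mem_univ _⟩

theorem smoothLift_comp_fst {f : Plane → ℝ} (hf : ContDiff ℝ ∞ f) :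
    SmoothLift fun p : Layer => f p.1 := by
  have h1 : ContDiff ℝ ∞ fun y : Vec3 => (!₂[y 0, y 1] : Plane) := by
    refine contDiff_euclidean.2 fun i => ?_
    fin_cases i <;> simp <;> fun_prop
  exact hf.comp h1

theorem isTestFunction_layerBump : IsTestFunction layerBump :=
  ⟨smoothLift_comp_fst planeBump.contDiff, hasCompactSupport_comp_fst planeBump.hasCompactSupport⟩

theorem isTestFunction_cutoff (m : ℕ) : IsTestFunction (cutoff m) := by
  have hm : ((m : ℝ) + 1)⁻¹ ≠ 0 := by positivity
  refine ⟨smoothLift_comp_fst (f := fun x => planeBump (((m : ℝ) + 1)⁻¹ • x))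
    (planeBump.contDiff.comp (contDiff_const_smul _)), ?_⟩
  exact hasCompactSupport_comp_fst (f := fun x => planeBump (((m : ℝ) + 1)⁻¹ • x))
    (planeBump.hasCompactSupport.comp_smul hm)

/-- The circle cannot be dilated, so `dilate` scales only the plane. For functions independent of
the vertical variable the chain rule still holds in all three directions. -/
theorem partialD_comp_dilate {c : Layer → ℝ} (hc : ∀ x z z', c (x, z) = c (x, z')) (ε : ℝ) (j : Fin 3)
    (p : Layer) :
    partialD j (fun p => c (dilate ε p)) p = ε * partialD j c (dilate ε p) := by
  have e : (fun s : ℝ => c (dilate ε (p + cover (EuclideanSpace.single j s)))) =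
      fun s => (fun r => c (dilate ε p + cover (EuclideanSpace.single j r))) (ε * s) := by
    funext s
    have h1 : (dilate ε (p + cover (EuclideanSpace.single j s))).1 =
        (dilate ε p + cover (EuclideanSpace.single j (ε * s))).1 := by
      ext i
      fin_cases j <;> fin_cases i <;> simp [dilate, cover]
    rw [← Prod.mk.eta (p := dilate ε (p + cover (EuclideanSpace.single j s))), h1]
    exact hc _ _ _
  unfold partialD
  rw [e]
  have := deriv_comp_mul_left ε (fun r => c (dilate ε p + cover (EuclideanSpace.single j r))) 0
  simpa using this

theorem partialD_vertical_invariant {c : Layer → ℝ} (hc : ∀ x z z', c (x, z) = c (x, z')) (j : Fin 3)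
    (x : Plane) (z z' : UnitAddCircle) : partialD j c (x, z) = partialD j c (x, z') := by
  unfold partialD
  congr 1
  funext s
  exact hc _ _ _

theorem cutoff_nonneg (m : ℕ) (p : Layer) : 0 ≤ cutoff m p := planeBump.nonneg

theorem cutoff_le_one (m : ℕ) (p : Layer) : cutoff m p ≤ 1 := planeBump.le_one

theorem tendsto_cutoff (p : Layer) : Tendsto (fun m => cutoff m p) atTop (𝓝 1) := by
  have h1 : Tendsto (fun m : ℕ => ((m : ℝ) + 1)⁻¹ • p.1) atTop (𝓝 ((0 : ℝ) • p.1)) := by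
    refine Tendsto.smul_const ?_ _
    simpa [one_div] using tendsto_one_div_add_atTop_nhds_zero_nat (𝕜 := ℝ)
  have h2 := (planeBump.continuous.tendsto _).comp h1
  rw [zero_smul, planeBump.one_of_mem_closedBall (by simp [planeBump])] at h2
  exact h2

/-- Every derivative of a dilated bump gains a factor `ε = 1/(m+1)`; the second derivative gains
`ε²`, which is relaxed to `ε`. -/
theorem exists_partialD_cutoff_le : ∃ C : ℝ, 0 ≤ C ∧ ∀ m j p,
    |partialD j (cutoff m) p| ≤ C * ((m : ℝ) + 1)⁻¹ ∧
    |partialD j (partialD j (cutoff m)) p| ≤ C * ((m : ℝ) + 1)⁻¹ := by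
  have hinv : ∀ x z z', layerBump (x, z) = layerBump (x, z') := fun _ _ _ => rfl
  have hb : ∀ {f : Layer → ℝ}, IsTestFunction f → ∃ C, ∀ p, ‖f p‖ ≤ C := fun {f} hf =>
    hf.continuous.bounded_above_of_compact_support hf.2
  choose C1 hC1 using fun j => hb (isTestFunction_layerBump.partialD j)
  choose C2 hC2 using fun j => hb ((isTestFunction_layerBump.partialD j).partialD j)
  have n1 : ∀ j, 0 ≤ C1 j := fun j => (norm_nonneg _).trans (hC1 j 0)
  have n2 : ∀ j, 0 ≤ C2 j := fun j => (norm_nonneg _).trans (hC2 j 0)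
  have hsum : ∀ j, C1 j + C2 j ≤ ∑ j, (C1 j + C2 j) := fun j =>
    Finset.single_le_sum (f := fun j => C1 j + C2 j) (fun i _ => add_nonneg (n1 i) (n2 i)) (Finset.mem_univ j)
  refine ⟨∑ j, (C1 j + C2 j), Finset.sum_nonneg fun i _ => add_nonneg (n1 i) (n2 i), fun m j p => ?_⟩
  set ε : ℝ := ((m : ℝ) + 1)⁻¹ with hε
  have hε0 : 0 < ε := by positivity
  have hε1 : ε ≤ 1 := inv_le_one_of_one_le₀ (by simp)
  have e1 : partialD j (cutoff m) = fun p => ε * partialD j layerBump (dilate ε p) :=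
    funext fun p => partialD_comp_dilate hinv ε j p
  have e2 : partialD j (partialD j (cutoff m)) p =
      ε * (ε * partialD j (partialD j layerBump) (dilate ε p)) := by
    rw [e1, ← partialD_comp_dilate (partialD_vertical_invariant hinv j)]
    unfold partialD
    exact deriv_const_mul_field ε
  have h1 := hC1 j (dilate ε p)
  have h2 := hC2 j (dilate ε p)
  rw [Real.norm_eq_abs] at h1 h2
  have := hsum j
  have := n1 j
  have := n2 j
  constructor
  · rw [e1, abs_mul, abs_of_pos hε0, mul_comm]
    gcongr; linarith
  · rw [e2, abs_mul, abs_mul, abs_of_pos hε0, mul_comm]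
    gcongr
    calc ε * |partialD j (partialD j layerBump) (dilate ε p)| ≤ 1 * C2 j := by gcongr
      _ ≤ _ := by linarith

section Approximation

variable {F : Type*} [NormedAddCommGroup F] [NormedSpace ℝ F]

theorem SmoothLift.isTestFunction_cutoff_smul {φ : Layer → F} (hφ : SmoothLift φ) (m : ℕ) :
    IsTestFunction fun p => cutoff m p • φ p :=
  ⟨(isTestFunction_cutoff m).smoothLift.smul hφ, (isTestFunction_cutoff m).2.smul_right⟩

theorem IsTestFunction.laplace {φ : Layer → F} (hφ : IsTestFunction φ) : IsTestFunction (laplace φ) := by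
  refine ⟨ContDiff.sum fun j _ => ((hφ.partialD j).partialD j).1, ?_⟩
  have : _root_.laplace φ = fun p => _root_.partialD 0 (_root_.partialD 0 φ) p +
      _root_.partialD 1 (_root_.partialD 1 φ) p + _root_.partialD 2 (_root_.partialD 2 φ) p :=
    funext fun p => Fin.sum_univ_three _
  rw [this]
  exact ((((hφ.partialD 0).partialD 0).2.add ((hφ.partialD 1).partialD 1).2)).add
    ((hφ.partialD 2).partialD 2).2

theorem IsTestFunction.memLp {φ : Layer → F} (hφ : IsTestFunction φ) (p : ℝ≥0∞) : MemLp φ p volume :=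
  hφ.continuous.memLp_of_hasCompactSupport hφ.2

theorem tendsto_inv_nat_succ : Tendsto (fun m : ℕ => ((m : ℝ) + 1)⁻¹) atTop (𝓝 0) := by
  simpa [one_div] using tendsto_one_div_add_atTop_nhds_zero_nat (𝕜 := ℝ)

theorem inv_nat_succ_le_one (m : ℕ) : ((m : ℝ) + 1)⁻¹ ≤ 1 := inv_le_one_of_one_le₀ (by simp)

theorem SmoothLift.tendsto_cutoff_smul {φ : Layer → F} (hφ : SmoothLift φ) (h2 : MemLp φ 2 volume) :
    Tendsto (fun m => ((hφ.isTestFunction_cutoff_smul m).memLp 2).toLp _) atTop (𝓝 (h2.toLp φ)) := by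
  refine tendsto_toLp_of_dominated _ _ h2.norm (fun m p => ?_) fun p => ?_
  · rw [norm_smul, Real.norm_of_nonneg (cutoff_nonneg m p)]
    exact mul_le_of_le_one_left (norm_nonneg _) (cutoff_le_one m p)
  · simpa using (tendsto_cutoff p).smul_const (φ p)

theorem tendsto_partialD_cutoff (j : Fin 3) (p : Layer) :
    Tendsto (fun m => _root_.partialD j (cutoff m) p) atTop (𝓝 0) ∧
    Tendsto (fun m => _root_.partialD j (_root_.partialD j (cutoff m)) p) atTop (𝓝 0) := by
  obtain ⟨C, _, hC⟩ := exists_partialD_cutoff_le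
  have h0 : Tendsto (fun m : ℕ => C * ((m : ℝ) + 1)⁻¹) atTop (𝓝 0) := by
    simpa using tendsto_inv_nat_succ.const_mul C
  exact ⟨squeeze_zero_norm (fun m => (hC m j p).1) h0, squeeze_zero_norm (fun m => (hC m j p).2) h0⟩

/-- In the product rule every term with a derivative on the cutoff tends to zero, while multiples of
`‖φ‖`, `‖∂ⱼφ‖` and `‖Δφ‖` dominate everything in `L²`. -/
theorem SmoothLift.tendsto_laplace_cutoff_smul {φ : Layer → F} (hφ : SmoothLift φ)
    (h2 : MemLp φ 2 volume) (hd : ∀ j, MemLp (_root_.partialD j φ) 2 volume)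
    (hl : MemLp (laplace φ) 2 volume) :
    Tendsto (fun m => (((hφ.isTestFunction_cutoff_smul m).laplace).memLp 2).toLp _) atTop
      (𝓝 (hl.toLp (laplace φ))) := by
  obtain ⟨C, hC0, hC⟩ := exists_partialD_cutoff_le
  have hC1 : ∀ m j p, |_root_.partialD j (cutoff m) p| ≤ C ∧
      |_root_.partialD j (_root_.partialD j (cutoff m)) p| ≤ C := fun m j p =>
    ⟨(hC m j p).1.trans (mul_le_of_le_one_right hC0 (inv_nat_succ_le_one m)),
      (hC m j p).2.trans (mul_le_of_le_one_right hC0 (inv_nat_succ_le_one m))⟩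
  have hdom : MemLp (fun p => ‖laplace φ p‖ +
      ∑ j, (2 * C * ‖_root_.partialD j φ p‖ + C * ‖φ p‖)) 2 volume :=
    hl.norm.add (memLp_finsetSum _ fun j _ => ((hd j).norm.const_mul _).add (h2.norm.const_mul _))
  refine tendsto_toLp_of_dominated _ _ hdom (fun m p => ?_) fun p => ?_
  · rw [(isTestFunction_cutoff m).smoothLift.laplace_smul hφ]
    refine (norm_add_le _ _).trans (add_le_add ?_ ((norm_sum_le _ _).trans (Finset.sum_le_sum fun j _ => ?_)))
    · rw [norm_smul, Real.norm_of_nonneg (cutoff_nonneg m p)]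
      exact mul_le_of_le_one_left (norm_nonneg _) (cutoff_le_one m p)
    · refine (norm_add_le _ _).trans (add_le_add ?_ ?_)
      · rw [norm_smul, norm_smul, Real.norm_two, Real.norm_eq_abs, ← mul_assoc]
        gcongr; exact (hC1 m j p).1
      · rw [norm_smul, Real.norm_eq_abs]
        gcongr; exact (hC1 m j p).2
  · simp_rw [(isTestFunction_cutoff _).smoothLift.laplace_smul hφ]
    have h3 : Tendsto (fun m => cutoff m p • laplace φ p +
        ∑ j, ((2 : ℝ) • (_root_.partialD j (cutoff m) p • _root_.partialD j φ p) +
          _root_.partialD j (_root_.partialD j (cutoff m)) p • φ p)) atTop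
        (𝓝 ((1 : ℝ) • laplace φ p + ∑ j, ((2 : ℝ) • ((0 : ℝ) • _root_.partialD j φ p) + (0 : ℝ) • φ p))) := by
      refine ((tendsto_cutoff p).smul_const _).add (tendsto_finsetSum _ fun j _ => ?_)
      exact (((tendsto_partialD_cutoff j p).1.smul_const _).const_smul _).add
        ((tendsto_partialD_cutoff j p).2.smul_const _)
    simpa using h3

/-- Divergence-free fields are orthogonal to square-integrable gradients of smooth functions. -/
theorem IsDivFree.inner_grad_eq_zero {v : L2Field} (hv : IsDivFree v) {q : Layer → ℝ}
    (hq : SmoothLift q) (h2 : MemLp q 2 volume) (hg : MemLp (grad q) 2 volume) :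
    ⟪v, hg.toLp (grad q)⟫_ℝ = 0 := by
  obtain ⟨C, hC0, hC⟩ := exists_partialD_cutoff_le
  have e : ∀ m p, grad (fun p => cutoff m p • q p) p = cutoff m p • grad q p + q p • grad (cutoff m) p := by
    intro m p
    ext j
    simp only [grad, (isTestFunction_cutoff m).smoothLift.partialD_smul hq]
    simp [mul_comm]
  have hgc : ∀ m p, ‖grad (cutoff m) p‖ ≤ 3 * C * ((m : ℝ) + 1)⁻¹ := fun m p => by
    have h3 : grad (cutoff m) p = ∑ j, EuclideanSpace.single j (_root_.partialD j (cutoff m) p) := by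
      ext i; simp [grad, Finset.sum_apply, Pi.single_apply]
    rw [h3]
    refine (norm_sum_le _ _).trans ((Finset.sum_le_card_nsmul _ _ (C * ((m : ℝ) + 1)⁻¹) fun j _ => ?_).trans ?_)
    · rw [PiLp.norm_single]; exact (hC m j p).1
    · simp; linarith
  have ht : Tendsto (fun m => ((hq.isTestFunction_cutoff_smul m).memLp_grad).toLp _) atTop
      (𝓝 (hg.toLp (grad q))) := by
    refine tendsto_toLp_of_dominated _ _ (hg.norm.add (h2.norm.const_mul (3 * C))) (fun m p => ?_) fun p => ?_
    · rw [e]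
      refine (norm_add_le _ _).trans (add_le_add ?_ ?_)
      · rw [norm_smul, Real.norm_of_nonneg (cutoff_nonneg m p)]
        exact mul_le_of_le_one_left (norm_nonneg _) (cutoff_le_one m p)
      · rw [norm_smul, mul_comm]
        exact mul_le_mul_of_nonneg_right ((hgc m p).trans
          (mul_le_of_le_one_right (by positivity) (inv_nat_succ_le_one m))) (norm_nonneg _)
    · simp_rw [e]
      have h0 : Tendsto (fun m => grad (cutoff m) p) atTop (𝓝 0) :=
        squeeze_zero_norm (fun m => hgc m p) (by simpa using tendsto_inv_nat_succ.const_mul (3 * C))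
      simpa using ((tendsto_cutoff p).smul_const (grad q p)).add (h0.const_smul (q p))
  have hz : ∀ m, ⟪v, ((hq.isTestFunction_cutoff_smul m).memLp_grad).toLp _⟫_ℝ = 0 := fun m => by
    exact (integral_inner_grad v (hq.isTestFunction_cutoff_smul m)).symm.trans
      (hv _ (hq.isTestFunction_cutoff_smul m))
  have h4 := Tendsto.inner (𝕜 := ℝ) ht (tendsto_const_nhds (x := v))
  rw [real_inner_comm]
  refine tendsto_nhds_unique h4 (tendsto_const_nhds.congr fun m => ?_)
  rw [real_inner_comm]
  exact (hz m).symm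

end Approximation

/-! ### Synthesis of fields from profiles and Parseval's identity -/

/-- Square-integrable complex functions on the horizontal plane. -/
abbrev PlaneL2 : Type := Lp ℂ 2 (volume : Measure Plane)

theorem norm_fourier_apply (n : ℤ) (z : UnitAddCircle) : ‖fourier n z‖ = 1 := by
  rw [fourier_apply, Circle.norm_coe]

theorem memLp_single_mode (n : ℤ) (i : Fin 3) {G : Plane → ℂ} (hG : MemLp G 2 volume) :
    MemLp (fun p : Layer => (EuclideanSpace.single i (fourier n p.2 * G p.1).re : Vec3)) 2 volume := by
  have h1 := hG.comp_measurePreserving measurePreserving_layer_fst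
  have hc : Continuous fun w : ℂ => (EuclideanSpace.single i w.re : Vec3) := by
    refine (PiLp.continuous_toLp 2 _).comp (continuous_pi fun k => ?_)
    by_cases hij : k = i
    · subst hij; simpa using Complex.continuous_re
    · simpa [hij] using continuous_const
  refine h1.of_le (hc.comp_aestronglyMeasurable (AEStronglyMeasurable.mul ?_ h1.1)) (.of_forall fun p => ?_)
  · exact ((fourier n).continuous.comp continuous_snd).aestronglyMeasurable
  · rw [PiLp.norm_single]
    refine (Complex.abs_re_le_norm _).trans ?_
    rw [norm_mul, norm_fourier_apply, one_mul, Function.comp_apply]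

/-- The field with `i`-th component `Re (e^{2πinz} G(x))`. -/
def liftMode (n : ℤ) (i : Fin 3) (G : PlaneL2) : L2Field :=
  (memLp_single_mode n i (Lp.memLp G)).toLp _

theorem coeFn_liftMode (n : ℤ) (i : Fin 3) (G : PlaneL2) :
    liftMode n i G =ᵐ[volume] fun p => EuclideanSpace.single i (fourier n p.2 * G p.1).re :=
  MemLp.coeFn_toLp _

theorem liftMode_add (n : ℤ) (i : Fin 3) (G H : PlaneL2) :
    liftMode n i (G + H) = liftMode n i G + liftMode n i H := by
  refine Lp.ext ?_
  have := measurePreserving_layer_fst.quasiMeasurePreserving.ae_eq_comp (Lp.coeFn_add G H)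
  filter_upwards [this, coeFn_liftMode n i G, coeFn_liftMode n i H, coeFn_liftMode n i (G + H),
    Lp.coeFn_add (liftMode n i G) (liftMode n i H)] with p hp h1 h2 h3 h4
  simp only [Function.comp_apply, Pi.add_apply] at hp
  rw [h3, h4, Pi.add_apply, h1, h2, hp]
  ext k
  by_cases hk : k = i <;> simp [hk, mul_add]

theorem liftMode_smul (n : ℤ) (i : Fin 3) (r : ℝ) (G : PlaneL2) :
    liftMode n i (r • G) = r • liftMode n i G := by
  refine Lp.ext ?_
  have := measurePreserving_layer_fst.quasiMeasurePreserving.ae_eq_comp (Lp.coeFn_smul r G)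
  filter_upwards [this, coeFn_liftMode n i G, coeFn_liftMode n i (r • G),
    Lp.coeFn_smul r (liftMode n i G)] with p hp h1 h3 h4
  simp only [Function.comp_apply, Pi.smul_apply] at hp
  rw [h3, h4, Pi.smul_apply, h1, hp]
  ext k
  by_cases hk : k = i <;> simp [hk]
  ring

theorem norm_liftMode_le (n : ℤ) (i : Fin 3) (G : PlaneL2) : ‖liftMode n i G‖ ≤ ‖G‖ := by
  refine ENNReal.toReal_mono (Lp.eLpNorm_ne_top _) ?_
  rw [eLpNorm_congr_ae (coeFn_liftMode n i G),
    ← eLpNorm_comp_measurePreserving (Lp.aestronglyMeasurable G) measurePreserving_layer_fst]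
  refine eLpNorm_mono fun p => ?_
  rw [PiLp.norm_single]
  refine (Complex.abs_re_le_norm _).trans ?_
  rw [norm_mul, norm_fourier_apply, one_mul, Function.comp_apply]

/-- `liftMode` as a bounded operator. -/
def liftModeCLM (n : ℤ) (i : Fin 3) : PlaneL2 →L[ℝ] L2Field :=
  LinearMap.mkContinuous
    { toFun := liftMode n i, map_add' := liftMode_add n i, map_smul' := liftMode_smul n i } 1
    fun G => by rw [one_mul]; exact norm_liftMode_le n i G

/-- The inverse Fourier transform of the plane as a real bounded operator. -/
def invFourierCLM : PlaneL2 →L[ℝ] PlaneL2 :=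
  ((Lp.fourierTransformₗᵢ Plane ℂ).symm.toContinuousLinearEquiv : PlaneL2 →L[ℂ] PlaneL2).restrictScalars ℝ

/-- The field with `i`-th component `Re (e^{2πinz} (𝓕⁻ g)(x))`, as a bounded operator of `g`. -/
def synthCLM (n : ℤ) (i : Fin 3) : PlaneL2 →L[ℝ] L2Field := liftModeCLM n i ∘L invFourierCLM

theorem synthCLM_apply (n : ℤ) (i : Fin 3) (g : PlaneL2) : synthCLM n i g = liftMode n i (𝓕⁻ g) := rfl

theorem norm_synthCLM_le (n : ℤ) (i : Fin 3) (g : PlaneL2) : ‖synthCLM n i g‖ ≤ ‖g‖ := by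
  rw [synthCLM_apply]
  exact (norm_liftMode_le n i _).trans ((Lp.fourierTransformₗᵢ Plane ℂ).symm.norm_map g).le

theorem coeFn_synthCLM {ρ : ℝ} {g : Plane → ℂ} (hg : BandLimited ρ g) (n : ℤ) (i : Fin 3) :
    synthCLM n i (hg.memLp.toLp g) =ᵐ[volume]
      fun p => EuclideanSpace.single i (bandFn n g p).re := by
  have h1 : synthCLM n i (hg.memLp.toLp g) =ᵐ[volume] fun p =>
      EuclideanSpace.single i (fourier n p.2 * (𝓕⁻ (hg.memLp.toLp g) : PlaneL2) p.1).re :=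
    coeFn_liftMode n i _
  have h2 := measurePreserving_layer_fst.quasiMeasurePreserving.ae_eq_comp
    (coeFn_fourierInv_toLp hg.memLp hg.integrable)
  filter_upwards [h1, h2] with p hp1 hp2
  simp only [Function.comp_apply] at hp2
  rw [hp1, hp2, bandFn]

theorem bandField_eq_sum (n : ℤ) (g : Fin 3 → Plane → ℂ) (p : Layer) :
    bandField n g p = ∑ i, (EuclideanSpace.single i (bandFn n (g i) p).re : Vec3) := by
  ext k
  simp [bandField, Finset.sum_apply, Pi.single_apply]

theorem coeFn_sum_synthCLM {ρ : ℝ} {g : Fin 3 → Plane → ℂ} (hg : ∀ i, BandLimited ρ (g i)) (n : ℤ) :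
    (∑ i, synthCLM n i ((hg i).memLp.toLp (g i)) : L2Field) =ᵐ[volume] bandField n g := by
  have h1 := Lp.coeFn_finsetSum Finset.univ (fun i => synthCLM n i ((hg i).memLp.toLp (g i)))
  have h2 : ∀ᵐ p, ∀ i, synthCLM n i ((hg i).memLp.toLp (g i)) p =
      EuclideanSpace.single i (bandFn n (g i) p).re := ae_all_iff.2 fun i => coeFn_synthCLM (hg i) n i
  filter_upwards [h1, h2] with p hp1 hp2
  rw [hp1, bandField_eq_sum, Finset.sum_apply]
  exact Finset.sum_congr rfl fun i _ => hp2 i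

theorem memLp_bandField {ρ : ℝ} {g : Fin 3 → Plane → ℂ} (hg : ∀ i, BandLimited ρ (g i)) (n : ℤ) :
    MemLp (bandField n g) 2 volume :=
  (memLp_congr_ae (coeFn_sum_synthCLM hg n)).1 (Lp.memLp _)

/-- `bandField n g` as an element of `L²`. -/
def bandL2 {ρ : ℝ} {g : Fin 3 → Plane → ℂ} (hg : ∀ i, BandLimited ρ (g i)) (n : ℤ) : L2Field :=
  (memLp_bandField hg n).toLp _

theorem bandL2_eq_sum {ρ : ℝ} {g : Fin 3 → Plane → ℂ} (hg : ∀ i, BandLimited ρ (g i)) (n : ℤ) :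
    bandL2 hg n = ∑ i, synthCLM n i ((hg i).memLp.toLp (g i)) := by
  refine Lp.ext ((MemLp.coeFn_toLp _).trans (coeFn_sum_synthCLM hg n).symm)

theorem memLp_re_bandFn {ρ : ℝ} {g : Plane → ℂ} (hg : BandLimited ρ g) (n : ℤ) :
    MemLp (fun p => (bandFn n g p).re) 2 volume := by
  have h := (memLp_congr_ae (coeFn_synthCLM hg n 0)).1 (Lp.memLp _)
  refine h.of_le (smoothLift_re (smoothLift_bandFn hg n)).continuous.aestronglyMeasurable
    (.of_forall fun p => ?_)
  rw [PiLp.norm_single]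

/-- The Fourier coefficient at vertical frequency `n`, in Mathlib's normalisation. -/
def modeFourier (v : L2Field) (n : ℤ) (i : Fin 3) : PlaneL2 :=
  𝓕 ((memLp_verticalCoeff v i n).toLp (verticalCoeff v i n))

theorem conj_verticalCoeff (v : L2Field) (i : Fin 3) (n : ℤ) (x : Plane) :
    (starRingEnd ℂ) (verticalCoeff v i n x) = ∫ z : UnitAddCircle, ((v (x, z) i : ℝ) : ℂ) * fourier n z := by
  rw [verticalCoeff, ← integral_conj]
  congr 1; funext z
  rw [map_mul, fourier_neg, Complex.conj_conj, Complex.conj_ofReal, mul_comm]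

/-- Fubini in the vertical variable turns the pairing into one of the conjugate vertical coefficient
with `𝓕⁻ g`, and Plancherel moves it to the frequency side. The real part appears because the
synthesised field is a real part. -/
theorem inner_synthCLM {ρ : ℝ} {g : Plane → ℂ} (hg : BandLimited ρ g) (n : ℤ) (i : Fin 3) (v : L2Field) :
    ⟪v, synthCLM n i (hg.memLp.toLp g)⟫_ℝ = (⟪modeFourier v n i, hg.memLp.toLp g⟫_ℂ).re := by
  have hvi : MemLp (fun p => ((v p i : ℝ) : ℂ)) 2 volume := by
    refine (Lp.memLp v).of_le ((by fun_prop : Continuous fun w : Vec3 => ((w i : ℝ) : ℂ)).comp_aestronglyMeasurable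
      (Lp.aestronglyMeasurable v)) (.of_forall fun p => ?_)
    rw [Complex.norm_real]; exact PiLp.norm_apply_le (v p) i
  have hG : MemLp (𝓕⁻ g) 2 volume :=
    (memLp_congr_ae (coeFn_fourierInv_toLp hg.memLp hg.integrable)).1 (Lp.memLp _)
  have hb : MemLp (bandFn n g) 2 volume := by
    have h1 := hG.comp_measurePreserving measurePreserving_layer_fst
    refine h1.of_le (smoothLift_bandFn hg n).continuous.aestronglyMeasurable (.of_forall fun p => ?_)
    rw [bandFn, norm_mul, norm_fourier_apply, one_mul, Function.comp_apply]
  have hint : Integrable (fun p : Layer => ((v p i : ℝ) : ℂ) * bandFn n g p) :=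
    hvi.integrable_mul hb
  have e1 : ⟪v, synthCLM n i (hg.memLp.toLp g)⟫_ℝ = (∫ p, ((v p i : ℝ) : ℂ) * bandFn n g p).re := by
    rw [L2.inner_def]
    have := integral_re hint
    simp only [RCLike.re_eq_complex_re] at this
    rw [← this]
    refine integral_congr_ae ?_
    filter_upwards [coeFn_synthCLM hg n i] with p hp
    rw [hp, EuclideanSpace.inner_single_right]
    simp
    ring
  have e2 : ∫ p, ((v p i : ℝ) : ℂ) * bandFn n g p =
      ∫ x, (starRingEnd ℂ) (verticalCoeff v i n x) * 𝓕⁻ g x := by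
    have := integral_prod (μ := (volume : Measure Plane)) (ν := (volume : Measure UnitAddCircle)) _ hint
    refine this.trans ?_
    congr 1; funext x
    rw [conj_verticalCoeff, ← integral_mul_const]
    congr 1; funext z
    rw [bandFn]; ring
  have e3 : ⟪modeFourier v n i, hg.memLp.toLp g⟫_ℂ =
      ∫ x, (starRingEnd ℂ) (verticalCoeff v i n x) * 𝓕⁻ g x := by
    have h1 : hg.memLp.toLp g = 𝓕 (𝓕⁻ (hg.memLp.toLp g)) := (FourierTransform.fourier_fourierInv_eq _).symm
    rw [h1, modeFourier, Lp.inner_fourier_eq, L2.inner_def]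
    refine integral_congr_ae ?_
    filter_upwards [coeFn_fourierInv_toLp hg.memLp hg.integrable, (memLp_verticalCoeff v i n).coeFn_toLp]
      with x h1 h2
    rw [h1, h2]
    simp [mul_comm]
  rw [e1, e2, e3]

/-- Parseval's identity against fields with a single vertical mode. -/
theorem inner_bandL2 {ρ : ℝ} {g : Fin 3 → Plane → ℂ} (hg : ∀ i, BandLimited ρ (g i)) (n : ℤ) (v : L2Field) :
    ⟪v, bandL2 hg n⟫_ℝ = (∑ i, ⟪modeFourier v n i, (hg i).memLp.toLp (g i)⟫_ℂ).re := by
  rw [bandL2_eq_sum, inner_sum, Complex.re_sum]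
  exact Finset.sum_congr rfl fun i _ => inner_synthCLM (hg i) n i v

theorem inner_toLp_eq_integral (f : PlaneL2) {g : Plane → ℂ} (hg : MemLp g 2 volume) :
    ⟪f, hg.toLp g⟫_ℂ = ∫ ξ, (starRingEnd ℂ) (f ξ) * g ξ := by
  rw [L2.inner_def]
  refine integral_congr_ae ?_
  filter_upwards [hg.coeFn_toLp] with x h1
  rw [h1]; simp [mul_comm]

theorem bandLimited_indicator (f : PlaneL2) {A : Set Plane} (hA : MeasurableSet A) {ρ : ℝ}
    (hAρ : ∀ ξ ∈ A, ‖ξ‖ ≤ ρ) : BandLimited ρ (A.indicator f) :=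
  ⟨(Lp.memLp f).indicator hA, fun ξ hξ => indicator_of_notMem (fun h => absurd (hAρ ξ h) (not_le.2 hξ)) _⟩

theorem ae_eq_zero_of_integral_conj_mul_self {h : Plane → ℂ} (hh : MemLp h 2 volume)
    (h0 : (∫ ξ, (starRingEnd ℂ) (h ξ) * h ξ).re = 0) : h =ᵐ[volume] 0 := by
  have e : ∀ ξ, (starRingEnd ℂ) (h ξ) * h ξ = ((‖h ξ‖ ^ 2 : ℝ) : ℂ) := fun ξ => by
    rw [mul_comm, Complex.mul_conj, Complex.normSq_eq_norm_sq]
  simp_rw [e] at h0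
  rw [integral_complex_ofReal, Complex.ofReal_re] at h0
  have h1 := (integral_eq_zero_iff_of_nonneg (fun ξ => by positivity)
    ((memLp_two_iff_integrable_sq_norm hh.1).1 hh)).1 h0
  filter_upwards [h1] with ξ hξ
  simpa using hξ

/-- The Fourier coefficients of a divergence-free field are orthogonal to the wave number. -/
theorem IsDivFree.sum_waveNumber_mul_modeFourier {v : L2Field} (hv : IsDivFree v) (n : ℤ) :
    ∀ᵐ ξ, ∑ j, (waveNumber n ξ j : ℂ) * modeFourier v n j ξ = 0 := by
  have main : ∀ ρ : ℕ, ∀ᵐ ξ : Plane, ‖ξ‖ ≤ ρ → ∑ j, (waveNumber n ξ j : ℂ) * modeFourier v n j ξ = 0 := by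
    intro ρ
    set A := Metric.closedBall (0 : Plane) ρ with hA
    have hAm : MeasurableSet A := Metric.isClosed_closedBall.measurableSet
    have hb : ∀ j, BandLimited ρ (A.indicator (modeFourier v n j)) := fun j =>
      bandLimited_indicator _ hAm fun ξ hξ => by simpa [hA] using hξ
    set h : Plane → ℂ := fun ξ => ∑ j, (waveNumber n ξ j : ℂ) * A.indicator (modeFourier v n j) ξ with hh
    have hbk : ∀ j, BandLimited ρ fun ξ => (waveNumber n ξ j : ℂ) * A.indicator (modeFourier v n j) ξ := by
      intro j
      have := measurable_waveNumber n j
      refine (hb j).mul_left (m := fun ξ => (waveNumber n ξ j : ℂ)) (by fun_prop) (c := ρ + |(n : ℝ)|) fun ξ hξ => ?_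
      rw [Complex.norm_real]
      exact (abs_waveNumber_le n j ξ).trans (by gcongr)
    have hhb : BandLimited ρ h := by
      have e : h = fun ξ => ((waveNumber n ξ 0 : ℂ) * A.indicator (modeFourier v n 0) ξ +
          (waveNumber n ξ 1 : ℂ) * A.indicator (modeFourier v n 1) ξ) +
          (waveNumber n ξ 2 : ℂ) * A.indicator (modeFourier v n 2) ξ := by
        funext ξ; exact Fin.sum_univ_three _
      rw [e]; exact ((hbk 0).add (hbk 1)).add (hbk 2)
    clear_value h
    -- The potential with profile `-i h` is chosen so that orthogonality of `v` to its gradient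
    -- reads `2π ∫ |h|² = 0`, where `h` is the truncated divergence symbol of `v`.
    have hq := hhb.const_mul (-Complex.I)
    have hgr := grad_re_bandFn hq n
    have hL := memLp_bandField (fun j => hq.waveNumber_mul n j) n
    have h0 := hv.inner_grad_eq_zero (smoothLift_re (smoothLift_bandFn hq n)) (memLp_re_bandFn hq n)
      (by rw [hgr]; exact hL)
    have h1 : ⟪v, bandL2 (fun j => hq.waveNumber_mul n j) n⟫_ℝ = 0 := by
      rw [← h0]; congr 1
      exact MemLp.toLp_congr _ _ (.of_forall fun p => by rw [hgr])
    rw [inner_bandL2] at h1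
    simp_rw [inner_toLp_eq_integral] at h1
    rw [← integral_finsetSum Finset.univ] at h1
    · have e : ∀ ξ, ∑ i, (starRingEnd ℂ) (modeFourier v n i ξ) *
          (2 * Real.pi * Complex.I * waveNumber n ξ i * (-Complex.I * h ξ)) =
          (2 * Real.pi : ℝ) * ((starRingEnd ℂ) (h ξ) * h ξ) := fun ξ => by
        by_cases hξ : ξ ∈ A
        · have e2 : h ξ = ∑ j, (waveNumber n ξ j : ℂ) * modeFourier v n j ξ := by
            simp only [hh, indicator_of_mem hξ]
          have e3 : (starRingEnd ℂ) (h ξ) = ∑ j, (waveNumber n ξ j : ℂ) * (starRingEnd ℂ) (modeFourier v n j ξ) := by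
            rw [e2, map_sum]
            exact Finset.sum_congr rfl fun j _ => by rw [map_mul, Complex.conj_ofReal]
          rw [e3, Finset.sum_mul, Finset.mul_sum]
          refine Finset.sum_congr rfl fun j _ => ?_
          push_cast
          linear_combination (-(2 * Real.pi * (waveNumber n ξ j : ℂ) * (starRingEnd ℂ) (modeFourier v n j ξ) * h ξ)) * Complex.I_sq
        · have e2 : h ξ = 0 := by simp only [hh, indicator_of_notMem hξ]; simp
          simp [e2]
      simp_rw [e] at h1
      rw [integral_const_mul, Complex.re_ofReal_mul] at h1
      have h2 := ae_eq_zero_of_integral_conj_mul_self hhb.memLp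
        ((mul_eq_zero.1 h1).resolve_left (by positivity))
      filter_upwards [h2] with ξ hξ hξρ
      have hm : ξ ∈ A := by simpa [hA] using hξρ
      simpa only [hh, indicator_of_mem hm, Pi.zero_apply] using hξ
    · intro i _
      have hc : MemLp (fun ξ => (starRingEnd ℂ) (modeFourier v n i ξ)) 2 volume := (Lp.memLp (modeFourier v n i)).star
      exact hc.integrable_mul (hq.waveNumber_mul n i).memLp
  filter_upwards [ae_all_iff.2 main] with ξ hξ
  obtain ⟨m, hm⟩ := exists_nat_ge ‖ξ‖
  exact hξ m hm

/-! ### Vertical Fourier series -/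

section VerticalFourierSeries

theorem volume_unitAddCircle_eq : (volume : Measure UnitAddCircle) = AddCircle.haarAddCircle := by
  have := AddCircle.volume_eq_smul_haarAddCircle (T := (1 : ℝ))
  simpa using this

theorem ae_eq_sum_fourier {f : UnitAddCircle → ℂ} (hf : MemLp f 2 volume) (s : Finset ℤ)
    (hs : ∀ n, n ∉ s → ∫ z, fourier (-n) z * f z = 0) :
    f =ᵐ[volume] fun z => ∑ n ∈ s, fourier n z * ∫ z, fourier (-n) z * f z := by
  rw [volume_unitAddCircle_eq] at hf hs ⊢
  set F := hf.toLp f with hF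
  have hc : ∀ n, (fourierBasis (T := 1)).repr F n = ∫ z, fourier (-n) z * f z ∂AddCircle.haarAddCircle := fun n => by
    rw [fourierBasis_repr, hF, fourierCoeff_congr_ae hf.coeFn_toLp]
    rfl
  have h1 := fourierBasis.hasSum_repr F
  have h2 : HasSum (fun n => (fourierBasis (T := 1)).repr F n • fourierBasis (T := 1) n)
      (∑ n ∈ s, (fourierBasis (T := 1)).repr F n • fourierBasis (T := 1) n) :=
    hasSum_sum_of_ne_finset_zero fun n hn => by rw [hc, hs n hn, zero_smul]
  have h3 := h1.unique h2
  have h4 := Lp.coeFn_finsetSum s (fun n => (fourierBasis (T := 1)).repr F n • (fourierBasis (T := 1) n : Lp ℂ 2 (@AddCircle.haarAddCircle 1 _)))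
  have h5 : ∀ᵐ z ∂AddCircle.haarAddCircle, ∀ n : ℤ,
      ((fourierBasis (T := 1)).repr F n • (fourierBasis (T := 1) n : Lp ℂ 2 (@AddCircle.haarAddCircle 1 _))) z =
        fourier n z * ∫ z, fourier (-n) z * f z ∂AddCircle.haarAddCircle := ae_all_iff.2 fun n => by
    rw [coe_fourierBasis]
    filter_upwards [Lp.coeFn_smul ((fourierBasis (T := 1)).repr F n) (fourierLp (T := 1) 2 n), coeFn_fourierLp (T := 1) 2 n]
      with z h6 h7
    rw [h6, Pi.smul_apply, h7, hc, smul_eq_mul, mul_comm]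
  filter_upwards [hf.coeFn_toLp, h4, h5] with z h6 h7 h8
  rw [← h6, ← hF, h3, h7, Finset.sum_apply]
  exact Finset.sum_congr rfl fun n _ => h8 n

theorem memLp_component (v : L2Field) (i : Fin 3) : MemLp (fun p => ((v p i : ℝ) : ℂ)) 2 volume := by
  refine (Lp.memLp v).of_le ((by fun_prop : Continuous fun w : Vec3 => ((w i : ℝ) : ℂ)).comp_aestronglyMeasurable
    (Lp.aestronglyMeasurable v)) (.of_forall fun p => ?_)
  rw [Complex.norm_real]; exact PiLp.norm_apply_le (v p) i

theorem stronglyMeasurable_component (v : L2Field) (i : Fin 3) :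
    StronglyMeasurable fun p => ((v p i : ℝ) : ℂ) :=
  (by fun_prop : Continuous fun w : Vec3 => ((w i : ℝ) : ℂ)).comp_stronglyMeasurable (Lp.stronglyMeasurable v)

theorem stronglyMeasurable_verticalCoeff (v : L2Field) (i : Fin 3) (n : ℤ) :
    StronglyMeasurable (verticalCoeff v i n) := by
  have : StronglyMeasurable fun p : Layer => fourier (-n) p.2 * ((v p i : ℝ) : ℂ) :=
    ((fourier (-n)).continuous.comp continuous_snd).stronglyMeasurable.mul (stronglyMeasurable_component v i)
  exact this.integral_prod_right' (ν := (volume : Measure UnitAddCircle))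

theorem ae_memLp_section {E : Type*} [NormedAddCommGroup E] {f : Layer → E} (hf : MemLp f 2 volume) :
    ∀ᵐ x : Plane, MemLp (fun z : UnitAddCircle => f (x, z)) 2 volume := by
  have h1 : Integrable (fun p => ‖f p‖ ^ 2) ((volume : Measure Plane).prod (volume : Measure UnitAddCircle)) :=
    (memLp_two_iff_integrable_sq_norm hf.1).1 hf
  have hm : AEStronglyMeasurable f ((volume : Measure Plane).prod (volume : Measure UnitAddCircle)) := hf.1
  filter_upwards [h1.prod_right_ae, hm.prodMk_left] with x hx hxm
  exact (memLp_two_iff_integrable_sq_norm hxm).2 hx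

/-- Vertical Fourier series of a field with finitely many vertical modes. -/
theorem ae_eq_sum_verticalCoeff (v : L2Field) (i : Fin 3) (s : Finset ℤ)
    (h : ∀ n, n ∉ s → verticalCoeff v i n =ᵐ[volume] 0) :
    ∀ᵐ p, ((v p i : ℝ) : ℂ) = ∑ n ∈ s, fourier n p.2 * verticalCoeff v i n p.1 := by
  have hmeas : MeasurableSet {p : Plane × UnitAddCircle | ((v p i : ℝ) : ℂ) =
      ∑ n ∈ s, fourier n p.2 * verticalCoeff v i n p.1} := by
    refine measurableSet_eq_fun (stronglyMeasurable_component v i).measurable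
      (Finset.measurable_fun_sum _ fun n _ => ?_)
    exact ((fourier n).continuous.measurable.comp measurable_snd).mul
      ((stronglyMeasurable_verticalCoeff v i n).measurable.comp measurable_fst)
  have key : ∀ᵐ x : Plane, ∀ᵐ z : UnitAddCircle, ((v (x, z) i : ℝ) : ℂ) =
      ∑ n ∈ s, fourier n z * verticalCoeff v i n x := by
    have h0 : ∀ᵐ x : Plane, ∀ n, n ∉ s → verticalCoeff v i n x = 0 :=
      ae_all_iff.2 fun n => by
        by_cases hn : n ∈ s
        · exact .of_forall fun x h => absurd hn h
        · filter_upwards [h n hn] with x hx _ using hx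
    filter_upwards [ae_memLp_section (memLp_component v i), h0] with x hx hx0
    exact ae_eq_sum_fourier hx s hx0
  exact (Measure.ae_prod_iff_ae_ae (μ := (volume : Measure Plane)) (ν := (volume : Measure UnitAddCircle))
    hmeas).2 key

end VerticalFourierSeries

/-! ### Exponential curves of band-limited profiles -/

section ExponentialCurve

variable {ρ Λ : ℝ} {f lam : Plane → ℂ}

theorem BandLimited.cexp_mul (hf : BandLimited ρ f) (hm : Measurable lam)
    (hΛ : ∀ ξ, ‖ξ‖ ≤ ρ → ‖lam ξ‖ ≤ Λ) (t : ℝ) :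
    BandLimited ρ fun ξ => Complex.exp (t * lam ξ) * f ξ := by
  refine hf.mul_left (by fun_prop) (c := Real.exp (|t| * Λ)) fun ξ hξ => ?_
  rw [Complex.norm_exp]
  refine Real.exp_le_exp.2 ((Complex.re_le_norm _).trans ?_)
  rw [norm_mul, Complex.norm_real, Real.norm_eq_abs]
  gcongr
  exact hΛ ξ hξ

/-- The symbol is bounded on the support of `f`, so `|e^z - 1 - z| ≤ |z|²` for `|z| ≤ 1` gives a
remainder quadratic in the time step, in `L²` norm. -/
theorem BandLimited.hasDerivAt_cexp (hf : BandLimited ρ f) (hm : Measurable lam)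
    (hΛ : ∀ ξ, ‖ξ‖ ≤ ρ → ‖lam ξ‖ ≤ Λ) (t : ℝ) :
    HasDerivAt (fun t : ℝ => ((hf.cexp_mul hm hΛ t).memLp.toLp _ : PlaneL2))
      (((hf.cexp_mul hm hΛ t).mul_left hm hΛ).memLp.toLp _) t := by
  rw [hasDerivAt_iff_isLittleO_nhds_zero]
  set F := fun t : ℝ => ((hf.cexp_mul hm hΛ t).memLp.toLp _ : PlaneL2) with hF
  set F' : PlaneL2 := ((hf.cexp_mul hm hΛ t).mul_left hm hΛ).memLp.toLp _ with hF'
  have hbound : ∀ h : ℝ, |h| * |Λ| ≤ 1 → ‖F (t + h) - F t - h • F'‖ ≤ (|Λ| ^ 2 * ‖F t‖) * ‖h ^ 2‖ := by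
    intro h hh
    have : ‖F (t + h) - F t - h • F'‖ ≤ ((|h| * |Λ|) ^ 2) * ‖F t‖ := by
      refine Lp.norm_le_mul_norm_of_ae_le_mul ?_
      filter_upwards [Lp.coeFn_sub (F (t + h) - F t) (h • F'), Lp.coeFn_sub (F (t + h)) (F t),
        Lp.coeFn_smul h F', (hf.cexp_mul hm hΛ t).memLp.coeFn_toLp,
        (hf.cexp_mul hm hΛ (t + h)).memLp.coeFn_toLp,
        ((hf.cexp_mul hm hΛ t).mul_left hm hΛ).memLp.coeFn_toLp] with ξ h1 h2 h3 h4 h5 h6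
      rw [h1, Pi.sub_apply, h2, Pi.sub_apply, h3, Pi.smul_apply, h4, h5, h6]
      have e : Complex.exp ((t + h : ℝ) * lam ξ) * f ξ - Complex.exp (t * lam ξ) * f ξ -
          h • (lam ξ * (Complex.exp (t * lam ξ) * f ξ)) =
          (Complex.exp (h * lam ξ) - 1 - h * lam ξ) * (Complex.exp (t * lam ξ) * f ξ) := by
        rw [Complex.real_smul, Complex.ofReal_add, add_mul, Complex.exp_add]; ring
      rw [e]
      rcases le_or_gt ‖ξ‖ ρ with hξ | hξ
      · rw [norm_mul]
        gcongr
        have hl : ‖(h : ℂ) * lam ξ‖ ≤ |h| * |Λ| := by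
          rw [norm_mul, Complex.norm_real, Real.norm_eq_abs]
          gcongr; exact (hΛ ξ hξ).trans (le_abs_self _)
        refine (Complex.norm_exp_sub_one_sub_id_le (hl.trans hh)).trans ?_
        gcongr
      · simp [hf.eq_zero ξ hξ]
    refine this.trans (le_of_eq ?_)
    rw [Real.norm_eq_abs, abs_pow]; ring
  have hO : (fun h : ℝ => F (t + h) - F t - h • F') =O[𝓝 0] fun h : ℝ => h ^ 2 := by
    refine Asymptotics.IsBigO.of_bound (|Λ| ^ 2 * ‖F t‖) ?_
    have h0 : Tendsto (fun h : ℝ => |h| * |Λ|) (𝓝 0) (𝓝 0) := by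
      have : Continuous fun h : ℝ => |h| * |Λ| := by fun_prop
      simpa using this.tendsto 0
    filter_upwards [h0.eventually (ge_mem_nhds one_pos)] with h hh using hbound h hh
  refine hO.trans_isLittleO ?_
  exact Asymptotics.isLittleO_pow_id one_lt_two

end ExponentialCurve

theorem bandL2_congr {ρ : ℝ} {g h : Fin 3 → Plane → ℂ} (hg : ∀ i, BandLimited ρ (g i))
    (hh : ∀ i, BandLimited ρ (h i)) (n : ℤ) (e : ∀ i, g i =ᵐ[volume] h i) :
    bandL2 hg n = bandL2 hh n := by
  rw [bandL2_eq_sum, bandL2_eq_sum]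
  refine Finset.sum_congr rfl fun i _ => ?_
  rw [MemLp.toLp_congr (hg i).memLp (hh i).memLp (e i)]

theorem hasDerivAt_bandL2_cexp {ρ Λ : ℝ} {f : Fin 3 → Plane → ℂ} {lam : Plane → ℂ}
    (hf : ∀ i, BandLimited ρ (f i)) (hm : Measurable lam) (hΛ : ∀ ξ, ‖ξ‖ ≤ ρ → ‖lam ξ‖ ≤ Λ)
    (n : ℤ) (t : ℝ) :
    HasDerivAt (fun t : ℝ => bandL2 (fun i => (hf i).cexp_mul hm hΛ t) n)
      (bandL2 (fun i => ((hf i).cexp_mul hm hΛ t).mul_left hm hΛ) n) t := by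
  simp_rw [bandL2_eq_sum]
  exact HasDerivAt.fun_sum fun i _ =>
    (synthCLM n i).hasFDerivAt.comp_hasDerivAt t ((hf i).hasDerivAt_cexp hm hΛ t)

theorem bandFn_add {ρ : ℝ} {g h : Plane → ℂ} (hg : BandLimited ρ g) (hh : BandLimited ρ h) (n : ℤ)
    (p : Layer) : bandFn n (fun ξ => g ξ + h ξ) p = bandFn n g p + bandFn n h p := by
  have hb : ∀ b : Bool, BandLimited ρ (cond b g h) := fun b => by cases b <;> assumption
  simpa using bandFn_sum (Finset.univ : Finset Bool) hb n p

theorem bandFn_const_mul (c : ℂ) (g : Plane → ℂ) (n : ℤ) (p : Layer) :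
    bandFn n (fun ξ => c * g ξ) p = c * bandFn n g p := by
  have h : 𝓕⁻ (fun ξ => c * g ξ) p.1 = c * 𝓕⁻ g p.1 := by
    simp only [Real.fourierInv_eq']
    rw [← integral_const_mul]
    refine integral_congr_ae (.of_forall fun ξ => ?_)
    simp only [smul_eq_mul]
    ring
  simp only [bandFn]
  rw [h]; ring

theorem bandL2_add_smul {ρ : ℝ} {a b g : Fin 3 → Plane → ℂ} (ha : ∀ i, BandLimited ρ (a i))
    (hb : ∀ i, BandLimited ρ (b i)) (hg : ∀ i, BandLimited ρ (g i)) (c : ℝ) (n : ℤ)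
    (e : ∀ i ξ, g i ξ = a i ξ + c * b i ξ) : bandL2 hg n = bandL2 ha n + c • bandL2 hb n := by
  refine Lp.ext ?_
  filter_upwards [(memLp_bandField hg n).coeFn_toLp, (memLp_bandField ha n).coeFn_toLp,
    (memLp_bandField hb n).coeFn_toLp, Lp.coeFn_add (bandL2 ha n) (c • bandL2 hb n),
    Lp.coeFn_smul c (bandL2 hb n)] with p h1 h2 h3 h4 h5
  rw [h4, Pi.add_apply, h5, Pi.smul_apply]
  simp only [bandL2]
  rw [h1, h2, h3]
  ext i
  have : g i = fun ξ => a i ξ + c * b i ξ := funext (e i)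
  simp only [bandField, this, bandFn_add (ha i) ((hb i).const_mul c), bandFn_const_mul]
  simp

theorem bandFn_zero (n : ℤ) (p : Layer) : bandFn n (fun _ => 0) p = 0 := by
  have := bandFn_const_mul 0 (fun _ => 0) n p
  simpa using this

/-! ### Circularly polarised modes and their evolution -/

/-- The modulus of the wave number `(ξ, n)`. -/
def waveNorm (n : ℤ) (ξ : Plane) : ℝ := √((n : ℝ) ^ 2 + ‖ξ‖ ^ 2)

theorem waveNorm_nonneg (n : ℤ) (ξ : Plane) : 0 ≤ waveNorm n ξ := Real.sqrt_nonneg _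

theorem continuous_waveNorm (n : ℤ) : Continuous (waveNorm n) := by unfold waveNorm; fun_prop

theorem abs_intCast_le_waveNorm (n : ℤ) (ξ : Plane) : |(n : ℝ)| ≤ waveNorm n ξ := by
  rw [waveNorm, ← Real.sqrt_sq_eq_abs]
  exact Real.sqrt_le_sqrt (by nlinarith [sq_nonneg ‖ξ‖])

theorem norm_rossbySymbol_le {ρ : ℝ} (n : ℤ) (Ω : ℝ) (ξ : Plane) (hξ : ‖ξ‖ ≤ ρ) :
    ‖rossbySymbol n Ω ξ‖ ≤ 4 * Real.pi ^ 2 * ((n : ℝ) ^ 2 + ρ ^ 2) + |Ω| := by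
  refine (norm_add_le _ _).trans (add_le_add ?_ ?_)
  · rw [Complex.norm_real, Real.norm_eq_abs, abs_neg, abs_of_nonneg (by positivity)]
    gcongr
  · rw [norm_mul, Complex.norm_I, mul_one, Complex.norm_real, Real.norm_eq_abs, mul_assoc, abs_mul]
    refine mul_le_of_le_one_right (abs_nonneg _) ?_
    change |(n : ℝ) * (waveNorm n ξ)⁻¹| ≤ 1
    rw [abs_mul, abs_inv, abs_of_nonneg (waveNorm_nonneg n ξ), ← div_eq_mul_inv]
    exact div_le_one_of_le₀ (abs_intCast_le_waveNorm n ξ) (waveNorm_nonneg n ξ)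

/-- Frequency profiles, at vertical frequency `n`, of circularly polarised divergence-free fields:
`k × f = -σ i |k| f` for the wave number `k`, with support in an annulus. -/
structure RossbyMode (n : ℤ) (σ ρ : ℝ) (f : Fin 3 → Plane → ℂ) : Prop where
  band : ∀ i, BandLimited ρ (f i)
  low : ∃ ε > 0, ∀ ξ, waveNorm n ξ < ε → ∀ i, f i ξ = 0
  sq : σ ^ 2 = 1
  polar0 : ∀ ξ, waveNumber n ξ 1 * f 2 ξ - waveNumber n ξ 2 * f 1 ξ = -(σ * Complex.I * waveNorm n ξ * f 0 ξ)
  polar1 : ∀ ξ, waveNumber n ξ 2 * f 0 ξ - waveNumber n ξ 0 * f 2 ξ = -(σ * Complex.I * waveNorm n ξ * f 1 ξ)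
  polar2 : ∀ ξ, waveNumber n ξ 0 * f 1 ξ - waveNumber n ξ 1 * f 0 ξ = -(σ * Complex.I * waveNorm n ξ * f 2 ξ)

/-- Multiplier of the Coriolis operator on modes with polarisation `σ`. -/
def coriolisSymbol (n : ℤ) (σ : ℝ) (ξ : Plane) : ℂ :=
  ((-(σ * (n * (waveNorm n ξ)⁻¹)) : ℝ) : ℂ) * Complex.I

theorem measurable_coriolisSymbol (n : ℤ) (σ : ℝ) : Measurable (coriolisSymbol n σ) := by
  have := (continuous_waveNorm n).measurable
  unfold coriolisSymbol; fun_prop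

theorem norm_coriolisSymbol_le (n : ℤ) (σ : ℝ) (ξ : Plane) : ‖coriolisSymbol n σ ξ‖ ≤ |σ| := by
  rw [coriolisSymbol, norm_mul, Complex.norm_I, mul_one, Complex.norm_real, Real.norm_eq_abs, abs_neg, abs_mul]
  refine mul_le_of_le_one_right (abs_nonneg _) ?_
  rw [abs_mul, abs_inv, abs_of_nonneg (waveNorm_nonneg n ξ), ← div_eq_mul_inv]
  exact div_le_one_of_le₀ (abs_intCast_le_waveNorm n ξ) (waveNorm_nonneg n ξ)

theorem e3Wedge_apply (v : Vec3) : e3Wedge v = !₂[-v 1, v 0, 0] := by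
  ext i
  fin_cases i <;> simp [e3Wedge, cross_apply]

/-- The Coriolis operator as a bounded operator. -/
def coriolisCLM : L2Field →L[ℝ] L2Field := leray ∘L e3Wedge.compLpL 2 volume

theorem coriolisCLM_apply (v : L2Field) : coriolisCLM v = coriolis v := rfl

namespace RossbyMode

variable {n : ℤ} {σ ρ : ℝ} {f : Fin 3 → Plane → ℂ}

theorem mul_left (hf : RossbyMode n σ ρ f) {m : Plane → ℂ} (hm : Measurable m) {c : ℝ}
    (hc : ∀ ξ, ‖ξ‖ ≤ ρ → ‖m ξ‖ ≤ c) : RossbyMode n σ ρ fun i ξ => m ξ * f i ξ where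
  band i := (hf.band i).mul_left hm hc
  low := by
    obtain ⟨ε, hε, h⟩ := hf.low
    exact ⟨ε, hε, fun ξ hξ i => by rw [h ξ hξ i, mul_zero]⟩
  sq := hf.sq
  polar0 ξ := by linear_combination m ξ * hf.polar0 ξ
  polar1 ξ := by linear_combination m ξ * hf.polar1 ξ
  polar2 ξ := by linear_combination m ξ * hf.polar2 ξ

theorem sigma_mul_I_sq (hf : RossbyMode n σ ρ f) : ((σ : ℂ) * Complex.I) ^ 2 = -1 := by
  have := hf.sq
  rw [mul_pow, Complex.I_sq]
  have e : (σ : ℂ) ^ 2 = 1 := by exact_mod_cast this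
  rw [e]; ring

theorem eq_zero_or_pos (hf : RossbyMode n σ ρ f) (ξ : Plane) : (∀ i, f i ξ = 0) ∨ 0 < waveNorm n ξ := by
  obtain ⟨ε, hε, h⟩ := hf.low
  rcases lt_or_ge (waveNorm n ξ) ε with h1 | h1
  · exact Or.inl (h ξ h1)
  · exact Or.inr (hε.trans_le h1)

/-- The wave number is orthogonal to its cross product with `f`, so the polarisation relation forces
`σ i |k| (k · f) = 0`. -/
theorem sum_waveNumber_mul (hf : RossbyMode n σ ρ f) (ξ : Plane) :
    ∑ j, (waveNumber n ξ j : ℂ) * f j ξ = 0 := by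
  rw [Fin.sum_univ_three]
  rcases hf.eq_zero_or_pos ξ with h | h
  · simp [h]
  · have h1 : (waveNorm n ξ : ℂ) ≠ 0 := by exact_mod_cast h.ne'
    have h2 : (σ : ℂ) * Complex.I ≠ 0 := fun h0 => by
      have := hf.sigma_mul_I_sq; rw [h0] at this; norm_num at this
    refine mul_left_cancel₀ (mul_ne_zero h2 h1) ?_
    linear_combination (waveNumber n ξ 0 : ℂ) * hf.polar0 ξ + (waveNumber n ξ 1 : ℂ) * hf.polar1 ξ +
      (waveNumber n ξ 2 : ℂ) * hf.polar2 ξ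

theorem isDivFree (hf : RossbyMode n σ ρ f) : IsDivFree (bandL2 hf.band n) := by
  intro φ hφ
  have e1 : ∫ p, ⟪bandL2 hf.band n p, grad φ p⟫_ℝ = ∫ p, ⟪bandField n f p, grad φ p⟫_ℝ := by
    refine integral_congr_ae ?_
    filter_upwards [(memLp_bandField hf.band n).coeFn_toLp] with p hp
    rw [bandL2, hp]
  have e2 : ∀ p, ∑ j, partialD j (bandField n f) p j = 0 := fun p => by
    simp_rw [partialD_bandField hf.band]
    have h1 := bandFn_sum Finset.univ (fun j => (hf.band j).waveNumber_mul n j) n p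
    have h2 : (fun ξ => ∑ j, 2 * Real.pi * Complex.I * waveNumber n ξ j * f j ξ) = fun _ => 0 := by
      funext ξ
      have := hf.sum_waveNumber_mul ξ
      simp_rw [mul_assoc (2 * Real.pi * Complex.I)]
      rw [← Finset.mul_sum, this, mul_zero]
    rw [h2, bandFn_zero] at h1
    simp only [bandField]
    rw [← Complex.re_sum, ← h1, Complex.zero_re]
  rw [e1, hφ.integral_inner_grad_eq (smoothLift_bandField hf.band n)]
  simp [e2]

theorem coriolisMode (hf : RossbyMode n σ ρ f) : RossbyMode n σ ρ fun i ξ => coriolisSymbol n σ ξ * f i ξ :=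
  hf.mul_left (measurable_coriolisSymbol n σ) fun ξ _ => norm_coriolisSymbol_le n σ ξ

/-- By `e₃ × (k × f) = k f₃ - n f`, the polarisation relation writes `e₃ × f` as the gradient of a
scalar potential with profile `σ f₃ / (2π |k|)` plus the multiplier applied to `f`. The multiplier
part is divergence-free and the gradient is orthogonal to all divergence-free fields, so the former
is the projection. -/
theorem coriolis_eq (hf : RossbyMode n σ ρ f) :
    coriolis (bandL2 hf.band n) = bandL2 hf.coriolisMode.band n := by
  obtain ⟨ε, hε, hlow⟩ := hf.low
  have hwm := (continuous_waveNorm n).measurable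
  -- Replacing `|k|` by `max |k| ε` keeps the multiplier bounded and changes nothing, since `f`
  -- vanishes where `|k| < ε`.
  set h : Plane → ℂ := fun ξ => ((σ * (2 * Real.pi * max (waveNorm n ξ) ε)⁻¹ : ℝ) : ℂ) * f 2 ξ with hh
  have hhb : BandLimited ρ h := by
    refine (hf.band 2).mul_left (m := fun ξ => ((σ * (2 * Real.pi * max (waveNorm n ξ) ε)⁻¹ : ℝ) : ℂ))
      (by fun_prop) (c := |σ| * (2 * Real.pi * ε)⁻¹) fun ξ _ => ?_
    have hm : 0 < max (waveNorm n ξ) ε := lt_max_iff.2 (Or.inr hε)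
    rw [Complex.norm_real, Real.norm_eq_abs, abs_mul]
    refine mul_le_mul_of_nonneg_left ?_ (abs_nonneg _)
    rw [abs_of_pos (by positivity)]
    gcongr
    exact le_max_right _ _
  set w : Fin 3 → Plane → ℂ := ![fun ξ => (-1) * f 1 ξ, f 0, fun _ => 0] with hw
  have hsum : ∀ j ξ, 2 * Real.pi * Complex.I * waveNumber n ξ j * h ξ + coriolisSymbol n σ ξ * f j ξ = w j ξ := by
    intro j ξ
    rcases lt_or_ge (waveNorm n ξ) ε with h1 | h1
    · have h0 := hlow ξ h1
      fin_cases j <;> simp [hh, hw, h0]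
    · have hr : (waveNorm n ξ : ℂ) ≠ 0 := by exact_mod_cast (hε.trans_le h1).ne'
      have hpi : (Real.pi : ℂ) ≠ 0 := by exact_mod_cast Real.pi_ne_zero
      have hs := hf.sigma_mul_I_sq
      have e1 : 2 * Real.pi * Complex.I * waveNumber n ξ j * h ξ + coriolisSymbol n σ ξ * f j ξ =
          (waveNorm n ξ : ℂ)⁻¹ * (σ * Complex.I * (waveNumber n ξ j * f 2 ξ - n * f j ξ)) := by
        simp only [hh, coriolisSymbol, max_eq_left h1]
        push_cast
        field_simp
        ring
      rw [e1, inv_mul_eq_iff_eq_mul₀ hr]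
      have p0 := hf.polar0 ξ
      have p1 := hf.polar1 ξ
      have k2 : (waveNumber n ξ 2 : ℂ) = n := by simp [waveNumber]
      rw [k2] at p0 p1
      fin_cases j
      · simp only [hw, Fin.zero_eta, Matrix.cons_val_zero]
        linear_combination (-(σ * Complex.I)) * p1 + waveNorm n ξ * f 1 ξ * hs
      · simp only [hw, Fin.mk_one, Matrix.cons_val_one, Matrix.cons_val_zero]
        linear_combination (σ * Complex.I) * p0 - waveNorm n ξ * f 0 ξ * hs
      · simp only [hw, Fin.reduceFinMk, Matrix.cons_val]
        rw [k2]; ring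
  have hgr := grad_re_bandFn hhb n
  have hL : MemLp (grad fun p => (bandFn n h p).re) 2 volume := by
    rw [hgr]; exact memLp_bandField (fun j => hhb.waveNumber_mul n j) n
  have hpt : ∀ p, e3Wedge (bandField n f p) =
      grad (fun p => (bandFn n h p).re) p + bandField n (fun i ξ => coriolisSymbol n σ ξ * f i ξ) p := by
    intro p
    have hb : ∀ j, bandFn n (fun ξ => 2 * Real.pi * Complex.I * waveNumber n ξ j * h ξ) p +
        bandFn n (fun ξ => coriolisSymbol n σ ξ * f j ξ) p = bandFn n (w j) p := fun j => by
      rw [← bandFn_add (hhb.waveNumber_mul n j) (hf.coriolisMode.band j)]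
      congr 1; funext ξ; exact hsum j ξ
    rw [hgr, e3Wedge_apply]
    ext j
    have hj := congrArg Complex.re (hb j)
    rw [Complex.add_re] at hj
    simp only [bandField, PiLp.add_apply, hj]
    fin_cases j
    · have := bandFn_const_mul (-1) (f 1) n p
      simp only [neg_mul, one_mul] at this
      simp [hw, this]
    · simp [hw]
    · simp [hw, bandFn_zero]
  have hdec : e3Wedge.compLp (bandL2 hf.band n) - bandL2 hf.coriolisMode.band n = hL.toLp _ := by
    refine Lp.ext ?_
    filter_upwards [Lp.coeFn_sub (e3Wedge.compLp (bandL2 hf.band n)) (bandL2 hf.coriolisMode.band n),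
      e3Wedge.coeFn_compLp (bandL2 hf.band n), (memLp_bandField hf.band n).coeFn_toLp,
      (memLp_bandField hf.coriolisMode.band n).coeFn_toLp, hL.coeFn_toLp] with p h1 h2 h3 h4 h5
    rw [h1, Pi.sub_apply, h2, h5]
    simp only [bandL2]
    rw [h3, h4, hpt, add_sub_cancel_right]
  refine Submodule.eq_starProjection_of_mem_orthogonal hf.coriolisMode.isDivFree ?_
  rw [hdec, Submodule.mem_orthogonal]
  exact fun v hv => IsDivFree.inner_grad_eq_zero hv (smoothLift_re (smoothLift_bandFn hhb n))
    (memLp_re_bandFn hhb n) hL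

theorem band_cexp (hf : RossbyMode n σ ρ f) (Ω t : ℝ) (i : Fin 3) :
    BandLimited ρ fun ξ => Complex.exp (t * rossbySymbol n (σ * Ω) ξ) * f i ξ :=
  (hf.band i).cexp_mul (measurable_rossbySymbol _ _) (fun ξ hξ => norm_rossbySymbol_le n (σ * Ω) ξ hξ) t

/-- The Rossby evolution of a single mode. -/
def flow (hf : RossbyMode n σ ρ f) (Ω t : ℝ) : L2Field := bandL2 (hf.band_cexp Ω t) n

theorem mode_cexp (hf : RossbyMode n σ ρ f) (Ω t : ℝ) :
    RossbyMode n σ ρ fun i ξ => Complex.exp (t * rossbySymbol n (σ * Ω) ξ) * f i ξ := by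
  have hm := measurable_rossbySymbol n (σ * Ω)
  refine hf.mul_left (m := fun ξ => Complex.exp (t * rossbySymbol n (σ * Ω) ξ)) (by fun_prop)
    (c := Real.exp (|t| * (4 * Real.pi ^ 2 * ((n : ℝ) ^ 2 + ρ ^ 2) + |σ * Ω|))) fun ξ hξ => ?_
  rw [Complex.norm_exp]
  refine Real.exp_le_exp.2 ((Complex.re_le_norm _).trans ?_)
  rw [norm_mul, Complex.norm_real, Real.norm_eq_abs]
  gcongr
  exact norm_rossbySymbol_le n (σ * Ω) ξ hξ

theorem band_laplace (hf : RossbyMode n σ ρ f) (i : Fin 3) :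
    BandLimited ρ fun ξ => ((-(4 * Real.pi ^ 2 * ((n : ℝ) ^ 2 + ‖ξ‖ ^ 2)) : ℝ) : ℂ) * f i ξ := by
  refine (hf.band i).mul_left (m := fun ξ => ((-(4 * Real.pi ^ 2 * ((n : ℝ) ^ 2 + ‖ξ‖ ^ 2)) : ℝ) : ℂ))
    (by fun_prop) (c := 4 * Real.pi ^ 2 * ((n : ℝ) ^ 2 + ρ ^ 2)) fun ξ hξ => ?_
  rw [Complex.norm_real, Real.norm_eq_abs, abs_neg, abs_of_nonneg (by positivity)]
  gcongr

/-- The Laplacian of a mode as an element of `L²`. -/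
def laplaceL2 (hf : RossbyMode n σ ρ f) : L2Field := bandL2 hf.band_laplace n

theorem coeFn_laplaceL2 (hf : RossbyMode n σ ρ f) : hf.laplaceL2 =ᵐ[volume] laplace (bandField n f) := by
  rw [laplace_bandField hf.band]
  exact (memLp_bandField hf.band_laplace n).coeFn_toLp

/-- The exponent is the symbol of the Laplacian minus `Ω` times that of the Coriolis operator; the
polarisation enters only by turning `Ω` into `σ Ω`. -/
theorem hasDerivAt_flow (hf : RossbyMode n σ ρ f) (Ω t : ℝ) :
    HasDerivAt (hf.flow Ω) ((hf.mode_cexp Ω t).laplaceL2 - Ω • coriolis (hf.flow Ω t)) t := by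
  have h := hasDerivAt_bandL2_cexp hf.band (measurable_rossbySymbol n (σ * Ω))
    (fun ξ hξ => norm_rossbySymbol_le n (σ * Ω) ξ hξ) n t
  refine h.congr_deriv ?_
  have hc : coriolis (hf.flow Ω t) = _ := (hf.mode_cexp Ω t).coriolis_eq
  rw [hc, sub_eq_add_neg, ← neg_smul, laplaceL2]
  refine bandL2_add_smul _ _ _ _ n fun i ξ => ?_
  simp only [rossbySymbol, coriolisSymbol, waveNorm]
  push_cast
  ring

theorem flow_zero (hf : RossbyMode n σ ρ f) (Ω : ℝ) : hf.flow Ω 0 = bandL2 hf.band n :=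
  bandL2_congr _ _ n fun i => .of_forall fun ξ => by simp

theorem isRossbySolution (hf : RossbyMode n σ ρ f) (Ω : ℝ) :
    IsRossbySolution Ω (bandL2 hf.band n) (hf.flow Ω) where
  continuousOn := (continuous_iff_continuousAt.2 fun t => (hf.hasDerivAt_flow Ω t).continuousAt).continuousOn
  initial := hf.flow_zero Ω
  div_free t _ := (hf.mode_cexp Ω t).isDivFree
  equation φ hφ t _ := by
    have hin : ∀ v : L2Field, ∫ p, ⟪v p, φ p⟫_ℝ = ⟪v, (hφ.memLp 2).toLp φ⟫_ℝ := fun v => by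
      rw [L2.inner_def]
      refine integral_congr_ae ?_
      filter_upwards [(hφ.memLp 2).coeFn_toLp] with p hp
      rw [hp]
    have h1 := (hf.hasDerivAt_flow Ω t).inner ℝ (hasDerivAt_const t ((hφ.memLp 2).toLp φ))
    simp_rw [hin]
    refine (h1.congr_deriv ?_).hasDerivWithinAt
    have h2 : ∫ p, ⟪hf.flow Ω t p, laplace φ p⟫_ℝ = ⟪(hf.mode_cexp Ω t).laplaceL2, (hφ.memLp 2).toLp φ⟫_ℝ := by
      rw [← hin]
      have e1 : ∫ p, ⟪hf.flow Ω t p, laplace φ p⟫_ℝ = ∫ p, ⟪bandField n (fun i ξ =>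
          Complex.exp (t * rossbySymbol n (σ * Ω) ξ) * f i ξ) p, laplace φ p⟫_ℝ := by
        refine integral_congr_ae ?_
        filter_upwards [(memLp_bandField (hf.band_cexp Ω t) n).coeFn_toLp] with p hp
        rw [flow, bandL2, hp]
      rw [e1, hφ.integral_inner_laplace (smoothLift_bandField (hf.band_cexp Ω t) n)]
      refine integral_congr_ae ?_
      filter_upwards [(hf.mode_cexp Ω t).coeFn_laplaceL2] with p hp
      rw [hp]
    rw [h2, inner_zero_right, zero_add, inner_sub_left, real_inner_smul_left]

end RossbyMode

/-! ### The weak formulation: superposition and duality -/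

theorem IsTestFunction.integral_inner_eq {φ : Layer → Vec3} (hφ : IsTestFunction φ) (v : L2Field) :
    ∫ p, ⟪v p, φ p⟫_ℝ = ⟪v, (hφ.memLp 2).toLp φ⟫_ℝ := by
  rw [L2.inner_def]
  refine integral_congr_ae ?_
  filter_upwards [(hφ.memLp 2).coeFn_toLp] with p hp
  rw [hp]

/-- With every integral written as an inner product in `L²`, linearity of the problem becomes
linearity of bounded operators. -/
theorem isRossbySolution_iff {Ω : ℝ} {u₀ : L2Field} {u : ℝ → L2Field} :
    IsRossbySolution Ω u₀ u ↔ ContinuousOn u (Ici 0) ∧ u 0 = u₀ ∧ (∀ t, 0 ≤ t → u t ∈ divFree) ∧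
      ∀ φ : Layer → Vec3, ∀ hφ : IsTestFunction φ, ∀ t, 0 ≤ t →
        HasDerivWithinAt (fun s => ⟪u s, (hφ.memLp 2).toLp φ⟫_ℝ)
          (⟪u t, (hφ.laplace.memLp 2).toLp (laplace φ)⟫_ℝ -
            Ω * ⟪coriolisCLM (u t), (hφ.memLp 2).toLp φ⟫_ℝ) (Ici 0) t := by
  constructor
  · rintro ⟨h1, h2, h3, h4⟩
    refine ⟨h1, h2, h3, fun φ hφ t ht => ?_⟩
    simpa only [hφ.integral_inner_eq, hφ.laplace.integral_inner_eq, coriolisCLM_apply] using h4 φ hφ t ht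
  · rintro ⟨h1, h2, h3, h4⟩
    refine ⟨h1, h2, h3, fun φ hφ t ht => ?_⟩
    simpa only [hφ.integral_inner_eq, hφ.laplace.integral_inner_eq, coriolisCLM_apply] using h4 φ hφ t ht

namespace IsRossbySolution

variable {Ω : ℝ} {u₀ v₀ : L2Field} {u v : ℝ → L2Field}

theorem add (hu : IsRossbySolution Ω u₀ u) (hv : IsRossbySolution Ω v₀ v) :
    IsRossbySolution Ω (u₀ + v₀) (fun t => u t + v t) := by
  rw [isRossbySolution_iff] at *
  obtain ⟨a1, a2, a3, a4⟩ := hu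
  obtain ⟨b1, b2, b3, b4⟩ := hv
  refine ⟨a1.add b1, by rw [a2, b2], fun t ht => divFree.add_mem (a3 t ht) (b3 t ht), fun φ hφ t ht => ?_⟩
  simp only [inner_add_left, map_add]
  exact ((a4 φ hφ t ht).add (b4 φ hφ t ht)).congr_deriv (by ring)

theorem smul (c : ℝ) (hu : IsRossbySolution Ω u₀ u) :
    IsRossbySolution Ω (c • u₀) (fun t => c • u t) := by
  rw [isRossbySolution_iff] at *
  obtain ⟨a1, a2, a3, a4⟩ := hu
  refine ⟨a1.const_smul c, by rw [a2], fun t ht => divFree.smul_mem c (a3 t ht), fun φ hφ t ht => ?_⟩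
  simp only [real_inner_smul_left, map_smul]
  exact ((a4 φ hφ t ht).const_mul c).congr_deriv (by ring)

theorem zero (Ω : ℝ) : IsRossbySolution Ω 0 (fun _ => 0) := by
  rw [isRossbySolution_iff]
  refine ⟨continuousOn_const, rfl, fun t _ => divFree.zero_mem, fun φ hφ t _ => ?_⟩
  simpa using hasDerivWithinAt_const t (Ici (0 : ℝ)) (0 : ℝ)

theorem sum {ι : Type*} (s : Finset ι) {a : ι → L2Field} {w : ι → ℝ → L2Field}
    (h : ∀ i ∈ s, IsRossbySolution Ω (a i) (w i)) :
    IsRossbySolution Ω (∑ i ∈ s, a i) (fun t => ∑ i ∈ s, w i t) := by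
  classical
  induction s using Finset.induction_on with
  | empty => simpa using IsRossbySolution.zero Ω
  | insert i s hi ih =>
    simp_rw [Finset.sum_insert hi]
    exact (h i (Finset.mem_insert_self i s)).add (ih fun j hj => h j (Finset.mem_insert_of_mem hj))

end IsRossbySolution

theorem inner_e3Wedge_left (a b : Vec3) : ⟪e3Wedge a, b⟫_ℝ = -⟪a, e3Wedge b⟫_ℝ := by
  simp only [e3Wedge_apply, PiLp.inner_apply, Fin.sum_univ_three]
  simp

/-- `e₃ ∧` is pointwise skew, and the symmetric projector acts as the identity on the
divergence-free arguments. -/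
theorem inner_coriolis_left {a b : L2Field} (ha : IsDivFree a) (hb : IsDivFree b) :
    ⟪coriolisCLM a, b⟫_ℝ = -⟪a, coriolis b⟫_ℝ := by
  rw [coriolisCLM_apply, coriolis, coriolis, leray, Submodule.inner_starProjection_left_eq_right,
    ← Submodule.inner_starProjection_left_eq_right,
    ← Submodule.inner_starProjection_left_eq_right,
    Submodule.starProjection_eq_self_iff.2 (show a ∈ divFree from ha),
    Submodule.inner_starProjection_left_eq_right,
    Submodule.starProjection_eq_self_iff.2 (show b ∈ divFree from hb), L2.inner_def, L2.inner_def, ← integral_neg]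
  refine integral_congr_ae ?_
  filter_upwards [e3Wedge.coeFn_compLp a, e3Wedge.coeFn_compLp b] with p h1 h2
  rw [h1, h2, inner_e3Wedge_left]

/-- A product rule in which `w` is merely continuous: the slope splits into that of `w` against the
fixed vector `V s` and that of `V` against `w r`, which converges to `w s`. -/
theorem hasDerivAt_inner_of_weak {H : Type*} [NormedAddCommGroup H] [InnerProductSpace ℝ H]
    {w V : ℝ → H} {s d : ℝ} {V' : H} (hw : ContinuousAt w s) (hV : HasDerivAt V V' s)
    (h : HasDerivAt (fun r => ⟪w r, V s⟫_ℝ) d s) :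
    HasDerivAt (fun r => ⟪w r, V r⟫_ℝ) (d + ⟪w s, V'⟫_ℝ) s := by
  rw [hasDerivAt_iff_tendsto_slope] at *
  refine (h.add ((hw.tendsto.mono_left nhdsWithin_le_nhds).inner hV)).congr fun r => ?_
  simp only [slope_def_field, slope_def_module, inner_smul_right, inner_sub_right]
  simp only [div_eq_inv_mul]
  ring

namespace RossbyMode

variable {n : ℤ} {σ ρ : ℝ} {f : Fin 3 → Plane → ℂ}

/-- A mode is not compactly supported. The equation holds for its cutoffs, and their derivatives
converge uniformly near `s` because a continuous solution is bounded on the compact interval `[0, s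
+ 1]`; hence it holds in the limit. -/
theorem hasDerivAt_inner (hf : RossbyMode n σ ρ f) {Ω : ℝ} {u₀ : L2Field} {w : ℝ → L2Field}
    (hw : IsRossbySolution Ω u₀ w) {s : ℝ} (hs : 0 < s) :
    HasDerivAt (fun s => ⟪w s, bandL2 hf.band n⟫_ℝ)
      (⟪w s, hf.laplaceL2⟫_ℝ - Ω * ⟪coriolisCLM (w s), bandL2 hf.band n⟫_ℝ) s := by
  obtain ⟨h1, -, -, h4⟩ := isRossbySolution_iff.1 hw
  have hΦ := smoothLift_bandField hf.band n
  have h2 := memLp_bandField hf.band n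
  have hd : ∀ j, MemLp (partialD j (bandField n f)) 2 volume := fun j => by
    rw [partialD_bandField hf.band]
    exact memLp_bandField (fun i => (hf.band i).waveNumber_mul n j) n
  have hl : MemLp (laplace (bandField n f)) 2 volume := by
    rw [laplace_bandField hf.band]
    exact memLp_bandField hf.band_laplace n
  have hlL : hf.laplaceL2 = hl.toLp _ :=
    MemLp.toLp_congr (memLp_bandField hf.band_laplace n) hl (.of_forall fun p => by rw [laplace_bandField hf.band])
  have tA := hΦ.tendsto_cutoff_smul h2
  have tB := hΦ.tendsto_laplace_cutoff_smul h2 hd hl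
  set A := fun m => ((hΦ.isTestFunction_cutoff_smul m).memLp 2).toLp _ with hA
  set B := fun m => (((hΦ.isTestFunction_cutoff_smul m).laplace).memLp 2).toLp _ with hB
  obtain ⟨M, hM⟩ := isCompact_Icc.exists_bound_of_continuousOn (h1.mono (Icc_subset_Ici_self : Icc 0 (s + 1) ⊆ _))
  have hmem : s ∈ Ioo 0 (s + 1) := ⟨hs, by linarith⟩
  have hM0 : 0 ≤ M := (norm_nonneg _).trans (hM s ⟨hs.le, by linarith⟩)
  refine hasDerivAt_of_tendstoUniformlyOn (l := atTop) isOpen_Ioo (f := fun m s => ⟪w s, A m⟫_ℝ)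
    (f' := fun m s => ⟪w s, B m⟫_ℝ - Ω * ⟪coriolisCLM (w s), A m⟫_ℝ)
    (g' := fun s => ⟪w s, hf.laplaceL2⟫_ℝ - Ω * ⟪coriolisCLM (w s), bandL2 hf.band n⟫_ℝ)
    ?_ ?_ ?_ hmem
  · rw [Metric.tendstoUniformlyOn_iff]
    intro ε hε
    have hlim : Tendsto (fun m => M * ‖B m - hf.laplaceL2‖ + |Ω| * (‖coriolisCLM‖ * M * ‖A m - bandL2 hf.band n‖))
        atTop (𝓝 (M * ‖hf.laplaceL2 - hf.laplaceL2‖ + |Ω| * (‖coriolisCLM‖ * M * ‖bandL2 hf.band n - bandL2 hf.band n‖))) := by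
      refine Tendsto.add ?_ ?_
      · rw [hlL]
        exact (tB.sub_const _).norm.const_mul _
      · exact ((tA.sub_const _).norm.const_mul _).const_mul _
    simp only [sub_self, norm_zero, mul_zero, add_zero] at hlim
    filter_upwards [hlim.eventually (gt_mem_nhds hε)] with m hm x hx
    refine lt_of_le_of_lt ?_ hm
    have hx := hM x (Ioo_subset_Icc_self hx)
    rw [dist_comm, Real.dist_eq]
    have e : ⟪w x, B m⟫_ℝ - Ω * ⟪coriolisCLM (w x), A m⟫_ℝ -
        (⟪w x, hf.laplaceL2⟫_ℝ - Ω * ⟪coriolisCLM (w x), bandL2 hf.band n⟫_ℝ) =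
        ⟪w x, B m - hf.laplaceL2⟫_ℝ - Ω * ⟪coriolisCLM (w x), A m - bandL2 hf.band n⟫_ℝ := by
      rw [inner_sub_right, inner_sub_right]; ring
    rw [e]
    refine (abs_sub _ _).trans (add_le_add ?_ ?_)
    · exact (abs_real_inner_le_norm _ _).trans (by gcongr)
    · rw [abs_mul]
      gcongr
      refine (abs_real_inner_le_norm _ _).trans ?_
      gcongr
      exact (coriolisCLM.le_opNorm _).trans (by gcongr)
  · filter_upwards with m x hx
    exact (h4 _ (hΦ.isTestFunction_cutoff_smul m) x hx.1.le).hasDerivAt (Ici_mem_nhds hx.1)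
  · intro x _
    exact tendsto_const_nhds.inner tA

/-- A solution with zero initial data is orthogonal to every mode. -/
theorem inner_eq_zero (hf : RossbyMode n σ ρ f) {Ω : ℝ} {w : ℝ → L2Field}
    (hw : IsRossbySolution Ω 0 w) {T : ℝ} (hT : 0 ≤ T) : ⟪w T, bandL2 hf.band n⟫_ℝ = 0 := by
  rcases hT.eq_or_lt with rfl | hT
  · rw [hw.initial, inner_zero_left]
  -- The adjoint evolution: the Laplacian is symmetric and the Coriolis operator skew, so the flow
  -- for `-Ω` at time `T - s` makes the pairing constant. It vanishes at `s = 0` and is the desired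
  -- inner product at `s = T`.
  have hV : ∀ s, HasDerivAt (fun s => hf.flow (-Ω) (T - s)) _ s := fun s =>
    (hf.hasDerivAt_flow (-Ω) (T - s)).scomp s ((hasDerivAt_id s).const_sub T)
  have hc : ContinuousOn (fun s => ⟪w s, hf.flow (-Ω) (T - s)⟫_ℝ) (Icc 0 T) :=
    (hw.continuousOn.mono Icc_subset_Ici_self).inner
      (continuous_iff_continuousAt.2 fun s => (hV s).continuousAt).continuousOn
  have hd : ∀ s ∈ Ioo 0 T, HasDerivAt (fun s => ⟪w s, hf.flow (-Ω) (T - s)⟫_ℝ) 0 s := fun s hs => by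
    have h1 := (hf.mode_cexp (-Ω) (T - s)).hasDerivAt_inner hw hs.1
    have h2 := hasDerivAt_inner_of_weak (hw.continuousOn.continuousAt (Ici_mem_nhds hs.1)) (hV s) h1
    refine h2.congr_deriv ?_
    have h3 := inner_coriolis_left (hw.div_free s hs.1.le) (hf.mode_cexp (-Ω) (T - s)).isDivFree
    rw [h3]
    simp only [neg_smul, one_smul, inner_neg_right, inner_sub_right, inner_smul_right]
    change _ - Ω * -⟪w s, coriolis (hf.flow (-Ω) (T - s))⟫_ℝ + _ = _
    ring
  obtain ⟨c, -, h⟩ := exists_hasDerivAt_eq_slope _ (fun _ => 0) hT hc hd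
  have h0 := hw.initial
  simp only [h0, inner_zero_left, sub_zero, sub_self, hf.flow_zero] at h
  exact (div_eq_zero_iff.1 h.symm).resolve_right hT.ne'

end RossbyMode

/-! ### Polarisation, totality of the modes and uniqueness -/

theorem abs_waveNumber_le_waveNorm (n : ℤ) (j : Fin 3) (ξ : Plane) : |waveNumber n ξ j| ≤ waveNorm n ξ := by
  rw [waveNorm, ← sum_waveNumber_sq, ← Real.sqrt_sq_eq_abs]
  exact Real.sqrt_le_sqrt (Finset.single_le_sum (f := fun j => waveNumber n ξ j ^ 2)
    (fun i _ => sq_nonneg _) (Finset.mem_univ j))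

theorem norm_le_waveNorm (n : ℤ) (ξ : Plane) : ‖ξ‖ ≤ waveNorm n ξ :=
  Real.le_sqrt_of_sq_le (by nlinarith [sq_nonneg (n : ℝ)])

/-- The normalised wave number. -/
def unitWave (n : ℤ) (j : Fin 3) (ξ : Plane) : ℂ := ((waveNumber n ξ j * (waveNorm n ξ)⁻¹ : ℝ) : ℂ)

theorem measurable_unitWave (n : ℤ) (j : Fin 3) : Measurable (unitWave n j) := by
  have h1 := measurable_waveNumber n j
  have h2 := (continuous_waveNorm n).measurable
  unfold unitWave; fun_prop

theorem norm_unitWave_le (n : ℤ) (j : Fin 3) (ξ : Plane) : ‖unitWave n j ξ‖ ≤ 1 := by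
  rw [unitWave, Complex.norm_real, Real.norm_eq_abs, abs_mul, abs_inv, abs_of_nonneg (waveNorm_nonneg n ξ),
    ← div_eq_mul_inv]
  exact div_le_one_of_le₀ (abs_waveNumber_le_waveNorm n j ξ) (waveNorm_nonneg n ξ)

theorem waveNumber_eq_mul_unitWave (n : ℤ) (j : Fin 3) (ξ : Plane) :
    (waveNumber n ξ j : ℂ) = waveNorm n ξ * unitWave n j ξ := by
  rw [unitWave, ← Complex.ofReal_mul]
  congr 1
  by_cases h : waveNorm n ξ = 0
  · have := abs_waveNumber_le_waveNorm n j ξ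
    rw [h] at this ⊢
    rw [zero_mul]; exact abs_nonpos_iff.1 this
  · field_simp

theorem sum_unitWave_sq {n : ℤ} {ξ : Plane} (h : 0 < waveNorm n ξ) :
    unitWave n 0 ξ ^ 2 + unitWave n 1 ξ ^ 2 + unitWave n 2 ξ ^ 2 = 1 := by
  have h1 := sum_waveNumber_sq n ξ
  have h2 : waveNorm n ξ ^ 2 = (n : ℝ) ^ 2 + ‖ξ‖ ^ 2 := Real.sq_sqrt (by positivity)
  rw [← h2, Fin.sum_univ_three] at h1
  simp only [unitWave]
  norm_cast
  field_simp
  exact h1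

/-- The part of `f` with circular polarisation `σ`. -/
def polarPart (n : ℤ) (σ : ℝ) (f : Fin 3 → Plane → ℂ) : Fin 3 → Plane → ℂ :=
  ![fun ξ => 2⁻¹ * (f 0 ξ + σ * Complex.I * (unitWave n 1 ξ * f 2 ξ + -1 * (unitWave n 2 ξ * f 1 ξ))),
    fun ξ => 2⁻¹ * (f 1 ξ + σ * Complex.I * (unitWave n 2 ξ * f 0 ξ + -1 * (unitWave n 0 ξ * f 2 ξ))),
    fun ξ => 2⁻¹ * (f 2 ξ + σ * Complex.I * (unitWave n 0 ξ * f 1 ξ + -1 * (unitWave n 1 ξ * f 0 ξ)))]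

theorem polarPart_add (n : ℤ) (f : Fin 3 → Plane → ℂ) (i : Fin 3) (ξ : Plane) :
    polarPart n 1 f i ξ + polarPart n (-1) f i ξ = f i ξ := by
  fin_cases i <;> simp [polarPart] <;> ring

theorem norm_polarPart_le (n : ℤ) {σ : ℝ} (hσ : σ ^ 2 = 1) (f : Fin 3 → Plane → ℂ) (i : Fin 3) (ξ : Plane) :
    ‖polarPart n σ f i ξ‖ ≤ ∑ j, ‖f j ξ‖ := by
  have key : ∀ j k l : Fin 3, ∀ a b : Fin 3,
      ‖2⁻¹ * (f j ξ + σ * Complex.I * (unitWave n a ξ * f k ξ + -1 * (unitWave n b ξ * f l ξ)))‖ ≤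
        ‖f j ξ‖ + ‖f k ξ‖ + ‖f l ξ‖ := by
    intro j k l a b
    have h1 : ‖(σ : ℂ) * Complex.I‖ = 1 := by
      rw [norm_mul, Complex.norm_I, mul_one, Complex.norm_real, Real.norm_eq_abs]
      exact (pow_eq_one_iff_of_nonneg (abs_nonneg σ) two_ne_zero).1 (by rw [sq_abs, hσ])
    have h2 : ‖(2⁻¹ : ℂ)‖ ≤ 1 := by norm_num
    rw [norm_mul]
    refine (mul_le_of_le_one_left (norm_nonneg _) h2).trans ?_
    refine (norm_add_le _ _).trans ?_
    rw [norm_mul, h1, one_mul, add_assoc]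
    refine add_le_add_right ((norm_add_le _ _).trans (add_le_add ?_ ?_)) _
    · rw [norm_mul]; exact mul_le_of_le_one_left (norm_nonneg _) (norm_unitWave_le n a ξ)
    · rw [norm_mul, norm_neg, norm_one, one_mul, norm_mul]
      exact mul_le_of_le_one_left (norm_nonneg _) (norm_unitWave_le n b ξ)
  rw [Fin.sum_univ_three]
  fin_cases i
  · exact (key 0 2 1 1 2).trans (by linarith)
  · exact (key 1 0 2 2 0).trans (by linarith)
  · exact (key 2 1 0 0 1).trans (by linarith)

/-- For the unit wave vector `κ`, the map `f ↦ κ × f` squares to `-1` on the orthogonal complement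
of `κ`. So `(1 + σ i κ ×) / 2` projects onto its eigenspace for the eigenvalue `-σ i`, where the
divergence condition `κ · f = 0` supplies the square. -/
theorem rossbyMode_polarPart {n : ℤ} {σ ρ : ℝ} {f : Fin 3 → Plane → ℂ} (hσ : σ ^ 2 = 1)
    (hb : ∀ i, BandLimited ρ (f i)) (hlow : ∃ ε > 0, ∀ ξ, waveNorm n ξ < ε → ∀ i, f i ξ = 0)
    (hdiv : ∀ ξ, ∑ j, (waveNumber n ξ j : ℂ) * f j ξ = 0) : RossbyMode n σ ρ (polarPart n σ f) := by
  have hbu : ∀ a j, BandLimited ρ fun ξ => unitWave n a ξ * f j ξ := fun a j =>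
    (hb j).mul_left (measurable_unitWave n a) fun ξ _ => norm_unitWave_le n a ξ
  have hs : ((σ : ℂ) * Complex.I) ^ 2 = -1 := by
    rw [mul_pow, Complex.I_sq]
    have e : (σ : ℂ) ^ 2 = 1 := by exact_mod_cast hσ
    rw [e]; ring
  have hcase : ∀ ξ, (∀ i, f i ξ = 0) ∨ 0 < waveNorm n ξ := fun ξ => by
    obtain ⟨ε, hε, h⟩ := hlow
    rcases lt_or_ge (waveNorm n ξ) ε with h1 | h1
    · exact Or.inl (h ξ h1)
    · exact Or.inr (hε.trans_le h1)
  have hd : ∀ ξ, 0 < waveNorm n ξ →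
      unitWave n 0 ξ * f 0 ξ + unitWave n 1 ξ * f 1 ξ + unitWave n 2 ξ * f 2 ξ = 0 := fun ξ h => by
    have h1 := hdiv ξ
    have h2 : (waveNorm n ξ : ℂ) ≠ 0 := by exact_mod_cast h.ne'
    simp only [Fin.sum_univ_three, waveNumber_eq_mul_unitWave] at h1
    refine mul_left_cancel₀ h2 ?_
    linear_combination h1
  refine ⟨fun i => ?_, ?_, hσ, fun ξ => ?_, fun ξ => ?_, fun ξ => ?_⟩
  · fin_cases i
    · exact ((hb 0).add (((hbu 1 2).add ((hbu 2 1).const_mul (-1))).const_mul _)).const_mul _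
    · exact ((hb 1).add (((hbu 2 0).add ((hbu 0 2).const_mul (-1))).const_mul _)).const_mul _
    · exact ((hb 2).add (((hbu 0 1).add ((hbu 1 0).const_mul (-1))).const_mul _)).const_mul _
  · obtain ⟨ε, hε, h⟩ := hlow
    refine ⟨ε, hε, fun ξ hξ i => ?_⟩
    fin_cases i <;> simp [polarPart, h ξ hξ]
  · rcases hcase ξ with h | h
    · simp [polarPart, h]
    have hd := hd ξ h
    have hm := sum_unitWave_sq h
    simp only [waveNumber_eq_mul_unitWave, polarPart, Matrix.cons_val]
    linear_combination (2⁻¹ * waveNorm n ξ * (unitWave n 1 ξ * f 2 ξ - unitWave n 2 ξ * f 1 ξ)) * hs +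
      (2⁻¹ * waveNorm n ξ * (σ * Complex.I)) * (unitWave n 0 ξ * hd - f 0 ξ * hm)
  · rcases hcase ξ with h | h
    · simp [polarPart, h]
    have hd := hd ξ h
    have hm := sum_unitWave_sq h
    simp only [waveNumber_eq_mul_unitWave, polarPart, Matrix.cons_val]
    linear_combination (2⁻¹ * waveNorm n ξ * (unitWave n 2 ξ * f 0 ξ - unitWave n 0 ξ * f 2 ξ)) * hs +
      (2⁻¹ * waveNorm n ξ * (σ * Complex.I)) * (unitWave n 1 ξ * hd - f 1 ξ * hm)
  · rcases hcase ξ with h | h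
    · simp [polarPart, h]
    have hd := hd ξ h
    have hm := sum_unitWave_sq h
    simp only [waveNumber_eq_mul_unitWave, polarPart, Matrix.cons_val]
    linear_combination (2⁻¹ * waveNorm n ξ * (unitWave n 0 ξ * f 1 ξ - unitWave n 1 ξ * f 0 ξ)) * hs +
      (2⁻¹ * waveNorm n ξ * (σ * Complex.I)) * (unitWave n 2 ξ * hd - f 2 ξ * hm)

theorem inner_indicator_self (h : PlaneL2) {A : Set Plane} {ρ : ℝ} (hb : BandLimited ρ (A.indicator h)) :
    ⟪h, hb.memLp.toLp _⟫_ℂ = ⟪hb.memLp.toLp _, hb.memLp.toLp _⟫_ℂ := by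
  rw [inner_toLp_eq_integral, inner_toLp_eq_integral]
  refine integral_congr_ae ?_
  filter_upwards [hb.memLp.coeFn_toLp] with ξ hξ
  rw [hξ]
  by_cases hm : ξ ∈ A
  · rw [indicator_of_mem hm]
  · rw [indicator_of_notMem hm]; simp

theorem toLp_eq_zero_iff {f : Plane → ℂ} (hf : MemLp f 2 volume) : hf.toLp f = 0 ↔ f =ᵐ[volume] 0 :=
  Lp.eq_zero_iff_ae_eq_zero.trans ⟨hf.coeFn_toLp.symm.trans, hf.coeFn_toLp.trans⟩

theorem modeFourier_eq_zero_iff {v : L2Field} {n : ℤ} {i : Fin 3} :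
    modeFourier v n i = 0 ↔ verticalCoeff v i n =ᵐ[volume] 0 := by
  have h := (Lp.fourierTransformₗᵢ Plane ℂ).map_eq_zero_iff
    (x := (memLp_verticalCoeff v i n).toLp (verticalCoeff v i n))
  exact h.trans (toLp_eq_zero_iff _)

theorem eq_zero_of_verticalCoeff {v : L2Field} (h : ∀ i n, verticalCoeff v i n =ᵐ[volume] 0) : v = 0 := by
  refine Lp.ext ?_
  have h1 : ∀ᵐ p, ∀ i, ((v p i : ℝ) : ℂ) = _ :=
    ae_all_iff.2 fun i => ae_eq_sum_verticalCoeff v i ∅ fun n _ => h i n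
  filter_upwards [h1, Lp.coeFn_zero Vec3 2 (volume : Measure Layer)] with p hp h0
  rw [h0]
  ext i
  simpa using hp i

/-- The modes span a dense subspace of the divergence-free fields. -/
theorem eq_zero_of_inner_modes {v : L2Field} (hv : IsDivFree v)
    (h : ∀ n σ ρ f, ∀ hf : RossbyMode n σ ρ f, ⟪v, bandL2 hf.band n⟫_ℝ = 0) : v = 0 := by
  refine eq_zero_of_verticalCoeff fun i n => modeFourier_eq_zero_iff.1 ?_
  have key : ∀ m : ℕ, ∀ᵐ ξ : Plane, ((m : ℝ) + 1)⁻¹ ≤ waveNorm n ξ → ‖ξ‖ ≤ m →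
      ∑ j, (waveNumber n ξ j : ℂ) * modeFourier v n j ξ = 0 → modeFourier v n i ξ = 0 := by
    intro m
    -- Truncation to an annulus makes the profile admissible as a mode, for `n = 0` too, and the
    -- last condition turns the almost everywhere divergence relation into one valid at every point.
    set A : Set Plane := ({ξ | ((m : ℝ) + 1)⁻¹ ≤ waveNorm n ξ} ∩ {ξ | ‖ξ‖ ≤ m}) ∩
      {ξ | ∑ j, (waveNumber n ξ j : ℂ) * modeFourier v n j ξ = 0} with hA
    have hAm : MeasurableSet A := by
      refine ((measurableSet_le measurable_const (continuous_waveNorm n).measurable).inter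
        (measurableSet_le measurable_norm measurable_const)).inter (measurableSet_eq_fun ?_ measurable_const)
      exact Finset.measurable_fun_sum _ fun j _ => (Complex.measurable_ofReal.comp (measurable_waveNumber n j)).mul
        (Lp.stronglyMeasurable _).measurable
    have hb : ∀ i, BandLimited m (A.indicator (modeFourier v n i)) := fun i =>
      bandLimited_indicator _ hAm fun ξ hξ => hξ.1.2
    have hlow : ∃ ε > 0, ∀ ξ, waveNorm n ξ < ε → ∀ i, A.indicator (modeFourier v n i) ξ = 0 :=
      ⟨((m : ℝ) + 1)⁻¹, by positivity, fun ξ hξ i => indicator_of_notMem (fun hm => absurd hm.1.1 (not_le.2 hξ)) _⟩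
    have hdiv : ∀ ξ, ∑ j, (waveNumber n ξ j : ℂ) * A.indicator (modeFourier v n j) ξ = 0 := fun ξ => by
      by_cases hξ : ξ ∈ A
      · simp only [indicator_of_mem hξ]
        exact hξ.2
      · simp only [indicator_of_notMem hξ, mul_zero, Finset.sum_const_zero]
    have hp := rossbyMode_polarPart (σ := 1) (by norm_num) hb hlow hdiv
    have hn := rossbyMode_polarPart (σ := -1) (by norm_num) hb hlow hdiv
    have hsum : bandL2 hb n = bandL2 hp.band n + (1 : ℝ) • bandL2 hn.band n :=
      bandL2_add_smul _ _ _ 1 n fun i ξ => by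
        rw [Complex.ofReal_one, one_mul]
        exact (polarPart_add n (fun i => A.indicator (modeFourier v n i)) i ξ).symm
    have h0 : ⟪v, bandL2 hb n⟫_ℝ = 0 := by
      rw [hsum, inner_add_right, inner_smul_right, h _ _ _ _ hp, h _ _ _ _ hn]; simp
    rw [inner_bandL2, Complex.re_sum] at h0
    have hnn : ∀ j ∈ Finset.univ, 0 ≤ (⟪modeFourier v n j, (hb j).memLp.toLp _⟫_ℂ).re := fun j _ => by
      rw [inner_indicator_self _ (hb j)]; exact inner_self_nonneg (𝕜 := ℂ)
    have h1 := (Finset.sum_eq_zero_iff_of_nonneg hnn).1 h0 i (Finset.mem_univ i)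
    rw [inner_indicator_self _ (hb i)] at h1
    have h2 : (hb i).memLp.toLp _ = (0 : PlaneL2) := by
      rw [← norm_eq_zero, ← sq_eq_zero_iff, ← inner_self_eq_norm_sq (𝕜 := ℂ)]; exact h1
    filter_upwards [(toLp_eq_zero_iff _).1 h2] with ξ hξ a1 a2 a3
    rwa [indicator_of_mem (show ξ ∈ A from ⟨⟨a1, a2⟩, a3⟩)] at hξ
  refine Lp.ext ?_
  -- Only `ξ = 0` can have wave number zero, so almost every point lies in one of the annuli.
  have hne : ∀ᵐ ξ : Plane, ξ ≠ 0 := Measure.ae_ne volume 0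
  filter_upwards [ae_all_iff.2 key, hv.sum_waveNumber_mul_modeFourier n, hne,
    Lp.coeFn_zero ℂ 2 (volume : Measure Plane)] with ξ h1 h2 h3 h4
  rw [h4]
  obtain ⟨m₁, hm₁⟩ := exists_nat_ge ‖ξ‖
  obtain ⟨m₂, hm₂⟩ := exists_nat_gt (waveNorm n ξ)⁻¹
  have hpos : 0 < waveNorm n ξ := (norm_pos_iff.2 h3).trans_le (norm_le_waveNorm n ξ)
  have c1 : (m₁ : ℝ) ≤ (max m₁ m₂ : ℕ) := by exact_mod_cast le_max_left _ _
  have c2 : (m₂ : ℝ) ≤ (max m₁ m₂ : ℕ) := by exact_mod_cast le_max_right _ _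
  refine h1 (max m₁ m₂) ?_ (hm₁.trans c1) h2
  exact inv_le_of_inv_le₀ hpos (by linarith)

theorem IsRossbySolution.eqOn {Ω : ℝ} {u₀ : L2Field} {u v : ℝ → L2Field} (hu : IsRossbySolution Ω u₀ u)
    (hv : IsRossbySolution Ω u₀ v) : EqOn v u (Ici 0) := by
  intro t ht
  have hw := hv.add (hu.smul (-1))
  rw [neg_one_smul, add_neg_cancel] at hw
  have h := eq_zero_of_inner_modes (hw.div_free t ht) fun n σ ρ f hf => hf.inner_eq_zero hw ht
  simp only [neg_one_smul] at h
  exact add_neg_eq_zero.1 h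

/-! ### Decomposition of the data into modes -/

/-- The substitution `k = 2π ξ` passes between the two normalisations; dilations preserve null sets.
-/
theorem FourierSupportedIn.modeFourier_eq_zero {R : ℝ} {v : L2Field} (h : FourierSupportedIn R v) (n : ℤ)
    (i : Fin 3) : ∀ᵐ ξ : Plane, R < 2 * Real.pi * waveNorm n ξ → modeFourier v n i ξ = 0 := by
  have hpi : (2 * Real.pi) ≠ 0 := by positivity
  have h1 : ∀ᵐ ξ : Plane, R < √(‖(2 * Real.pi) • ξ‖ ^ 2 + 4 * Real.pi ^ 2 * (n : ℝ) ^ 2) →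
      layerFourier v i n ((2 * Real.pi) • ξ) = 0 := by
    have h0 := ae_iff.1 (h i n)
    rw [ae_iff]
    have := Measure.addHaar_preimage_smul (volume : Measure Plane) hpi
      {k | ¬(R < √(‖k‖ ^ 2 + 4 * Real.pi ^ 2 * (n : ℝ) ^ 2) → layerFourier v i n k = 0)}
    rw [h0, mul_zero] at this
    exact this
  filter_upwards [h1] with ξ hξ hR
  have e : √(‖(2 * Real.pi) • ξ‖ ^ 2 + 4 * Real.pi ^ 2 * (n : ℝ) ^ 2) = 2 * Real.pi * waveNorm n ξ := by
    rw [norm_smul, Real.norm_of_nonneg (by positivity), waveNorm,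
      show (2 * Real.pi * ‖ξ‖) ^ 2 + 4 * Real.pi ^ 2 * (n : ℝ) ^ 2 = (2 * Real.pi) ^ 2 * ((n : ℝ) ^ 2 + ‖ξ‖ ^ 2) by ring,
      Real.sqrt_mul (by positivity), Real.sqrt_sq (by positivity)]
  rw [e] at hξ
  have := hξ hR
  rw [layerFourier, smul_smul, inv_mul_cancel₀ hpi, one_smul] at this
  refine (mul_eq_zero.1 this).resolve_left ?_
  exact_mod_cast inv_ne_zero hpi

theorem HasZeroVerticalMean.verticalCoeff_zero {v : L2Field} (h : HasZeroVerticalMean v) (i : Fin 3) :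
    verticalCoeff v i 0 =ᵐ[volume] 0 := by
  filter_upwards [h, ae_memLp_section (Lp.memLp v)] with x hx hx1
  have h2 := (Complex.ofRealCLM ∘L (EuclideanSpace.proj i : Vec3 →L[ℝ] ℝ)).integral_comp_comm
    (hx1.integrable (by norm_num))
  rw [hx, map_zero] at h2
  simp only [verticalCoeff, neg_zero, fourier_zero, one_mul, Pi.zero_apply]
  exact h2

/-- A duality form of Bessel's inequality: `‖F‖²` is the pairing of `v` with the field synthesised
from `F`, whose norm is at most `‖F‖`. -/
theorem norm_toLp_indicator_le (v : L2Field) (n : ℤ) (i : Fin 3) {A : Set Plane} {ρ : ℝ}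
    (hb : BandLimited ρ (A.indicator (modeFourier v n i))) :
    eLpNorm (A.indicator (modeFourier v n i)) 2 volume ≤ ENNReal.ofReal ‖v‖ := by
  set F := hb.memLp.toLp _ with hF
  have h1 := inner_synthCLM hb n i v
  rw [inner_indicator_self _ hb] at h1
  have h2 : ‖F‖ ^ 2 ≤ ‖v‖ * ‖F‖ := by
    rw [← inner_self_eq_norm_sq (𝕜 := ℂ)]
    change (⟪F, F⟫_ℂ).re ≤ _
    rw [hF, ← h1]
    refine (real_inner_le_norm _ _).trans ?_
    gcongr
    exact norm_synthCLM_le n i _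
  have h3 : ‖F‖ ≤ ‖v‖ := by
    rcases (norm_nonneg F).eq_or_lt with h | h
    · rw [← h]; exact norm_nonneg v
    · exact le_of_mul_le_mul_right (by rwa [← sq]) h
  rw [← ENNReal.ofReal_toReal hb.memLp.2.ne]
  refine ENNReal.ofReal_le_ofReal ?_
  rwa [← Lp.norm_toLp _ hb.memLp]

/-- The non-zero vertical frequencies of modulus at most `⌈R⌉`. -/
def verticalFrequencies (R : ℝ) : Finset ℤ := (Finset.Icc (-⌈R⌉) ⌈R⌉).erase 0

/-- The two circular polarisations. -/
def polarSign (b : Bool) : ℝ := bif b then 1 else -1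

theorem polarSign_sq (b : Bool) : polarSign b ^ 2 = 1 := by cases b <;> simp [polarSign]

/-- Almost everywhere, truncating the Fourier coefficients to the ball and to the divergence-free
set changes nothing, so `v` is its finite vertical Fourier series and each coefficient splits into
its two polarisations. The vertical mean removes `n = 0`. The factor 3 comes from bounding a
polarised component by the sum of the three original ones. -/
theorem exists_mode_decomposition {R : ℝ} (hR : 0 < R) {v : L2Field} (hmean : HasZeroVerticalMean v)
    (hv : IsDivFree v) (hsupp : FourierSupportedIn R v) :
    ∃ (g : ℤ → Bool → Fin 3 → Plane → ℂ)
      (hg : ∀ x : verticalFrequencies R × Bool, RossbyMode x.1 (polarSign x.2) R (g x.1 x.2)),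
      v = ∑ x, bandL2 (hg x).band x.1 ∧
      ∀ n b i, eLpNorm (g n b i) 2 volume ≤ ENNReal.ofReal (3 * ‖v‖) := by
  set A : ℤ → Set Plane := fun n => {ξ | ‖ξ‖ ≤ R} ∩
    {ξ | ∑ j, (waveNumber n ξ j : ℂ) * modeFourier v n j ξ = 0} with hA
  have hAm : ∀ n, MeasurableSet (A n) := fun n => by
    refine (measurableSet_le measurable_norm measurable_const).inter (measurableSet_eq_fun ?_ measurable_const)
    exact Finset.measurable_fun_sum _ fun j _ => (Complex.measurable_ofReal.comp (measurable_waveNumber n j)).mul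
      (Lp.stronglyMeasurable _).measurable
  set f : ℤ → Fin 3 → Plane → ℂ := fun n i => (A n).indicator (modeFourier v n i) with hf
  have hb : ∀ n i, BandLimited R (f n i) := fun n i => bandLimited_indicator _ (hAm n) fun ξ hξ => hξ.1
  have hdiv : ∀ n ξ, ∑ j, (waveNumber n ξ j : ℂ) * f n j ξ = 0 := fun n ξ => by
    by_cases hξ : ξ ∈ A n
    · simp only [hf, indicator_of_mem hξ]
      exact hξ.2
    · simp only [hf, indicator_of_notMem hξ, mul_zero, Finset.sum_const_zero]
  have hone : ∀ n : ℤ, n ≠ 0 → (1 : ℝ) ≤ |(n : ℝ)| := fun n hn => by exact_mod_cast Int.one_le_abs hn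
  -- For `n ≠ 0` the wave number has modulus at least 1, so the condition near zero is vacuous with
  -- `ε = 1`.
  have hlow : ∀ n, n ≠ 0 → ∃ ε > 0, ∀ ξ, waveNorm n ξ < ε → ∀ i, f n i ξ = 0 := fun n hn =>
    ⟨1, one_pos, fun ξ hξ => absurd ((hone n hn).trans (abs_intCast_le_waveNorm n ξ)) (not_le.2 hξ)⟩
  have hmode : ∀ n b, n ≠ 0 → RossbyMode n (polarSign b) R (polarPart n (polarSign b) (f n)) := fun n b hn =>
    rossbyMode_polarPart (polarSign_sq b) (hb n) (hlow n hn) (hdiv n)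
  have hfm : ∀ n i, f n i =ᵐ[volume] modeFourier v n i := fun n i => by
    filter_upwards [hsupp.modeFourier_eq_zero n i, hv.sum_waveNumber_mul_modeFourier n] with ξ h1 h2
    by_cases hξ : ‖ξ‖ ≤ R
    · exact indicator_of_mem (show ξ ∈ A n from ⟨hξ, h2⟩) _
    · rw [h1, hf]
      · exact indicator_of_notMem (fun h => hξ h.1) _
      · have h3 := norm_le_waveNorm n ξ
        nlinarith [Real.pi_gt_three, waveNorm_nonneg n ξ]
  have hcoeff : ∀ n i, verticalCoeff v i n =ᵐ[volume] 𝓕⁻ (f n i) := fun n i => by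
    have e1 : (hb n i).memLp.toLp _ = modeFourier v n i := by
      refine Lp.ext ((hb n i).memLp.coeFn_toLp.trans (hfm n i))
    have e2 : (𝓕⁻ (modeFourier v n i) : PlaneL2) = (memLp_verticalCoeff v i n).toLp _ :=
      (Lp.fourierTransformₗᵢ Plane ℂ).symm_apply_apply _
    have e3 := coeFn_fourierInv_toLp (hb n i).memLp (hb n i).integrable
    rw [e1, e2] at e3
    exact (MemLp.coeFn_toLp _).symm.trans e3
  have hvanish : ∀ i n, n ∉ verticalFrequencies R → verticalCoeff v i n =ᵐ[volume] 0 := by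
    intro i n hn
    by_cases h0 : n = 0
    · rw [h0]; exact hmean.verticalCoeff_zero i
    rw [← modeFourier_eq_zero_iff]
    refine Lp.ext ?_
    filter_upwards [hsupp.modeFourier_eq_zero n i, Lp.coeFn_zero ℂ 2 (volume : Measure Plane)] with ξ h1 h2
    rw [h2]
    refine h1 ?_
    have h3 : ⌈R⌉ < |n| := by
      by_contra! h
      exact hn (Finset.mem_erase.2 ⟨h0, Finset.mem_Icc.2 (abs_le.1 h)⟩)
    have h4 : R < |(n : ℝ)| := (Int.le_ceil R).trans_lt (by exact_mod_cast h3)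
    have h5 := abs_intCast_le_waveNorm n ξ
    nlinarith [Real.pi_gt_three, waveNorm_nonneg n ξ]
  have hne : ∀ x : verticalFrequencies R, (x : ℤ) ≠ 0 := fun x => Finset.ne_of_mem_erase x.2
  have hsplit : ∀ x : verticalFrequencies R, bandL2 (hb x) x =
      ∑ b : Bool, bandL2 (hmode x b (hne x)).band x := fun x => by
    rw [Fintype.sum_bool, ← one_smul ℝ (bandL2 (hmode x false (hne x)).band x)]
    refine bandL2_add_smul _ _ _ 1 x fun i ξ => ?_
    rw [Complex.ofReal_one, one_mul]
    exact (polarPart_add x (f x) i ξ).symm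
  refine ⟨fun n b => polarPart n (polarSign b) (f n), fun x => hmode x.1 x.2 (hne x.1), ?_, fun n b i => ?_⟩
  · rw [Fintype.sum_prod_type]
    simp_rw [← hsplit]
    refine Lp.ext ?_
    have h1 : ∀ᵐ p, ∀ i, ((v p i : ℝ) : ℂ) = _ := ae_all_iff.2 fun i =>
      ae_eq_sum_verticalCoeff v i (verticalFrequencies R) (hvanish i)
    have h2 : ∀ᵐ p : Layer, ∀ n i, verticalCoeff v i n p.1 = 𝓕⁻ (f n i) p.1 :=
      ae_all_iff.2 fun n => ae_all_iff.2 fun i =>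
        measurePreserving_layer_fst.quasiMeasurePreserving.ae_eq_comp (hcoeff n i)
    have h3 : ∀ᵐ p : Layer, ∀ x : verticalFrequencies R, bandL2 (hb x) x p = bandField x (f x) p :=
      ae_all_iff.2 fun x => (memLp_bandField (hb x) x).coeFn_toLp
    filter_upwards [h1, h2, h3, Lp.coeFn_finsetSum Finset.univ
      (fun x : verticalFrequencies R => bandL2 (hb x) x)] with p h1 h2 h3 h4
    rw [h4, Finset.sum_apply]
    ext i
    have h5 := congrArg Complex.re (h1 i)
    rw [Complex.ofReal_re, Complex.re_sum] at h5
    rw [h5, WithLp.ofLp_sum, Finset.sum_apply,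
      ← Finset.sum_coe_sort (verticalFrequencies R) (fun n => (fourier n p.2 * verticalCoeff v i n p.1).re)]
    refine Finset.sum_congr rfl fun x _ => ?_
    rw [h3, h2]
    rfl
  · calc eLpNorm (polarPart n (polarSign b) (f n) i) 2 volume
        ≤ eLpNorm (∑ j, fun ξ => ‖f n j ξ‖) 2 volume := by
          refine eLpNorm_mono_real fun ξ => ?_
          rw [Finset.sum_apply]
          exact norm_polarPart_le n (polarSign_sq b) (f n) i ξ
      _ ≤ ∑ j, eLpNorm (fun ξ => ‖f n j ξ‖) 2 volume :=
          eLpNorm_sum_le (fun j _ => (hb n j).memLp.1.norm) (by norm_num)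
      _ ≤ ∑ _j : Fin 3, ENNReal.ofReal ‖v‖ := by
          refine Finset.sum_le_sum fun j _ => ?_
          rw [eLpNorm_norm]
          exact norm_toLp_indicator_le v n j (hb n j)
      _ = ENNReal.ofReal (3 * ‖v‖) := by
          rw [Finset.sum_const, Finset.card_univ, Fintype.card_fin, nsmul_eq_mul,
            ENNReal.ofReal_mul (by norm_num)]
          norm_num

/-! ### Interpolation in space and time -/

/-- For finite `q`, `|f|^q ≤ ‖f‖_∞^{q-2} |f|²` almost everywhere. -/
theorem eLpNorm_le_rpow_mul_rpow {α E : Type*} [MeasurableSpace α] [NormedAddCommGroup E] {μ : Measure α}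
    {f : α → E} (hf : AEStronglyMeasurable f μ) {q : ℝ≥0∞} (hq : 2 ≤ q) :
    eLpNorm f q μ ≤ eLpNorm f 2 μ ^ (2 * q⁻¹.toReal) * eLpNorm f ⊤ μ ^ (1 - 2 * q⁻¹.toReal) := by
  rcases eq_or_ne q ⊤ with rfl | hqt
  · simp
  have hq0 : q ≠ 0 := (two_pos.trans_le hq).ne'
  set r := q.toReal with hr
  have hr2 : 2 ≤ r := by simpa using ENNReal.toReal_mono hqt hq
  have hr0 : r ≠ 0 := by positivity
  set N := eLpNorm f ⊤ μ with hN
  have h1 : ∫⁻ x, ‖f x‖ₑ ^ r ∂μ ≤ N ^ (r - 2) * eLpNorm f 2 μ ^ (2 : ℝ) := by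
    have e : eLpNorm f 2 μ ^ (2 : ℝ) = ∫⁻ x, ‖f x‖ₑ ^ (2 : ℝ) ∂μ := by
      rw [eLpNorm_eq_lintegral_rpow_enorm_toReal (by simp) (by simp), ← ENNReal.rpow_mul]
      simp
    rw [e, ← lintegral_const_mul'' _ (hf.enorm.pow_const _)]
    refine lintegral_mono_ae ?_
    filter_upwards [enorm_ae_le_eLpNormEssSup f μ] with x hx
    rw [← eLpNorm_exponent_top] at hx
    calc ‖f x‖ₑ ^ r = ‖f x‖ₑ ^ (r - 2) * ‖f x‖ₑ ^ (2 : ℝ) := by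
          rw [← ENNReal.rpow_add_of_nonneg _ _ (by linarith) (by norm_num)]; congr 1; ring
      _ ≤ _ := by gcongr
  rw [eLpNorm_eq_lintegral_rpow_enorm_toReal hq0 hqt, ← hr, ENNReal.toReal_inv, ← hr]
  calc (∫⁻ x, ‖f x‖ₑ ^ r ∂μ) ^ (1 / r) ≤ (N ^ (r - 2) * eLpNorm f 2 μ ^ (2 : ℝ)) ^ (1 / r) := by gcongr
    _ = _ := by
      rw [ENNReal.mul_rpow_of_nonneg _ _ (by positivity), ← ENNReal.rpow_mul, ← ENNReal.rpow_mul, mul_comm]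
      congr 2
      · ring
      · field_simp

/-- Interpolation between a bounded `L²` norm and an integrable `L^∞` norm. -/
theorem mixedNorm_le_of_lintegral_le {u : ℝ → L2Field} {S : ℝ → ℝ≥0∞} {A B : ℝ≥0∞} (hA : A ≠ ⊤)
    (h2 : ∀ t, 0 < t → eLpNorm (u t) 2 volume ≤ A) (htop : ∀ t, 0 < t → eLpNorm (u t) ⊤ volume ≤ S t)
    (hS : ∀ t, 0 < t → S t ≤ A) (hint : ∫⁻ t in Ioi 0, S t ≤ A * B)
    {p q : ℝ≥0∞} (hp : 1 ≤ p) (hq : 2 ≤ q) (hpq : p⁻¹ + 2 * q⁻¹ ≤ 1) :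
    mixedNorm p q u ≤ A * B ^ p⁻¹.toReal := by
  have hpi : p⁻¹ ≠ ⊤ := ENNReal.inv_ne_top.2 (one_pos.trans_le hp).ne'
  have hqi : 2 * q⁻¹ ≠ ⊤ := ENNReal.mul_ne_top (by simp) (ENNReal.inv_ne_top.2 (two_pos.trans_le hq).ne')
  set a := p⁻¹.toReal with ha
  set b := 2 * q⁻¹.toReal with hb
  have ha0 : 0 ≤ a := ENNReal.toReal_nonneg
  have hb0 : 0 ≤ b := mul_nonneg (by norm_num) ENNReal.toReal_nonneg
  have hab : a + b ≤ 1 := by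
    have := ENNReal.toReal_mono ENNReal.one_ne_top hpq
    rw [ENNReal.toReal_add hpi hqi, ENNReal.toReal_mul] at this
    simpa only [ENNReal.toReal_one, ENNReal.toReal_ofNat] using this
  -- Only the power `a = 1/p` of `S` is integrated in time. The surplus `1 - b - a`, nonnegative by
  -- the admissibility condition, is absorbed by `S ≤ A`.
  have key : ∀ t, 0 < t → eLpNorm (u t) q volume ≤ A ^ (1 - a) * S t ^ a := fun t ht => by
    calc eLpNorm (u t) q volume
        ≤ eLpNorm (u t) 2 volume ^ b * eLpNorm (u t) ⊤ volume ^ (1 - b) :=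
          eLpNorm_le_rpow_mul_rpow (Lp.aestronglyMeasurable (u t)) hq
      _ ≤ A ^ b * S t ^ (1 - b) := by
          gcongr
          · exact h2 t ht
          · linarith
          · exact htop t ht
      _ = A ^ b * (S t ^ (1 - b - a) * S t ^ a) := by
          rw [← ENNReal.rpow_add_of_nonneg _ _ (by linarith) ha0]; congr 2; ring
      _ ≤ A ^ b * (A ^ (1 - b - a) * S t ^ a) := by
          gcongr
          · linarith
          · exact hS t ht
      _ = A ^ (1 - a) * S t ^ a := by
          rw [← mul_assoc, ← ENNReal.rpow_add_of_nonneg _ _ hb0 (by linarith)]; congr 2; ring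
  have hmono : mixedNorm p q u ≤ eLpNorm (fun t => A ^ (1 - a) * S t ^ a) p (volume.restrict (Ioi 0)) := by
    refine eLpNorm_mono_enorm_ae ?_
    filter_upwards [ae_restrict_mem measurableSet_Ioi] with t ht
    simpa using key t ht
  refine hmono.trans ?_
  rcases eq_or_ne p ⊤ with rfl | hpt
  · have h0 : a = 0 := by simp [ha]
    rw [h0]
    simp only [sub_zero, ENNReal.rpow_one, ENNReal.rpow_zero, mul_one, eLpNorm_exponent_top]
    refine eLpNormEssSup_le_of_ae_enorm_bound (.of_forall fun t => by simp)
  have hp0 : p ≠ 0 := (one_pos.trans_le hp).ne'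
  set r := p.toReal with hr
  have hr0 : 0 < r := ENNReal.toReal_pos hp0 hpt
  have har : a = r⁻¹ := ENNReal.toReal_inv p
  rw [eLpNorm_eq_lintegral_rpow_enorm_toReal hp0 hpt, ← hr]
  have e : ∀ t, ‖A ^ (1 - a) * S t ^ a‖ₑ ^ r = (A ^ (1 - a)) ^ r * S t := fun t => by
    rw [enorm_eq_self, ENNReal.mul_rpow_of_nonneg _ _ hr0.le, ← ENNReal.rpow_mul (S t), har,
      inv_mul_cancel₀ hr0.ne', ENNReal.rpow_one]
  have hAr : (A ^ (1 - a)) ^ r ≠ ⊤ :=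
    ENNReal.rpow_ne_top_of_nonneg hr0.le (ENNReal.rpow_ne_top_of_nonneg (by linarith) hA)
  simp_rw [e]
  rw [lintegral_const_mul' _ _ hAr, ENNReal.mul_rpow_of_nonneg _ _ (by positivity), ← ENNReal.rpow_mul,
    mul_one_div_cancel hr0.ne', ENNReal.rpow_one, one_div, ← har]
  calc A ^ (1 - a) * (∫⁻ t in Ioi 0, S t) ^ a ≤ A ^ (1 - a) * (A * B) ^ a := by gcongr
    _ = A * B ^ a := by
      rw [ENNReal.mul_rpow_of_nonneg _ _ ha0, ← mul_assoc, ← ENNReal.rpow_add_of_nonneg _ _ (by linarith) ha0]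
      simp

theorem BandLimited.continuous_fourierInv_cexp {ρ Λ : ℝ} {f lam : Plane → ℂ} (hf : BandLimited ρ f)
    (hm : Measurable lam) (hΛ : ∀ ξ, ‖ξ‖ ≤ ρ → ‖lam ξ‖ ≤ Λ) (x : Plane) :
    Continuous fun t : ℝ => 𝓕⁻ (fun ξ => Complex.exp (t * lam ξ) * f ξ) x := by
  simp only [Real.fourierInv_eq']
  refine continuous_iff_continuousAt.2 fun t₀ => ?_
  refine continuousAt_of_dominated (bound := fun ξ => Real.exp ((|t₀| + 1) * Λ) * ‖f ξ‖) ?_ ?_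
    (hf.integrable.norm.const_mul _) ?_
  · have hc : Continuous fun ξ : Plane => Complex.exp (↑(2 * Real.pi * ⟪ξ, x⟫_ℝ) * Complex.I) := by fun_prop
    exact .of_forall fun t => hc.aestronglyMeasurable.smul (hf.cexp_mul hm hΛ t).memLp.1
  · filter_upwards [Metric.ball_mem_nhds t₀ one_pos] with t ht
    refine .of_forall fun ξ => ?_
    rw [norm_smul, Complex.norm_exp_ofReal_mul_I, one_mul, norm_mul]
    rcases le_or_gt ‖ξ‖ ρ with h | h
    · refine mul_le_mul_of_nonneg_right ?_ (norm_nonneg _)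
      rw [Complex.norm_exp]
      refine Real.exp_le_exp.2 ((Complex.re_le_norm _).trans ?_)
      rw [norm_mul, Complex.norm_real, Real.norm_eq_abs]
      have h1 : |t| ≤ |t₀| + 1 := by
        rw [Metric.mem_ball, Real.dist_eq] at ht
        have := abs_sub_abs_le_abs_sub t t₀
        linarith
      exact mul_le_mul h1 (hΛ ξ h) (norm_nonneg _) (by positivity)
    · simp [hf.eq_zero ξ h]
  · exact .of_forall fun ξ => by fun_prop

/-! ### Norm bounds for the flow of one mode -/

namespace RossbyMode

variable {n : ℤ} {σ ρ : ℝ} {f : Fin 3 → Plane → ℂ}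

/-- The sum of the sup norms of the components of the complex amplitude of the flow. -/
def amplitude (n : ℤ) (σ : ℝ) (f : Fin 3 → Plane → ℂ) (Ω t : ℝ) : ℝ≥0∞ :=
  ∑ i, ⨆ x, ‖𝓕⁻ (fun ξ => Complex.exp (t * rossbySymbol n (σ * Ω) ξ) * f i ξ) x‖ₑ

/-- An uncountable supremum of functions continuous in `t` is lower semicontinuous, hence
measurable. -/
theorem measurable_iSup_fourierInv_cexp (hf : RossbyMode n σ ρ f) (Ω : ℝ) (i : Fin 3) :
    Measurable fun t : ℝ => ⨆ x, ‖𝓕⁻ (fun ξ => Complex.exp (t * rossbySymbol n (σ * Ω) ξ) * f i ξ) x‖ₑ :=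
  (lowerSemicontinuous_iSup fun x => ((hf.band i).continuous_fourierInv_cexp (measurable_rossbySymbol _ _)
    (fun ξ hξ => norm_rossbySymbol_le n (σ * Ω) ξ hξ) x).enorm.lowerSemicontinuous).measurable

theorem measurable_amplitude (hf : RossbyMode n σ ρ f) (Ω : ℝ) : Measurable (amplitude n σ f Ω) :=
  Finset.measurable_fun_sum _ fun i _ => hf.measurable_iSup_fourierInv_cexp Ω i

theorem norm_cexp_mul_le (Ω : ℝ) {t : ℝ} (ht : 0 ≤ t) (i : Fin 3) (ξ : Plane) :
    ‖Complex.exp (t * rossbySymbol n (σ * Ω) ξ) * f i ξ‖ ≤ ‖f i ξ‖ := by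
  rw [norm_mul, norm_cexp_rossbySymbol]
  exact mul_le_of_le_one_left (norm_nonneg _) (Real.exp_le_one_iff.2 (neg_nonpos.2 (by positivity)))

theorem eLpNorm_flow_two_le (hf : RossbyMode n σ ρ f) (Ω : ℝ) {t : ℝ} (ht : 0 ≤ t) :
    eLpNorm (hf.flow Ω t) 2 volume ≤ ∑ i, eLpNorm (f i) 2 volume := by
  rw [flow, bandL2_eq_sum, ← Lp.enorm_def]
  refine (enorm_sum_le _ _).trans (Finset.sum_le_sum fun i _ => ?_)
  refine (enorm_le_iff_norm_le.2 (norm_synthCLM_le n i _)).trans ?_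
  rw [Lp.enorm_def, eLpNorm_congr_ae (hf.band_cexp Ω t i).memLp.coeFn_toLp]
  exact eLpNorm_mono fun ξ => norm_cexp_mul_le Ω ht i ξ

theorem eLpNorm_flow_top_le (hf : RossbyMode n σ ρ f) (Ω t : ℝ) :
    eLpNorm (hf.flow Ω t) ⊤ volume ≤ amplitude n σ f Ω t := by
  rw [flow, bandL2, eLpNorm_congr_ae (memLp_bandField (hf.band_cexp Ω t) n).coeFn_toLp, eLpNorm_exponent_top]
  refine eLpNormEssSup_le_of_ae_enorm_bound (.of_forall fun p => ?_)
  rw [bandField_eq_sum]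
  refine (enorm_sum_le _ _).trans (Finset.sum_le_sum fun i _ => ?_)
  refine le_trans ?_ (le_iSup _ p.1)
  refine enorm_le_iff_norm_le.2 ?_
  rw [PiLp.norm_single]
  refine (Complex.abs_re_le_norm _).trans ?_
  rw [bandFn, norm_mul, norm_fourier_apply, one_mul]

theorem amplitude_le (hf : RossbyMode n σ ρ f) (Ω : ℝ) {t : ℝ} (ht : 0 ≤ t) :
    amplitude n σ f Ω t ≤
      ∑ i, eLpNorm (f i) 2 volume * volume (Metric.closedBall (0 : Plane) ρ) ^ (1 / 2 : ℝ) := by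
  refine Finset.sum_le_sum fun i _ => iSup_le fun x => ?_
  refine le_trans ?_ (hf.band i).lintegral_enorm_le
  have h1 := norm_fourierInv_le (fun ξ => Complex.exp (t * rossbySymbol n (σ * Ω) ξ) * f i ξ) x
  rw [integral_norm_eq_lintegral_enorm (hf.band_cexp Ω t i).memLp.1] at h1
  have h2 : ∫⁻ ξ, ‖Complex.exp (t * rossbySymbol n (σ * Ω) ξ) * f i ξ‖ₑ ≤ ∫⁻ ξ, ‖f i ξ‖ₑ :=
    lintegral_mono fun ξ => enorm_le_iff_norm_le.2 (norm_cexp_mul_le Ω ht i ξ)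
  have h3 : ∫⁻ ξ, ‖f i ξ‖ₑ ≠ ⊤ := (hf.band i).integrable.2.ne
  rw [← ofReal_norm]
  exact (ENNReal.ofReal_le_of_le_toReal h1).trans h2

/-- The dispersive bound is applied to each component with `σ Ω`, whose bracket is that of `Ω` since
`σ² = 1`. -/
theorem lintegral_amplitude_le (hf : RossbyMode n σ ρ f) (Ω : ℝ) {C : ℝ}
    (hC : ∀ (Ω : ℝ) (f : Plane → ℂ), MemLp f 2 volume → (∀ ξ, ρ < ‖ξ‖ → f ξ = 0) →
      ∫⁻ t in Ioi (0 : ℝ), ⨆ x, ‖𝓕⁻ (fun ξ => Complex.exp (t * rossbySymbol n Ω ξ) * f ξ) x‖ₑ ≤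
        ENNReal.ofReal (C * japaneseBracket Ω ^ (-(1 / 4) : ℝ)) * eLpNorm f 2 volume) :
    ∫⁻ t in Ioi 0, amplitude n σ f Ω t ≤
      ∑ i, ENNReal.ofReal (C * japaneseBracket Ω ^ (-(1 / 4) : ℝ)) * eLpNorm (f i) 2 volume := by
  have hj : japaneseBracket (σ * Ω) = japaneseBracket Ω := by
    rw [japaneseBracket, japaneseBracket, sq_abs, sq_abs, mul_pow, hf.sq, one_mul]
  simp only [amplitude]
  rw [lintegral_finsetSum _ fun i _ => hf.measurable_iSup_fourierInv_cexp Ω i]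
  refine Finset.sum_le_sum fun i _ => ?_
  rw [← hj]
  exact hC (σ * Ω) (f i) (hf.band i).memLp (hf.band i).eq_zero

end RossbyMode

/-- The 9 is three components times the factor 3 in the profile bound; the summand 1 keeps the final
constant positive even when there are no frequencies. -/
theorem sum_ofReal_mul_le {ι : Type*} [Fintype ι] {c d : ι → ℝ} (hc : ∀ x, 0 ≤ c x) (hcd : ∀ x, c x ≤ d x)
    {r : ℝ} (hr : 0 ≤ r) :
    ∑ x, ∑ _i : Fin 3, ENNReal.ofReal (c x) * ENNReal.ofReal (3 * r) ≤
      ENNReal.ofReal ((9 * ∑ x, d x + 1) * r) := by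
  have h1 : ∀ x, ∑ _i : Fin 3, ENNReal.ofReal (c x) * ENNReal.ofReal (3 * r) = ENNReal.ofReal (9 * c x * r) := by
    intro x
    rw [Finset.sum_const, Finset.card_univ, Fintype.card_fin, nsmul_eq_mul, ← ENNReal.ofReal_mul (hc x),
      show ((3 : ℕ) : ℝ≥0∞) = ENNReal.ofReal 3 by norm_num, ← ENNReal.ofReal_mul (by norm_num)]
    congr 1; ring
  simp_rw [h1]
  rw [← ENNReal.ofReal_sum_of_nonneg fun x _ => by have := hc x; positivity]
  refine ENNReal.ofReal_le_ofReal ?_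
  rw [← Finset.sum_mul, ← Finset.mul_sum]
  have h2 : ∑ x, c x ≤ ∑ x, d x := Finset.sum_le_sum fun x _ => hcd x
  gcongr
  linarith

end

/-! ### Assembly of the estimate -/

theorem corollary2p4 (R : ℝ) (hR : 0 < R) :
    ∃ C : ℝ, 0 < C ∧
      ∀ (Ω : ℝ) (u₀ : L2Field),
        HasZeroVerticalMean u₀ → IsDivFree u₀ → FourierSupportedIn R u₀ →
        ∃ u : ℝ → L2Field, IsRossbySolution Ω u₀ u ∧
          (∀ v : ℝ → L2Field, IsRossbySolution Ω u₀ v → EqOn v u (Ici 0)) ∧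
          ∀ p q : ℝ≥0∞, 1 ≤ p → 2 ≤ q → p⁻¹ + 2 * q⁻¹ ≤ 1 →
            mixedNorm p q u ≤
              ENNReal.ofReal (C * japaneseBracket Ω ^ (-(p⁻¹.toReal / 4)) * ‖u₀‖) := by
  set V := volume (Metric.closedBall (0 : Plane) R) ^ (1 / 2 : ℝ) with hV
  have hVt : V ≠ ⊤ := ENNReal.rpow_ne_top_of_nonneg (by norm_num) measure_closedBall_lt_top.ne
  have hone : ∀ n : verticalFrequencies R, (1 : ℝ) ≤ |((n : ℤ) : ℝ)| := fun n => by
    exact_mod_cast Int.one_le_abs (Finset.ne_of_mem_erase n.2)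
  choose D hD0 hD using fun n : verticalFrequencies R => lintegral_iSup_fourierInv_le (hone n) hR.le
  -- One number dominating the three constants of a mode: 1 for the `L²` bound, `V` for the sup
  -- bound uniform in time, `D` for the time-integrated one. Interpolation requires the same `A` in
  -- all three.
  set d : verticalFrequencies R × Bool → ℝ := fun x => 1 + V.toReal + D x.1 with hd
  have hV0 : 0 ≤ V.toReal := ENNReal.toReal_nonneg
  have hd0 : ∀ x, 0 ≤ d x := fun x => by have := hD0 x.1; positivity
  have hsum0 : 0 ≤ ∑ x, d x := Finset.sum_nonneg fun x _ => hd0 x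
  refine ⟨9 * ∑ x, d x + 1, by positivity, fun Ω u₀ hmean hdiv hsupp => ?_⟩
  obtain ⟨g, hg, hdec, hgn⟩ := exists_mode_decomposition hR hmean hdiv hsupp
  have hsol : IsRossbySolution Ω u₀ fun t => ∑ x, (hg x).flow Ω t := by
    rw [hdec]
    exact IsRossbySolution.sum Finset.univ fun x _ => (hg x).isRossbySolution Ω
  refine ⟨_, hsol, fun v hv => hsol.eqOn hv, fun p q hp hq hpq => ?_⟩
  have hJ : 0 < japaneseBracket Ω := one_pos.trans_le (one_le_japaneseBracket Ω)
  have h2 : ∀ t, 0 < t → eLpNorm (∑ x, (hg x).flow Ω t : L2Field) 2 volume ≤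
      ENNReal.ofReal ((9 * ∑ x, d x + 1) * ‖u₀‖) := fun t ht => by
    refine le_trans ?_ (sum_ofReal_mul_le (c := fun _ => 1) (fun _ => zero_le_one)
      (fun x => by have := hD0 x.1; simp only [hd]; linarith) (norm_nonneg u₀))
    rw [← Lp.enorm_def]
    refine (enorm_sum_le _ _).trans (Finset.sum_le_sum fun x _ => ?_)
    rw [Lp.enorm_def]
    refine ((hg x).eLpNorm_flow_two_le Ω ht.le).trans (Finset.sum_le_sum fun i _ => ?_)
    rw [ENNReal.ofReal_one, one_mul]
    exact hgn x.1 x.2 i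
  have htop : ∀ t, 0 < t → eLpNorm (∑ x, (hg x).flow Ω t : L2Field) ⊤ volume ≤
      ∑ x : verticalFrequencies R × Bool, RossbyMode.amplitude x.1 (polarSign x.2) (g x.1 x.2) Ω t := fun t _ => by
    rw [eLpNorm_congr_ae (Lp.coeFn_finsetSum Finset.univ fun x => (hg x).flow Ω t)]
    refine (eLpNorm_sum_le (fun x _ => Lp.aestronglyMeasurable _) le_top).trans ?_
    exact Finset.sum_le_sum fun x _ => (hg x).eLpNorm_flow_top_le Ω t
  have hS : ∀ t, 0 < t → ∑ x : verticalFrequencies R × Bool,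
      RossbyMode.amplitude x.1 (polarSign x.2) (g x.1 x.2) Ω t ≤
        ENNReal.ofReal ((9 * ∑ x, d x + 1) * ‖u₀‖) := fun t ht => by
    refine le_trans ?_ (sum_ofReal_mul_le (c := fun _ => V.toReal) (fun _ => hV0)
      (fun x => by have := hD0 x.1; simp only [hd]; linarith) (norm_nonneg u₀))
    refine Finset.sum_le_sum fun x _ => ((hg x).amplitude_le Ω ht.le).trans (Finset.sum_le_sum fun i _ => ?_)
    rw [ENNReal.ofReal_toReal hVt, mul_comm]
    gcongr
    exact hgn x.1 x.2 i
  have hint : ∫⁻ t in Ioi 0, ∑ x : verticalFrequencies R × Bool,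
      RossbyMode.amplitude x.1 (polarSign x.2) (g x.1 x.2) Ω t ≤
        ENNReal.ofReal ((9 * ∑ x, d x + 1) * ‖u₀‖) * ENNReal.ofReal (japaneseBracket Ω ^ (-(1 / 4) : ℝ)) := by
    rw [lintegral_finsetSum _ fun x _ => (hg x).measurable_amplitude Ω]
    refine le_trans ?_ (mul_le_mul_left (sum_ofReal_mul_le (c := fun x => D x.1) (fun x => hD0 x.1)
      (fun x => by simp only [hd]; linarith) (norm_nonneg u₀)) _)
    rw [Finset.sum_mul]
    refine Finset.sum_le_sum fun x _ => ((hg x).lintegral_amplitude_le Ω (hD x.1)).trans ?_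
    rw [Finset.sum_mul]
    refine Finset.sum_le_sum fun i _ => ?_
    rw [ENNReal.ofReal_mul (hD0 x.1), mul_right_comm]
    gcongr
    exact hgn x.1 x.2 i
  -- Here `B = ⟨Ω⟩^{-1/4}`, and its power `1/p` is the asserted rate.
  refine (mixedNorm_le_of_lintegral_le ENNReal.ofReal_ne_top h2 htop hS hint hp hq hpq).trans (le_of_eq ?_)
  rw [ENNReal.ofReal_rpow_of_nonneg (by positivity) ENNReal.toReal_nonneg, ← Real.rpow_mul hJ.le,
    ← ENNReal.ofReal_mul (by positivity), mul_right_comm]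
  congr 4
  ring
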